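/- Let $N\ge 1$ and $n\ge 1$ be integers and, for $1\le j\le n$, let $f_j=\sum_{m\ge 0}a^{(j)}_m q^m\in M_{k_j}(\Gamma_0(N),\chi_j)$ ($k_j\in\mathbb Z$, $\chi_j$ a Dirichlet character modulo $N$, $q=e^{2\pi i z}$). Let $\alpha_2,\dots,\alpha_n$ be positive integers. The multiple modular $L$-function is defined, for $\operatorname{Re}(s_1)$ sufficiently large, by $$L\binom{f_1,\dots,f_n}{s_1,\dots,s_n}=(-2\pi i)^{-(s_1+\dots+s_n)}\sum_{m_1,\dots,m_n>0}\frac{a^{(1)}_{m_1}\cdots a^{(n)}_{m_n}}{(m_1+\dots+m_n)^{s_1}(m_2+\dots+m_n)^{s_2}\cdots m_n^{s_n}}$$ and, as a function of $s_1$, by meromorphic continuation. The modular iterated integral is $$I_{i\infty}^0\binom{f_1,\dots,f_n}{s_1,\dots,s_n}=\int_{i\infty}^0 f_1(z_1)z_1^{s_1}\frac{dz_1}{z_1}\int_{i\infty}^{z_1}f_2(z_2)z_2^{s_2}\frac{dz_2}{z_2}\cdots\int_{i\infty}^{z_{n-1}}f_n(z_n)z_n^{s_n}\frac{dz_n}{z_n},$$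 understood by analytic continuation in the exponents: with $b=i/\sqrt N$ it is $\sum_{j=0}^n I_b^0\binom{f_1,\dots,f_j}{s_1,\dots,s_j}\,I_{i\infty}^b\binom{f_{j+1},\dots,f_n}{s_{j+1},\dots,s_n}$, where $I_{i\infty}^b$ and $I_b^0$, the analogous iterated integrals with these end points, are continued meromorphically from their domains of convergence (powers are taken with the principal branch). Then, as a meromorphic function of $s\in\mathbb C$, $L\binom{f_1,\dots,f_n}{s,\alpha_2,\dots,\alpha_n}$ is a linear combination of modular iterated integrals: there are finitely many index tuples $i_1<\dots<i_r$ in $\{1,\dots,n\}$ ($r\ge 1$), integers $t\ge 0$, positive integers $\beta_2,\dots,\beta_r$ and rational functions $R$, each the quotient of a polynomial with coefficients in $\mathbb Q[a_0^{(1)},\dots,a_0^{(n)}]$ by a nonzero polynomial with rational coefficients (all of them, with $r$, depending on the term, and none on $s$), such that $$L\binom{f_1,\dots,f_n}{s,\alpha_2,\dots,\alpha_n}=\frac1{\Gamma(s)}\sum_{\text{terms}}R(s)\,I_{i\infty}^0\binom{f_{i_1},\dots,f_{i_r}}{s+t,\beta_2,\dots,\beta_r}.$$ Here every integral on the right-hand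 side is a meromorphic function of $s\in\mathbb C$; for $\operatorname{Re}(s)$ sufficiently large the series for $L$ converges absolutely and no integral and no chosen denominator on the right-hand side is singular (respectively zero); and the identity holds at every $s\in\mathbb C$ at which all integrals are holomorphic and all denominators are nonzero. -/

import Mathlib

open UpperHalfPlane hiding I
open Complex Filter MeasureTheory
open scoped MatrixGroups ModularForm CongruenceSubgroup

noncomputable section

namespace MultipleModular

/-- `f ∈ M_k(Γ₀(N), χ)`, for a modular form `f` of weight `k` on `Γ₁(N)`: one has
`f ∣[k] γ = χ(d) f` for every `γ = (a, b; c, d) ∈ Γ₀(N)`. (Holomorphy on the upper half-plane and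
at all cusps is part of `ModularForm`, and invariance under `Γ₁(N)` is implied by this formula.) -/
def HasNebentypus (N : ℕ) {k : ℤ} (χ : DirichletCharacter ℂ N)
    (f : ModularForm (CongruenceSubgroup.Gamma1 N : Subgroup (GL (Fin 2) ℝ)) k) : Prop :=
  ∀ γ ∈ CongruenceSubgroup.Gamma0 N,
    (f : ℍ → ℂ) ∣[k] γ = χ ((γ 1 1 : ℤ) : ZMod N) • (f : ℍ → ℂ)

/-- The `m`-th Fourier coefficient `a_m` in `f = ∑ a_m q^m`, `q = exp(2πiz)`. -/
def fourierCoeff (f : ℍ → ℂ) (m : ℕ) : ℂ := (UpperHalfPlane.qExpansion 1 f).coeff m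

/-! ### Meromorphic continuation in one variable -/

/-- The meromorphic continuation to `ℂ` of a function `g` given near the end `l` of the plane
(below: a half-plane `Re w > c` or `Re w < c`). It is normalised so as to take its limit value at
each point where it has no pole, and the value `0` at poles; this makes it unique. If there is no
continuation, it is `0`. -/
def meromorphicContinuation (l : Filter ℂ) (g : ℂ → ℂ) : ℂ → ℂ :=
  open Classical in
  if h : ∃ G : ℂ → ℂ, MeromorphicNFOn G Set.univ ∧ G =ᶠ[l] g then h.choose else 0

/-- `Re w → +∞`. -/
def rightEnd : Filter ℂ := comap Complex.re atTop

/-- `Re w → -∞`. -/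
def leftEnd : Filter ℂ := comap Complex.re atBot

/-! ### Iterated integrals along the imaginary axis

The data `(f₁, …, fₙ; s₁, …, sₙ)` is a list of pairs `(f_j, s_j)`. Powers `z ^ s` are those of the
principal branch, which is holomorphic on the upper half-plane. The path is the imaginary axis,
parametrised by `z = iu`, `u > 0`. -/

/-- The integrand `f(z) z^s dz/z` at `z = iu`, as a multiple of `du`. -/
def integrand (f : ℍ → ℂ) (s : ℂ) (u : ℝ) : ℂ :=
  f (ofComplex (u * I)) * (u * I) ^ (s - 1) * I

/-- `I_{i∞}^{it}(f₁, …, fₙ; s₁, …, sₙ)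
  = ∫_{i∞}^{it} f₁(z₁) z₁^{s₁} dz₁/z₁ ∫_{i∞}^{z₁} f₂(z₂) z₂^{s₂} dz₂/z₂ ⋯`. For functions `f_j`
bounded near `i∞` the integrals converge absolutely if `Re (s_j + ⋯ + s_n) < 0` for all `j`. -/
def integralFromInfinity : List ((ℍ → ℂ) × ℂ) → ℝ → ℂ
  | [], _ => 1
  | (f, s) :: l, t => -∫ u in Set.Ioi t, integrand f s u * integralFromInfinity l u

/-- `I_{ia}^{it}(f₁, …, fₙ; s₁, …, sₙ)`, with `0 < a` and `0 ≤ t`. -/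
def integralFromPoint (a : ℝ) : List ((ℍ → ℂ) × ℂ) → ℝ → ℂ
  | [], _ => 1
  | (f, s) :: l, t => ∫ u in a..t, integrand f s u * integralFromPoint a l u

/-- Add `w` to the first exponent. -/
def shiftFirst (w : ℂ) : List ((ℍ → ℂ) × ℂ) → List ((ℍ → ℂ) × ℂ)
  | [] => []
  | (f, s) :: l => (f, s + w) :: l

/-- Add `w` to the last exponent. -/
def shiftLast (w : ℂ) : List ((ℍ → ℂ) × ℂ) → List ((ℍ → ℂ) × ℂ)
  | [] => []
  | [(f, s)] => [(f, s + w)]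
  | p :: q :: l => p :: shiftLast w (q :: l)

/-- The analytic continuation of `I_{i∞}^{i/√N}`: for fixed `(s₁, …, sₙ)` the integral at
`(s₁, …, s_{n-1}, sₙ + w)` converges for `Re w ≪ 0`, and it is continued to `w = 0`. -/
def continuedFromInfinity (N : ℕ) (l : List ((ℍ → ℂ) × ℂ)) : ℂ :=
  meromorphicContinuation leftEnd
    (fun w => integralFromInfinity (shiftLast w l) (1 / Real.sqrt N)) 0

/-- The analytic continuation of `I_{i/√N}^0`: for fixed `(s₁, …, sₙ)` the integral at
`(s₁ + w, s₂, …, sₙ)` converges for `Re w ≫ 0`, and it is continued to `w = 0`. -/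
def continuedToZero (N : ℕ) (l : List ((ℍ → ℂ) × ℂ)) : ℂ :=
  meromorphicContinuation rightEnd
    (fun w => integralFromPoint (1 / Real.sqrt N) (shiftFirst w l) 0) 0

/-- The modular iterated integral `I_{i∞}^0(f₁, …, fₙ; s₁, …, sₙ)`. The path is cut at `i/√N` by the
composition-of-paths formula (the outer variables `z₁, …, z_j` run from `i/√N` to `0`, the inner
ones `z_{j+1}, …, z_n` from `i∞` to `i/√N`) and the two factors are given by analytic continuation
in the exponents. -/
def modularIteratedIntegral (N : ℕ) {n : ℕ} (f : Fin n → ℍ → ℂ) (s : Fin n → ℂ) : ℂ :=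
  let l := List.ofFn fun j => (f j, s j)
  ∑ j ∈ Finset.range (n + 1), continuedToZero N (l.take j) * continuedFromInfinity N (l.drop j)

/-! ### Multiple modular `L`-functions -/

/-- The term of the multiple modular `L`-series with index `(m₁, …, mₙ)`. -/
def multipleLTerm {n : ℕ} (f : Fin n → ℍ → ℂ) (s : Fin n → ℂ) (m : Fin n → ℕ+) : ℂ :=
  ∏ j, fourierCoeff (f j) (m j) / (∑ i ∈ Finset.Ici j, (m i : ℂ)) ^ s j

/-- The multiple modular `L`-series
`(-2πi)^{-(s₁+⋯+sₙ)} ∑ a_{m₁} ⋯ a_{mₙ} / ((m₁+⋯+mₙ)^{s₁} (m₂+⋯+mₙ)^{s₂} ⋯ mₙ^{sₙ})`. -/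
def multipleLSeries {n : ℕ} (f : Fin n → ℍ → ℂ) (s : Fin n → ℂ) : ℂ :=
  (-2 * Real.pi * I) ^ (-∑ j, s j) * ∑' m : Fin n → ℕ+, multipleLTerm f s m

/-- The tuple `(s, α₂, …, α_{n+1})`. -/
def exponents {n : ℕ} (s : ℂ) (α : Fin n → ℕ+) : Fin (n + 1) → ℂ :=
  Fin.cons s fun i => (α i : ℂ)

/-- The multiple modular `L`-function `L(f₁, …, f_{n+1}; s, α₂, …, α_{n+1})` for `s ∈ ℂ`: the
meromorphic continuation of the series, which converges for `Re s` sufficiently large. -/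
def multipleL {n : ℕ} (f : Fin (n + 1) → ℍ → ℂ) (α : Fin n → ℕ+) : ℂ → ℂ :=
  meromorphicContinuation rightEnd fun s => multipleLSeries f (exponents s α)

/-! ### Linear combinations -/

/-- One term `(num(s) / den(s)) · I_{i∞}^0(f_{i₁}, …, f_{i_r}; s + shift, β₂, …, β_r)`, with
`i₁ < ⋯ < i_r`, `r ≥ 1`, `shift ≥ 0` and positive integers `β₂, …, β_r`, of a linear combination of
modular iterated integrals formed from `f₁, …, f_{n+1}`. -/
structure IntegralTerm (n : ℕ) where
  /-- `r - 1` -/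
  depth : ℕ
  /-- the indices `i₁ < ⋯ < i_r` -/
  index : Fin (depth + 1) ↪o Fin (n + 1)
  shift : ℕ
  /-- the exponents `β₂, …, β_r` -/
  β : Fin depth → ℕ+
  num : Polynomial ℂ
  den : Polynomial ℚ
  den_ne_zero : den ≠ 0

/-- The modular iterated integral in a term, as a function of `s`. -/
def IntegralTerm.integral {n : ℕ} (T : IntegralTerm n) (N : ℕ) (f : Fin (n + 1) → ℍ → ℂ)
    (s : ℂ) : ℂ :=
  modularIteratedIntegral N (fun j => f (T.index j)) (exponents (s + T.shift) T.β)

/-- The rational function of `s` in a term. -/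
def IntegralTerm.coeff {n : ℕ} (T : IntegralTerm n) (s : ℂ) : ℂ :=
  T.num.eval s / Polynomial.aeval s T.den

/-- `s` is neither a pole of the iterated integral nor a zero of the denominator. -/
def IntegralTerm.RegularAt {n : ℕ} (T : IntegralTerm n) (N : ℕ) (f : Fin (n + 1) → ℍ → ℂ)
    (s : ℂ) : Prop :=
  AnalyticAt ℂ (T.integral N f) s ∧ Polynomial.aeval s T.den ≠ 0

end MultipleModular

end

noncomputable section

namespace MultipleModular

open Asymptotics
open scoped Topology Manifold Pointwise ConjAct

/-! ### Meromorphic continuation -/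

/-! Write `z = iu`. For `Re s` large, the series times `Γ(s)` is, up to an elementary factor, the
Mellin transform of the exponential series whose first exponent is `0`
(`hasSum_mellin_multipleExpSeries`). With that exponent equal to `0` the index `m₁` decouples, so
the exponential series is `(f₁(z) - a₀⁽¹⁾) E(z)`, where `E` is the series of `f₂, …, fₙ` with
exponents `α` (`multipleExpSeries_cons_zero`).

Raising the leading exponent of such a series by one amounts to integrating it from `i∞`. Hence `E`
arises from `1` by multiplying by `f_j - a₀⁽ʲ⁾` and integrating `α_j` times, for `j = n, …, 2`.
Partial integration shows that the functions `z ^ t I_{i∞}^z(K)` with positive integral exponents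
span a module over `ℚ[a₀⁽¹⁾, …]` which is closed under integration, and in which multiplying by some
`f_j` before integrating only lengthens the list (`exists_primitive_mem`,
`exists_onAxis_primitive_mem`). So `E` lies in this module, up to a power of `2πi`
(`exists_multipleExpSeries_eq`). The same partial integration with the extra factor `z ^ (s - 1)`
gives an explicit primitive `G` of the Mellin integrand. It is built from iterated integrals with
first exponent `s + t`, from boundary terms that die at `0`, and from coefficients with denominators
`s + t` (`exists_terms_of_mem`). The Mellin integral is minus the limit of `G` at `0`, and this
limit is the required combination of integrals from `i∞` to `0`.

The separate pieces diverge at `i∞`, so they are regularised: `I_{i∞}^z` is a constant times a power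
of `z` plus a rapidly decaying remainder, with denominators the exponent sums of suffixes. This is
the analytic continuation in the last exponent (`continuedFromInfinity_eq`). Constants of
integration are controlled by asymptotics: every primitive used is `z ^ s p(z) + o(1)` with `p` a
polynomial, and for `Re s > 0` the only finite limit of such a function is `0`
(`HasPowerAsymptotics.eq_zero_of_tendsto`).

At the end point `0`, modularity makes each `f_j` a multiple of a power of `z` plus a function
vanishing to infinite order, so truncated Mellin transforms of iterated integrals continue
meromorphically (`hasMellinContinuation_integralFromPoint`). Composition of paths then identifies
the limit at `0` of a regularised integral with the modular iterated integral
(`listIteratedIntegral_properties`). The identity for large `Re s` extends to the plane because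
continuations in normal form are unique (`multipleL_eq_of_terms`). -/

lemma toMeromorphicNFOn_eq_of_analyticAt {G : ℂ → ℂ} (hG : MeromorphicOn G Set.univ) {x : ℂ}
    (hx : AnalyticAt ℂ G x) : toMeromorphicNFOn G Set.univ x = G x := by
  rw [toMeromorphicNFOn_eq_toMeromorphicNFAt hG (Set.mem_univ x),
    toMeromorphicNFAt_eq_self.2 hx.meromorphicNFAt]

/-- The difference has infinite order at one point, hence at every point by connectedness. Normal
form then upgrades agreement on punctured neighbourhoods to agreement everywhere. -/
lemma MeromorphicNFOn.eq_of_eventuallyEq_nhds {G₁ G₂ : ℂ → ℂ}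
    (h₁ : MeromorphicNFOn G₁ Set.univ) (h₂ : MeromorphicNFOn G₂ Set.univ) {x : ℂ}
    (h : G₁ =ᶠ[nhds x] G₂) : G₁ = G₂ := by
  have hm : MeromorphicOn (G₁ - G₂) Set.univ := h₁.meromorphicOn.sub h₂.meromorphicOn
  have hx : meromorphicOrderAt (G₁ - G₂) x = ⊤ := by
    rw [meromorphicOrderAt_eq_top_iff]
    filter_upwards [h.filter_mono nhdsWithin_le_nhds] with z hz
    simp [hz]
  funext y
  have hy : meromorphicOrderAt (G₁ - G₂) y = ⊤ := by
    by_contra hy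
    exact hm.meromorphicOrderAt_ne_top_of_isPreconnected isPreconnected_univ
      (Set.mem_univ y) (Set.mem_univ x) hy hx
  rw [meromorphicOrderAt_eq_top_iff] at hy
  refine ((MeromorphicNFAt.eventuallyEq_nhdsNE_iff_eventuallyEq_nhds
    (h₁ (Set.mem_univ y)) (h₂ (Set.mem_univ y))).1 ?_).eq_of_nhds
  filter_upwards [hy] with z hz
  simpa [sub_eq_zero] using hz

/-- Every set of the filter is a neighbourhood of some point. -/
def HasInteriorPoints (l : Filter ℂ) : Prop := ∀ s ∈ l, ∃ x, s ∈ nhds x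

lemma hasInteriorPoints_rightEnd : HasInteriorPoints rightEnd := by
  intro s hs
  obtain ⟨t, ht, hts⟩ := mem_comap.1 hs
  obtain ⟨a, ha⟩ := mem_atTop_sets.1 ht
  refine ⟨((a + 1 : ℝ) : ℂ), Filter.mem_of_superset
    ((isOpen_lt continuous_const Complex.continuous_re).mem_nhds (x := ((a + 1 : ℝ) : ℂ))
      (show a < _ by simp)) fun z hz => hts (ha _ (le_of_lt hz))⟩

lemma hasInteriorPoints_leftEnd : HasInteriorPoints leftEnd := by
  intro s hs
  obtain ⟨t, ht, hts⟩ := mem_comap.1 hs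
  obtain ⟨a, ha⟩ := mem_atBot_sets.1 ht
  refine ⟨((a - 1 : ℝ) : ℂ), Filter.mem_of_superset
    ((isOpen_lt Complex.continuous_re continuous_const).mem_nhds (x := ((a - 1 : ℝ) : ℂ))
      (show _ < a by simp)) fun z hz => hts (ha _ (le_of_lt hz))⟩

lemma eventually_rightEnd (σ : ℝ) : ∀ᶠ w in rightEnd, σ < w.re :=
  tendsto_comap.eventually (eventually_gt_atTop σ)

lemma eventually_leftEnd (σ : ℝ) : ∀ᶠ w in leftEnd, w.re < σ :=
  tendsto_comap.eventually (eventually_lt_atBot σ)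

/-- This makes the choice in `meromorphicContinuation` harmless: two continuations agree on a set of
`l`, which is a neighbourhood of some point, so the identity theorem applies. Analyticity of `G` on
the common region ensures that passing to normal form does not change its values there. -/
lemma meromorphicContinuation_eq {l : Filter ℂ} (hl : HasInteriorPoints l) {g G : ℂ → ℂ}
    (hG : MeromorphicOn G Set.univ) (h : ∀ᶠ w in l, AnalyticAt ℂ G w ∧ G w = g w) :
    meromorphicContinuation l g = toMeromorphicNFOn G Set.univ := by
  have hex : ∃ G : ℂ → ℂ, MeromorphicNFOn G Set.univ ∧ G =ᶠ[l] g := by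
    refine ⟨toMeromorphicNFOn G Set.univ, meromorphicNFOn_toMeromorphicNFOn .., ?_⟩
    filter_upwards [h] with w hw
    rw [toMeromorphicNFOn_eq_of_analyticAt hG hw.1, hw.2]
  rw [meromorphicContinuation, dif_pos hex]
  obtain ⟨h₁, h₂⟩ := hex.choose_spec
  have : hex.choose =ᶠ[l] toMeromorphicNFOn G Set.univ := by
    filter_upwards [h, h₂] with w hw hw'
    rw [toMeromorphicNFOn_eq_of_analyticAt hG hw.1, hw.2, hw']
  obtain ⟨x, hx⟩ := hl _ this
  exact MeromorphicNFOn.eq_of_eventuallyEq_nhds h₁ (meromorphicNFOn_toMeromorphicNFOn ..) hx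

lemma meromorphicContinuation_apply {l : Filter ℂ} (hl : HasInteriorPoints l) {g G : ℂ → ℂ}
    (hG : MeromorphicOn G Set.univ) (h : ∀ᶠ w in l, AnalyticAt ℂ G w ∧ G w = g w) {x : ℂ}
    (hx : AnalyticAt ℂ G x) : meromorphicContinuation l g x = G x := by
  rw [meromorphicContinuation_eq hl hG h, toMeromorphicNFOn_eq_of_analyticAt hG hx]

lemma meromorphicContinuation_const {l : Filter ℂ} (hl : HasInteriorPoints l) (c x : ℂ) :
    meromorphicContinuation l (fun _ => c) x = c :=
  meromorphicContinuation_apply hl (G := fun _ => c) (fun _ _ => analyticAt_const.meromorphicAt)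
    (Eventually.of_forall fun _ => ⟨analyticAt_const, rfl⟩) analyticAt_const

/-! ### Integrals depending holomorphically on a parameter -/

/-- No bound on the derivative is needed: Cauchy's estimate on circles of radius `ε / 4` derives one
from the local bound on `g`. -/
lemma differentiableOn_integral_of_bound {α : Type*} [MeasurableSpace α] {μ : Measure α}
    {U : Set ℂ} (hU : IsOpen U) {g : ℂ → α → ℂ}
    (hd : ∀ᵐ u ∂μ, DifferentiableOn ℂ (fun w => g w u) U)
    (hm : ∀ w ∈ U, AEStronglyMeasurable (g w) μ)
    (hb : ∀ w ∈ U, ∃ ε > 0, ∃ B : α → ℝ, Integrable B μ ∧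
      ∀ᵐ u ∂μ, ∀ z ∈ Metric.ball w ε, ‖g z u‖ ≤ B u) :
    DifferentiableOn ℂ (fun w => ∫ u, g w u ∂μ) U := by
  intro w hw
  obtain ⟨ε₁, hε₁, B, hB, hgB⟩ := hb w hw
  obtain ⟨ε₂, hε₂, hεU⟩ := Metric.isOpen_iff.1 hU w hw
  obtain ⟨ε, hε, hle₁, hle₂⟩ : ∃ ε > 0, ε ≤ ε₁ ∧ ε ≤ ε₂ :=
    ⟨min ε₁ ε₂, lt_min hε₁ hε₂, min_le_left .., min_le_right ..⟩
  have hsub : Metric.ball w ε ⊆ U := (Metric.ball_subset_ball hle₂).trans hεU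
  have hcb : ∀ z ∈ Metric.ball w (ε / 2), Metric.closedBall z (ε / 4) ⊆ Metric.ball w ε := by
    intro z hz
    refine Metric.closedBall_subset_ball' ?_
    rw [Metric.mem_ball] at hz
    linarith
  refine (hasDerivAt_integral_of_dominated_loc_of_deriv_le (μ := μ) (F := g)
    (F' := fun z u => deriv (fun w => g w u) z) (bound := fun u => B u / (ε / 4))
    (s := Metric.ball w (ε / 2)) (Metric.ball_mem_nhds w (half_pos hε)) ?_ ?_ ?_ ?_ ?_
    ?_).2.differentiableAt.differentiableWithinAt
  · filter_upwards [hU.mem_nhds hw] with z hz using hm z hz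
  · refine hB.mono' (hm w hw) ?_
    filter_upwards [hgB] with u hu using hu w (Metric.mem_ball_self hε₁)
  -- The derivative in the parameter is measurable in `u` as a limit of difference quotients along a
  -- sequence of real steps tending to `0`.
  · refine aestronglyMeasurable_of_tendsto_ae (atTop : Filter ℕ)
      (f := fun n u => ((ε / 2 / (n + 1) : ℝ) : ℂ)⁻¹ •
        (g (w + ((ε / 2 / (n + 1) : ℝ) : ℂ)) u - g w u)) (fun n => ?_) ?_
    · refine AEStronglyMeasurable.const_smul ((hm _ (hsub ?_)).sub (hm w hw))
        (((ε / 2 / (n + 1) : ℝ) : ℂ)⁻¹)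
      rw [Metric.mem_ball, dist_self_add_left, norm_real, Real.norm_of_nonneg (by positivity)]
      have : ε / 2 / (n + 1) ≤ ε / 2 := div_le_self (by positivity) (by linarith [n.cast_nonneg (α := ℝ)])
      linarith
    · filter_upwards [hd] with u hu
      have h1 := ((hu.differentiableAt (hU.mem_nhds hw)).hasDerivAt).tendsto_slope_zero
      refine h1.comp (tendsto_nhdsWithin_iff.2 ⟨?_, Eventually.of_forall fun n => ?_⟩)
      · have : Tendsto (fun n : ℕ => ε / 2 / ((n : ℝ) + 1)) atTop (nhds 0) :=
          (tendsto_const_div_atTop_nhds_zero_nat (ε / 2)).comp (tendsto_add_atTop_nat 1) |>.congr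
            fun n => by simp
        simpa [Function.comp_def] using (continuous_ofReal.tendsto 0).comp this
      · simp only [Set.mem_compl_iff, Set.mem_singleton_iff, ofReal_eq_zero]
        positivity
  · filter_upwards [hd, hgB] with u hu huB z hz
    refine norm_deriv_le_of_forall_mem_sphere_norm_le (by positivity)
      ((hu.mono hsub).diffContOnCl_ball (hcb z hz)) fun y hy => ?_
    exact huB y (Metric.ball_subset_ball hle₁ (hcb z hz (Metric.sphere_subset_closedBall hy)))
  · exact hB.div_const _
  · filter_upwards [hd] with u hu z hz
    exact (hu.differentiableAt (hU.mem_nhds (hsub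
      (Metric.ball_subset_ball (by linarith) hz)))).hasDerivAt

/-! ### Powers along the imaginary axis -/

lemma axis_ne_zero {u : ℝ} (hu : 0 < u) : (u : ℂ) * I ≠ 0 := by
  simp [hu.ne']

lemma axis_mem_slitPlane {u : ℝ} (hu : 0 < u) : (u : ℂ) * I ∈ slitPlane := by
  simp [mem_slitPlane_iff, hu.ne']

lemma norm_axis_cpow {u : ℝ} (hu : 0 < u) (s : ℂ) :
    ‖((u : ℂ) * I) ^ s‖ = u ^ s.re * Real.exp (-(Real.pi / 2 * s.im)) := by
  rw [norm_cpow_of_ne_zero (axis_ne_zero hu), arg_real_mul I hu, arg_I, Real.exp_neg]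
  simp [abs_of_pos hu, div_eq_mul_inv]

lemma axis_cpow_add {u : ℝ} (hu : 0 < u) (s t : ℂ) :
    ((u : ℂ) * I) ^ (s + t) = ((u : ℂ) * I) ^ s * ((u : ℂ) * I) ^ t :=
  cpow_add _ _ (axis_ne_zero hu)

lemma hasDerivAt_axis_cpow {u : ℝ} (hu : 0 < u) (s : ℂ) :
    HasDerivAt (fun u : ℝ => ((u : ℂ) * I) ^ s) (s * ((u : ℂ) * I) ^ (s - 1) * I) u := by
  have h1 : HasDerivAt (fun z : ℂ => z * I) I (u : ℂ) := by
    simpa using (hasDerivAt_id (u : ℂ)).mul_const I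
  exact (h1.cpow_const (c := s) (axis_mem_slitPlane hu)).comp_ofReal

lemma continuousOn_axis_cpow (s : ℂ) :
    ContinuousOn (fun u : ℝ => ((u : ℂ) * I) ^ s) (Set.Ioi 0) := fun _ hu =>
  (hasDerivAt_axis_cpow hu s).continuousAt.continuousWithinAt

lemma differentiable_axis_cpow {u : ℝ} (hu : 0 < u) {a : ℂ → ℂ} (ha : Differentiable ℂ a) :
    Differentiable ℂ fun w => ((u : ℂ) * I) ^ a w := fun w =>
  (ha w).const_cpow (Or.inl (axis_ne_zero hu))

lemma axis_cpow_split {u : ℝ} (hu : 0 < u) (s : ℂ) :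
    ((u : ℂ) * I) ^ s = (u : ℂ) ^ s * I ^ s := by
  rw [cpow_def_of_ne_zero (axis_ne_zero hu), cpow_def_of_ne_zero (ofReal_ne_zero.2 hu.ne'),
    cpow_def_of_ne_zero I_ne_zero, log_ofReal_mul hu I_ne_zero, ofReal_log hu.le, add_mul,
    Complex.exp_add]

/-! ### Functions along the imaginary axis -/

/-- The restriction of `f` to the imaginary axis. -/
def onAxis (f : ℍ → ℂ) (u : ℝ) : ℂ := f (ofComplex (u * I))

/-- The analytic properties of a modular form on the imaginary axis: it is continuous, it tends
rapidly to its zeroth Fourier coefficient at `i∞`, and it differs from a multiple of an integral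
power by a rapidly decaying function at `0`. -/
structure AxisAdmissible (f : ℍ → ℂ) : Prop where
  continuousOn : ContinuousOn (onAxis f) (Set.Ioi 0)
  isBigO_atTop : ∀ M : ℝ, (fun u => onAxis f u - fourierCoeff f 0) =O[atTop] fun u => u ^ M
  isBigO_zero : ∃ (c : ℂ) (k : ℤ), ∀ M : ℝ,
    (fun u => onAxis f u - c * ((u : ℂ) * I) ^ k) =O[𝓝[>] 0] fun u => u ^ M

lemma tendsto_ofComplex_axis_atImInfty :
    Tendsto (fun t : ℝ => ofComplex (t * I)) atTop atImInfty := by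
  rw [atImInfty, tendsto_comap_iff]
  refine tendsto_id.congr' ?_
  filter_upwards [eventually_gt_atTop 0] with t ht
  simp [ofComplex_apply_of_im_pos, ht, ← coe_im]

lemma onAxis_inv {Γ : Subgroup (GL (Fin 2) ℝ)} {k : ℤ} {F : Type*} [FunLike F ℍ ℂ]
    [ModularFormClass F Γ k] (f : F) {t : ℝ} (ht : 0 < t) :
    onAxis f t⁻¹ = I ^ k * t ^ k * onAxis (ModularForm.translate (Γ := Γ) (k := k) f
      (ModularGroup.S : GL (Fin 2) ℝ)) t := by
  rw [ModularForm.coe_translate, onAxis, onAxis, ModularForm.slash_def]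
  suffices f (ofComplex ((t⁻¹ : ℝ) * I)) = I ^ k * t ^ k *
      (f ((ModularGroup.S : GL (Fin 2) ℝ) • ofComplex (t * I)) * ofComplex (t * I) ^ (-k)) by
    simpa [σ, denom] using this
  rw [ofComplex_apply_of_im_pos (by simpa), ofComplex_apply_of_im_pos (by simpa),
    mul_comm (f _), ← mul_assoc, ← mul_zpow, zpow_neg, mul_comm I,
    mul_inv_cancel₀ (zpow_ne_zero _ (by aesop))]
  simp only [one_mul]
  congr 1
  ext
  rw [coe_smul_of_det_pos (by simp)]
  simp [num, denom, div_eq_mul_inv, mul_comm]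

/-! ### Modular forms on the imaginary axis: both ends and Fourier coefficients. -/

section ModularForm

variable {Γ : Subgroup (GL (Fin 2) ℝ)} {k : ℤ} {F : Type*} [FunLike F ℍ ℂ] [Γ.IsArithmetic]

lemma isBigO_onAxis_sub_valueAtInfty (Γ : Subgroup (GL (Fin 2) ℝ)) [Γ.IsArithmetic] (k : ℤ)
    [ModularFormClass F Γ k] (f : F) (r : ℝ) :
    (fun t : ℝ => onAxis f t - valueAtInfty f) =O[atTop] (fun t => t ^ r) := by
  obtain ⟨C, hCpos, hCO⟩ := ModularFormClass.exp_decay_sub_atImInfty' (Γ := Γ) (k := k) f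
  refine (hCO.comp_tendsto tendsto_ofComplex_axis_atImInfty).trans ?_
  refine (EventuallyEq.isBigO ?_).trans (isLittleO_exp_neg_mul_rpow_atTop hCpos r).isBigO
  filter_upwards [eventually_gt_atTop 0] with t ht
  simp [ht, ofComplex_apply_of_im_pos, ← coe_im]

/-- The translate of `f` by `S`, which governs the behaviour of `f` at `0`, is a modular form for
this conjugate group. -/
lemma isArithmetic_conj_S (Γ : Subgroup (GL (Fin 2) ℝ)) [Γ.IsArithmetic] :
    Subgroup.IsArithmetic (ConjAct.toConjAct (ModularGroup.S : GL (Fin 2) ℝ)⁻¹ • Γ) := by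
  convert Subgroup.IsArithmetic.conj Γ ↑(ModularGroup.S⁻¹)
  simp only [ModularGroup.S_inv, ← map_inv]
  ext i j
  fin_cases i <;> fin_cases j <;> simp [ModularGroup.S]

lemma axisAdmissible_of_modularForm [ModularFormClass F Γ k] (f : F)
    (h1 : (1 : ℝ) ∈ Γ.strictPeriods) : AxisAdmissible f where
  continuousOn := by
    unfold onAxis
    have hf : MDiff (f : ℍ → ℂ) := ModularFormClass.holo f
    intro u hu
    have h2 : ContinuousAt (ofComplex : ℂ → ℍ) ((u : ℂ) * I) :=
      (contMDiffAt_ofComplex (n := 1) (by simpa using hu)).continuousAt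
    refine ContinuousAt.continuousWithinAt ?_
    exact (hf.continuous.continuousAt).comp (f := fun u : ℝ => ofComplex ((u : ℂ) * I))
      (ContinuousAt.comp (f := fun u : ℝ => (u : ℂ) * I) h2 (by fun_prop))
  isBigO_atTop M := by
    have := isBigO_onAxis_sub_valueAtInfty Γ k f M
    rwa [← qExpansion_coeff_zero one_pos
      (ModularFormClass.analyticAt_cuspFunction_zero f one_pos h1)
      (SlashInvariantFormClass.periodic_comp_ofComplex f h1)] at this
  isBigO_zero := by
    have := isArithmetic_conj_S Γ
    set g := ModularForm.translate (Γ := Γ) (k := k) f (ModularGroup.S : GL (Fin 2) ℝ) with hg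
    -- By `onAxis_inv`, `f(iu) = I ^ k u ^ (-k) g(i/u)`. One factor `I ^ k` in the constant cancels
    -- the `I ^ (-k)` inside `(uI) ^ (-k)`.
    refine ⟨I ^ k * I ^ k * valueAtInfty g, -k, fun M => ?_⟩
    have h2 := (isBigO_onAxis_sub_valueAtInfty _ k g (-k - M)).comp_tendsto
      tendsto_inv_nhdsGT_zero
    have h3 : (fun u : ℝ => I ^ k * (u : ℂ) ^ (-k)) =O[𝓝[>] 0] fun u : ℝ => u ^ (-k : ℝ) := by
      refine IsBigO.of_bound 1 ?_
      filter_upwards [self_mem_nhdsWithin] with u (hu : 0 < u)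
      rw [norm_mul, norm_zpow, norm_zpow, norm_I, one_zpow, one_mul, one_mul, norm_real,
        ← Int.cast_neg, Real.rpow_intCast, norm_zpow]
    refine (h3.mul h2).congr' ?_ ?_
    · filter_upwards [self_mem_nhdsWithin] with u (hu : 0 < u)
      have h4 := onAxis_inv (Γ := Γ) (k := k) f (inv_pos.2 hu)
      rw [inv_inv] at h4
      rw [h4, Function.comp_apply, mul_zpow, zpow_neg I, ← hg]
      have : I ^ k ≠ 0 := zpow_ne_zero _ I_ne_zero
      push_cast
      field_simp
      simp [zpow_neg]
      ring
    · filter_upwards [self_mem_nhdsWithin] with u (hu : 0 < u)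
      rw [Function.comp_apply, Real.inv_rpow hu.le, ← Real.rpow_neg hu.le, ← Real.rpow_add hu]
      congr 1
      ring

lemma hasSum_fourierCoeff_onAxis [ModularFormClass F Γ k] (f : F)
    (h1 : (1 : ℝ) ∈ Γ.strictPeriods) {u : ℝ} (hu : 0 < u) :
    HasSum (fun m : ℕ => fourierCoeff f m * Real.exp (-(2 * Real.pi * m * u))) (onAxis f u) := by
  have h := ModularForm.hasSum_qExpansion (Γ := Γ) (k := k) f one_pos h1 (ofComplex (u * I))
  convert! h using 2 with m
  rw [fourierCoeff, Function.Periodic.qParam, ofComplex_apply_of_im_pos (by simpa),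
    ← Complex.exp_nat_mul, ofReal_exp]
  congr 2
  push_cast
  simp only [div_one]
  linear_combination (-2 * Real.pi * m * u : ℂ) * I_sq

lemma fourierCoeff_isBigO (hw : Γ.strictWidthInfty = 1) (f : ModularForm Γ k) :
    ∃ K : ℕ, (fun n : ℕ => fourierCoeff f n) =O[atTop] fun n : ℕ => (n : ℝ) ^ K := by
  -- Forms of negative weight vanish, so the growth bound is needed only for `k ≥ 0`.
  rcases lt_or_ge k 0 with hk | hk
  · refine ⟨0, ?_⟩
    have h0 : (f : ℍ → ℂ) = 0 := by rw [ModularForm.isZero_of_neg_weight hk f]; rfl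
    simp only [fourierCoeff, h0, qExpansion_zero, map_zero]
    exact Asymptotics.isBigO_zero _ _
  · refine ⟨k.toNat, ?_⟩
    have := ModularFormClass.qExpansion_isBigO (Γ := Γ) hk f
    rw [hw] at this
    refine this.congr_right fun n => ?_
    rw [← zpow_natCast, Int.toNat_of_nonneg hk]

end ModularForm

/-! ### Entire families of rapidly decaying functions -/

lemma rpow_le_mul_rpow {t u a b : ℝ} (ht : 0 < t) (htu : t ≤ u) (hab : a ≤ b) :
    u ^ a ≤ t ^ (a - b) * u ^ b := by
  have hu : 0 < u := ht.trans_le htu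
  calc u ^ a = u ^ (a - b) * u ^ b := by rw [← Real.rpow_add hu]; congr 1; ring
    _ ≤ t ^ (a - b) * u ^ b := by
      gcongr ?_ * _
      exact Real.rpow_le_rpow_of_nonpos ht htu (by linarith)

lemma exists_norm_le_rpow_of_isBigO {h : ℝ → ℂ} (hc : ContinuousOn h (Set.Ioi 0)) {M : ℝ}
    (hO : h =O[atTop] fun u => u ^ M) {t : ℝ} (ht : 0 < t) :
    ∃ C, ∀ u ≥ t, ‖h u‖ ≤ C * u ^ M := by
  obtain ⟨c, hc'⟩ := hO.bound
  obtain ⟨T, hT⟩ := eventually_atTop.1 hc'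
  have hcont : ContinuousOn (fun u => h u * ((u ^ (-M) : ℝ) : ℂ)) (Set.Icc t (max t T)) := by
    intro u hu
    have hu0 : 0 < u := ht.trans_le hu.1
    refine ((hc u hu0).mono fun v hv => ht.trans_le hv.1).mul (ContinuousAt.continuousWithinAt ?_)
    exact continuous_ofReal.continuousAt.comp (Real.continuousAt_rpow_const u _ (Or.inl hu0.ne'))
  obtain ⟨B, hB⟩ := isCompact_Icc.exists_bound_of_continuousOn hcont
  refine ⟨max B c, fun u hu => ?_⟩
  have hu0 : 0 < u := ht.trans_le hu
  have hpos : 0 < u ^ M := Real.rpow_pos_of_pos hu0 M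
  rcases le_total u (max t T) with hle | hle
  · have := hB u ⟨hu, hle⟩
    rw [norm_mul, norm_real, Real.norm_of_nonneg (Real.rpow_nonneg hu0.le _),
      Real.rpow_neg hu0.le, ← div_eq_mul_inv, div_le_iff₀ hpos] at this
    exact this.trans (by gcongr; exact le_max_left ..)
  · have := hT u ((le_max_right _ _).trans hle)
    rw [Real.norm_of_nonneg hpos.le] at this
    exact this.trans (by gcongr; exact le_max_right ..)

lemma integrableOn_Ioi_of_norm_le {h : ℝ → ℂ} (hc : ContinuousOn h (Set.Ioi 0)) {t C M : ℝ}
    (ht : 0 < t) (hM : M < -1) (hb : ∀ u ≥ t, ‖h u‖ ≤ C * u ^ M) :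
    IntegrableOn h (Set.Ioi t) := by
  refine ((integrableOn_Ioi_rpow_of_lt hM ht).const_mul C).mono'
    ((hc.mono (Set.Ioi_subset_Ioi ht.le)).aestronglyMeasurable measurableSet_Ioi) ?_
  filter_upwards [ae_restrict_mem measurableSet_Ioi] with u hu using hb u (le_of_lt hu)

lemma hasDerivAt_integral_Ioi {h : ℝ → ℂ} (hc : ContinuousOn h (Set.Ioi 0))
    (hi : ∀ t > 0, IntegrableOn h (Set.Ioi t)) {t : ℝ} (ht : 0 < t) :
    HasDerivAt (fun t => ∫ u in Set.Ioi t, h u) (-h t) t := by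
  have h1 : HasDerivAt (fun x => ∫ u in (t / 2)..x, h u) (h t) t := by
    refine intervalIntegral.integral_hasDerivAt_right ?_ ?_ ?_
    · exact (hc.mono fun u hu => lt_of_lt_of_le (by positivity)
        ((Set.uIcc_of_le (half_le_self ht.le) ▸ hu).1)).intervalIntegrable
    · exact hc.stronglyMeasurableAtFilter isOpen_Ioi t ht
    · exact hc.continuousAt (Ioi_mem_nhds ht)
  have h2 : HasDerivAt (fun x => (∫ u in Set.Ioi (t / 2), h u) - ∫ u in (t / 2)..x, h u)
      (-h t) t := by
    simpa using h1.const_sub (∫ u in Set.Ioi (t / 2), h u)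
  refine h2.congr_of_eventuallyEq ?_
  filter_upwards [Ioi_mem_nhds (half_lt_self ht)] with x hx
  rw [← intervalIntegral.integral_interval_add_Ioi (hi (t / 2) (half_pos ht))
    (hi x ((half_pos ht).trans hx))]
  ring

/-- A family of continuous functions on the positive half-line which is entire in the parameter
and decays rapidly at infinity, locally uniformly in the parameter. -/
structure EntireRapid (g : ℂ → ℝ → ℂ) : Prop where
  differentiable : ∀ u > 0, Differentiable ℂ fun w => g w u
  continuousOn : ∀ w, ContinuousOn (g w) (Set.Ioi 0)
  bound : ∀ (r t : ℝ), 0 < t → ∀ M : ℝ, ∃ C, ∀ w, ‖w‖ ≤ r → ∀ u ≥ t, ‖g w u‖ ≤ C * u ^ M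

namespace EntireRapid

variable {g h : ℂ → ℝ → ℂ}

lemma zero : EntireRapid fun _ _ => 0 where
  differentiable _ _ := by fun_prop
  continuousOn _ := by fun_prop
  bound _ _ _ _ := ⟨0, by simp⟩

lemma add (hg : EntireRapid g) (hh : EntireRapid h) : EntireRapid fun w u => g w u + h w u where
  differentiable u hu := (hg.differentiable u hu).add (hh.differentiable u hu)
  continuousOn w := (hg.continuousOn w).add (hh.continuousOn w)
  bound r t ht M := by
    obtain ⟨C, hC⟩ := hg.bound r t ht M
    obtain ⟨D, hD⟩ := hh.bound r t ht M
    refine ⟨C + D, fun w hw u hu => (norm_add_le _ _).trans ?_⟩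
    linarith [hC w hw u hu, hD w hw u hu]

lemma entire_mul (hg : EntireRapid g) {a : ℂ → ℂ} (ha : Differentiable ℂ a) :
    EntireRapid fun w u => a w * g w u where
  differentiable u hu := ha.mul (hg.differentiable u hu)
  continuousOn w := continuousOn_const.mul (hg.continuousOn w)
  bound r t ht M := by
    obtain ⟨C, hC⟩ := hg.bound r t ht M
    obtain ⟨A, hA⟩ := (isCompact_closedBall (0 : ℂ) r).exists_bound_of_continuousOn
      ha.continuous.continuousOn
    refine ⟨A * C, fun w hw u hu => ?_⟩
    rw [norm_mul, mul_assoc]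
    have := hA w (by simpa using hw)
    have := hC w hw u hu
    gcongr
    exact (norm_nonneg _).trans ‹‖a w‖ ≤ A›

lemma function_mul (hg : EntireRapid g) {F : ℝ → ℂ} (hF : ContinuousOn F (Set.Ioi 0))
    (hb : ∀ t > 0, ∃ B, ∀ u ≥ t, ‖F u‖ ≤ B) : EntireRapid fun w u => F u * g w u where
  differentiable u hu := (differentiable_const _).mul (hg.differentiable u hu)
  continuousOn w := hF.mul (hg.continuousOn w)
  bound r t ht M := by
    obtain ⟨C, hC⟩ := hg.bound r t ht M
    obtain ⟨B, hB⟩ := hb t ht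
    refine ⟨B * C, fun w hw u hu => ?_⟩
    rw [norm_mul, mul_assoc]
    have := hC w hw u hu
    have := hB u hu
    gcongr
    exact (norm_nonneg _).trans ‹‖F u‖ ≤ B›

lemma cpow_mul (hg : EntireRapid g) {a : ℂ → ℂ} (ha : Differentiable ℂ a) :
    EntireRapid fun w u => ((u : ℂ) * I) ^ a w * g w u where
  differentiable u hu := (differentiable_axis_cpow hu ha).mul (hg.differentiable u hu)
  continuousOn w := (continuousOn_axis_cpow _).mul (hg.continuousOn w)
  bound r t ht M := by
    obtain ⟨A, hA⟩ := (isCompact_closedBall (0 : ℂ) r).exists_bound_of_continuousOn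
      ha.continuous.continuousOn
    -- For `‖w‖ ≤ r` the power grows at most like `u ^ A`, so a decay rate lower by `A` absorbs it.
    obtain ⟨C, hC⟩ := hg.bound r t ht (M - A)
    obtain ⟨D, hD⟩ := (isCompact_closedBall (0 : ℂ) r).exists_bound_of_continuousOn
      (f := fun w => t ^ ((a w).re - A) * Real.exp (-(Real.pi / 2 * (a w).im))) (by
        refine Continuous.continuousOn (Continuous.mul ?_ ?_)
        · exact Continuous.rpow continuous_const
            ((Complex.continuous_re.comp ha.continuous).sub continuous_const)
            (fun _ => Or.inl ht.ne')
        · exact Real.continuous_exp.comp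
            ((continuous_const.mul (Complex.continuous_im.comp ha.continuous)).neg))
    refine ⟨D * C, fun w hw u hu => ?_⟩
    have hu0 : 0 < u := ht.trans_le hu
    have hwr : w ∈ Metric.closedBall (0 : ℂ) r := by simpa using hw
    have h1 : (a w).re ≤ A := (re_le_norm _).trans (hA w hwr)
    have h2 := (Real.le_norm_self _).trans (hD w hwr)
    have h3 := hC w hw u hu
    rw [norm_mul, norm_axis_cpow hu0]
    calc u ^ (a w).re * Real.exp (-(Real.pi / 2 * (a w).im)) * ‖g w u‖
        ≤ (t ^ ((a w).re - A) * u ^ A) * Real.exp (-(Real.pi / 2 * (a w).im)) *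
          (C * u ^ (M - A)) := by gcongr; exact rpow_le_mul_rpow ht hu h1
      _ = (t ^ ((a w).re - A) * Real.exp (-(Real.pi / 2 * (a w).im))) *
          (u ^ A * (C * u ^ (M - A))) := by ring
      _ ≤ D * (u ^ A * (C * u ^ (M - A))) := by
          gcongr
          exact mul_nonneg (by positivity) ((norm_nonneg _).trans h3)
      _ = D * C * (u ^ A * u ^ (M - A)) := by ring
      _ = D * C * u ^ M := by rw [← Real.rpow_add hu0]; congr 2; ring

lemma integrableOn (hg : EntireRapid g) (w : ℂ) {t : ℝ} (ht : 0 < t) :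
    IntegrableOn (g w) (Set.Ioi t) := by
  obtain ⟨C, hC⟩ := hg.bound ‖w‖ t ht (-2)
  exact integrableOn_Ioi_of_norm_le (hg.continuousOn w) ht (by norm_num) (hC w le_rfl)

lemma hasDerivAt_integral (hg : EntireRapid g) (w : ℂ) {t : ℝ} (ht : 0 < t) :
    HasDerivAt (fun t => ∫ u in Set.Ioi t, g w u) (-g w t) t :=
  hasDerivAt_integral_Ioi (hg.continuousOn w) (fun _ h => hg.integrableOn w h) ht

lemma integral (hg : EntireRapid g) : EntireRapid fun w t => ∫ u in Set.Ioi t, g w u where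
  differentiable t ht := by
    rw [← differentiableOn_univ]
    refine differentiableOn_integral_of_bound isOpen_univ ?_ (fun w _ =>
      (hg.integrableOn w ht).aestronglyMeasurable) fun w _ => ?_
    · filter_upwards [ae_restrict_mem measurableSet_Ioi] with u hu
      exact (hg.differentiable u (ht.trans hu)).differentiableOn
    · obtain ⟨C, hC⟩ := hg.bound (‖w‖ + 1) t ht (-2)
      refine ⟨1, one_pos, fun u => C * u ^ (-2 : ℝ),
        (integrableOn_Ioi_rpow_of_lt (by norm_num) ht).const_mul C, ?_⟩
      filter_upwards [ae_restrict_mem measurableSet_Ioi] with u hu z hz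
      refine hC z ?_ u (le_of_lt hu)
      have := norm_le_norm_add_norm_sub' z w
      rw [mem_ball_iff_norm] at hz
      linarith
  continuousOn w _ ht := (hg.hasDerivAt_integral w ht).continuousAt.continuousWithinAt
  bound r t ht M := by
    -- This exponent is below `-1`, so the bound is integrable, and integration raises it by one to
    -- `min M (-1) ≤ M`.
    obtain ⟨C, hC⟩ := hg.bound r t ht (min M (-1) - 1)
    have hlt : min M (-1) - 1 < -1 := by linarith [min_le_right M (-1)]
    have hneg : 0 < -min M (-1) := by linarith [min_le_right M (-1)]
    refine ⟨C * (t ^ (min M (-1) - M) / -min M (-1)), fun w hw u hu => ?_⟩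
    have hu0 : 0 < u := ht.trans_le hu
    have hC0 : 0 ≤ C := by
      have := (norm_nonneg _).trans (hC w hw t le_rfl)
      exact nonneg_of_mul_nonneg_left this (Real.rpow_pos_of_pos ht _)
    calc ‖∫ v in Set.Ioi u, g w v‖ ≤ ∫ v in Set.Ioi u, C * v ^ (min M (-1) - 1) := by
          refine norm_integral_le_of_norm_le
            ((integrableOn_Ioi_rpow_of_lt hlt hu0).const_mul C) ?_
          filter_upwards [ae_restrict_mem measurableSet_Ioi] with v hv
          exact hC w hw v (hu.trans (le_of_lt hv))
      _ = C * (u ^ min M (-1) / -min M (-1)) := by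
          rw [integral_const_mul, integral_Ioi_rpow_of_lt hlt hu0, sub_add_cancel, div_neg,
            neg_div]
      _ ≤ C * ((t ^ (min M (-1) - M) * u ^ M) / -min M (-1)) := by
          gcongr
          exact rpow_le_mul_rpow ht hu (min_le_left _ _)
      _ = _ := by ring

lemma tendsto_zero (hg : EntireRapid g) (w : ℂ) : Tendsto (g w) atTop (𝓝 0) := by
  obtain ⟨C, hC⟩ := hg.bound ‖w‖ 1 one_pos (-1)
  refine squeeze_zero_norm' (a := fun u => C * u ^ (-1 : ℝ)) ?_ ?_
  · filter_upwards [eventually_ge_atTop 1] with u hu using hC w le_rfl u hu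
  · simpa using (tendsto_rpow_neg_atTop one_pos).const_mul C

end EntireRapid

lemma AxisAdmissible.bounded {f : ℍ → ℂ} (hf : AxisAdmissible f) {t : ℝ} (ht : 0 < t) :
    ∃ B, ∀ u ≥ t, ‖onAxis f u‖ ≤ B := by
  obtain ⟨C, hC⟩ := exists_norm_le_rpow_of_isBigO (hf.continuousOn.sub continuousOn_const)
    (hf.isBigO_atTop 0) ht
  refine ⟨C + ‖fourierCoeff f 0‖, fun u hu => ?_⟩
  have := hC u hu
  rw [Real.rpow_zero, mul_one] at this
  exact (norm_le_norm_sub_add _ _).trans (by gcongr; exact this)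

lemma AxisAdmissible.entireRapid {f : ℍ → ℂ} (hf : AxisAdmissible f) :
    EntireRapid fun _ u => onAxis f u - fourierCoeff f 0 where
  differentiable _ _ := by fun_prop
  continuousOn _ := hf.continuousOn.sub continuousOn_const
  bound _ t ht M := by
    obtain ⟨C, hC⟩ := exists_norm_le_rpow_of_isBigO (hf.continuousOn.sub continuousOn_const)
      (hf.isBigO_atTop M) ht
    exact ⟨C, fun _ _ => hC⟩

/-! ### Regularised iterated integrals from `i∞` -/

/-- The sum of the exponents. -/
def exponentSum (l : List ((ℍ → ℂ) × ℂ)) : ℂ := (l.map Prod.snd).sum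

/-- The product of the zeroth Fourier coefficients. -/
def constantTermProd (l : List ((ℍ → ℂ) × ℂ)) : ℂ := (l.map fun p => fourierCoeff p.1 0).prod

/-- The product of the exponent sums of all nonempty suffixes. -/
def suffixSumProd : List ((ℍ → ℂ) × ℂ) → ℂ
  | [] => 1
  | p :: l => exponentSum (p :: l) * suffixSumProd l

/-- The rapidly decaying part of the regularised iterated integral, multiplied by
`suffixSumProd`. -/
def regularizedRemainder : List ((ℍ → ℂ) × ℂ) → ℝ → ℂ
  | [], _ => 0
  | (f, s) :: l, t => -(exponentSum ((f, s) :: l)) * ∫ u in Set.Ioi t, I * (((u : ℂ) * I) ^ (s - 1) *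
      (onAxis f u * regularizedRemainder l u +
        constantTermProd l * (((u : ℂ) * I) ^ exponentSum l *
          (onAxis f u - fourierCoeff f 0))))

/-- The regularised iterated integral, multiplied by `suffixSumProd`. -/
def regularizedNum (l : List ((ℍ → ℂ) × ℂ)) (t : ℝ) : ℂ :=
  constantTermProd l * ((t : ℂ) * I) ^ exponentSum l + regularizedRemainder l t

/-- The iterated integral `I_{i∞}^{it}`, regularised by analytic continuation in the exponents. -/
def regularizedIntegral (l : List ((ℍ → ℂ) × ℂ)) (t : ℝ) : ℂ :=
  regularizedNum l t / suffixSumProd l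

/-- A list of functions with exponents depending holomorphically on a parameter. -/
inductive IsEntireFamily : (ℂ → List ((ℍ → ℂ) × ℂ)) → Prop
  | nil : IsEntireFamily fun _ => []
  | cons {f : ℍ → ℂ} {s : ℂ → ℂ} {l : ℂ → List ((ℍ → ℂ) × ℂ)} :
      AxisAdmissible f → Differentiable ℂ s → IsEntireFamily l →
      IsEntireFamily fun w => (f, s w) :: l w

lemma isEntireFamily_const {l : List ((ℍ → ℂ) × ℂ)} (hl : ∀ p ∈ l, AxisAdmissible p.1) :
    IsEntireFamily fun _ => l := by
  induction l with
  | nil => exact .nil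
  | cons p l ih =>
    exact .cons (hl p List.mem_cons_self) (differentiable_const p.2)
      (ih fun q hq => hl q (List.mem_cons_of_mem _ hq))

@[simp] lemma exponentSum_nil : exponentSum [] = 0 := by simp [exponentSum]

@[simp] lemma exponentSum_cons (p : (ℍ → ℂ) × ℂ) (l) :
    exponentSum (p :: l) = p.2 + exponentSum l := by simp [exponentSum]

@[simp] lemma constantTermProd_nil : constantTermProd [] = 1 := by simp [constantTermProd]

@[simp] lemma constantTermProd_cons (p : (ℍ → ℂ) × ℂ) (l) :
    constantTermProd (p :: l) = fourierCoeff p.1 0 * constantTermProd l := by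
  simp [constantTermProd]

namespace IsEntireFamily

variable {l : ℂ → List ((ℍ → ℂ) × ℂ)}

lemma differentiable_exponentSum (hl : IsEntireFamily l) :
    Differentiable ℂ fun w => exponentSum (l w) := by
  induction hl with
  | nil => simp
  | cons hf hs hl ih => simpa using hs.fun_add ih

lemma differentiable_suffixSumProd (hl : IsEntireFamily l) :
    Differentiable ℂ fun w => suffixSumProd (l w) := by
  induction hl with
  | nil => simp [suffixSumProd]
  | cons hf hs hl ih =>
    simpa [suffixSumProd] using (hs.fun_add hl.differentiable_exponentSum).fun_mul ih

lemma constantTermProd_eq (hl : IsEntireFamily l) (w w' : ℂ) :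
    constantTermProd (l w) = constantTermProd (l w') := by
  induction hl with
  | nil => simp
  | cons hf hs hl ih => simp [ih]

/-- The integrand is what remains of `f z ^ (s - 1)` times the inner numerator once the leading
power, with coefficient `a₀ · constantTermProd l`, is removed. It decays because the inner remainder
and `f - a₀` both do. -/
lemma entireRapid_integrand {f : ℍ → ℂ} {s : ℂ → ℂ} (hf : AxisAdmissible f)
    (hs : Differentiable ℂ s) (hl : IsEntireFamily l)
    (h : EntireRapid fun w => regularizedRemainder (l w)) :
    EntireRapid fun w u => I * (((u : ℂ) * I) ^ (s w - 1) *
      (onAxis f u * regularizedRemainder (l w) u + constantTermProd (l w) *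
        (((u : ℂ) * I) ^ exponentSum (l w) * (onAxis f u - fourierCoeff f 0)))) := by
  have h1 := (h.function_mul hf.continuousOn fun t ht => hf.bounded ht).add
    ((hf.entireRapid.cpow_mul hl.differentiable_exponentSum).entire_mul
      (differentiable_const (constantTermProd (l 0))))
  have h2 := (h1.cpow_mul (hs.sub_const 1)).entire_mul (differentiable_const I)
  simpa only [hl.constantTermProd_eq _ 0] using h2

lemma entireRapid (hl : IsEntireFamily l) : EntireRapid fun w => regularizedRemainder (l w) := by
  induction hl with
  | nil => exact EntireRapid.zero
  | @cons f s l hf hs hl ih =>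
    have hS : Differentiable ℂ fun w => -exponentSum ((f, s w) :: l w) := by
      simpa only [exponentSum_cons] using (hs.fun_add hl.differentiable_exponentSum).fun_neg
    exact (entireRapid_integrand hf hs hl ih).integral.entire_mul hS

lemma differentiable_regularizedNum (hl : IsEntireFamily l) {t : ℝ} (ht : 0 < t) :
    Differentiable ℂ fun w => regularizedNum (l w) t := by
  have h1 := ((differentiable_const (constantTermProd (l 0))).fun_mul
    (differentiable_axis_cpow ht hl.differentiable_exponentSum)).fun_add
    (hl.entireRapid.differentiable t ht)
  simpa only [regularizedNum, hl.constantTermProd_eq _ 0] using h1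

lemma meromorphicOn_regularizedIntegral (hl : IsEntireFamily l) {t : ℝ} (ht : 0 < t) :
    MeromorphicOn (fun w => regularizedIntegral (l w) t) Set.univ := fun w _ =>
  ((hl.differentiable_regularizedNum ht).analyticAt w).meromorphicAt.div
    (hl.differentiable_suffixSumProd.analyticAt w).meromorphicAt

lemma analyticAt_regularizedIntegral (hl : IsEntireFamily l) {t : ℝ} (ht : 0 < t) {w : ℂ}
    (hw : suffixSumProd (l w) ≠ 0) : AnalyticAt ℂ (fun w => regularizedIntegral (l w) t) w :=
  ((hl.differentiable_regularizedNum ht).analyticAt w).div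
    (hl.differentiable_suffixSumProd.analyticAt w) hw

end IsEntireFamily

/-! ### Regularised integrals as functions of the end point. -/

section Fixed

variable {f : ℍ → ℂ} {s : ℂ} {l : List ((ℍ → ℂ) × ℂ)}

lemma integrand_eq (f : ℍ → ℂ) (s : ℂ) (u : ℝ) :
    integrand f s u = onAxis f u * ((u : ℂ) * I) ^ (s - 1) * I := rfl

/-- Integrating the leading power would divide by the exponent sum of the whole list. The numerator
carries this factor instead, and so stays entire in the exponents even where the sum vanishes. -/
lemma hasDerivAt_regularizedNum_cons (hf : AxisAdmissible f) (hl : ∀ p ∈ l, AxisAdmissible p.1)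
    {t : ℝ} (ht : 0 < t) :
    HasDerivAt (regularizedNum ((f, s) :: l))
      (exponentSum ((f, s) :: l) * (integrand f s t * regularizedNum l t)) t := by
  have h1 := ((isEntireFamily_const hl).entireRapid_integrand hf (differentiable_const s)
    (isEntireFamily_const hl).entireRapid).hasDerivAt_integral 0 ht
  have h2 := ((hasDerivAt_axis_cpow ht (exponentSum ((f, s) :: l))).const_mul
    (constantTermProd ((f, s) :: l))).add (h1.const_mul (-(exponentSum ((f, s) :: l))))
  refine h2.congr_deriv ?_
  have h3 : ((t : ℂ) * I) ^ (s + exponentSum l - 1) =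
      ((t : ℂ) * I) ^ (s - 1) * ((t : ℂ) * I) ^ exponentSum l := by
    rw [← axis_cpow_add ht]; congr 1; ring
  simp only [exponentSum_cons, constantTermProd_cons, integrand_eq, regularizedNum, h3]
  ring

lemma regularizedNum_nil (t : ℝ) : regularizedNum [] t = 1 := by
  simp [regularizedNum, regularizedRemainder]

lemma regularizedIntegral_nil (t : ℝ) : regularizedIntegral [] t = 1 := by
  simp [regularizedIntegral, regularizedNum_nil, suffixSumProd]

lemma hasDerivAt_regularizedIntegral_cons (hf : AxisAdmissible f)
    (hl : ∀ p ∈ l, AxisAdmissible p.1) (hS : exponentSum ((f, s) :: l) ≠ 0) {t : ℝ} (ht : 0 < t) :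
    HasDerivAt (regularizedIntegral ((f, s) :: l)) (integrand f s t * regularizedIntegral l t) t := by
  refine ((hasDerivAt_regularizedNum_cons hf hl ht).div_const
    (suffixSumProd ((f, s) :: l))).congr_deriv ?_
  rw [suffixSumProd, regularizedIntegral, mul_div_mul_left _ _ hS, mul_div_assoc]

lemma continuousOn_regularizedNum (hl : ∀ p ∈ l, AxisAdmissible p.1) :
    ContinuousOn (regularizedNum l) (Set.Ioi 0) :=
  (continuousOn_const.mul (continuousOn_axis_cpow _)).add
    ((isEntireFamily_const hl).entireRapid.continuousOn 0)

lemma continuousOn_regularizedIntegral (hl : ∀ p ∈ l, AxisAdmissible p.1) :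
    ContinuousOn (regularizedIntegral l) (Set.Ioi 0) :=
  (continuousOn_regularizedNum hl).div_const _

lemma continuousOn_integrand (hf : AxisAdmissible f) (s : ℂ) :
    ContinuousOn (integrand f s) (Set.Ioi 0) :=
  (hf.continuousOn.mul (continuousOn_axis_cpow _)).mul continuousOn_const

lemma tendsto_axis_cpow_atTop {s : ℂ} (hs : s.re < 0) :
    Tendsto (fun u : ℝ => ((u : ℂ) * I) ^ s) atTop (𝓝 0) := by
  rw [tendsto_zero_iff_norm_tendsto_zero]
  have := (tendsto_rpow_neg_atTop (neg_pos.2 hs)).mul_const (Real.exp (-(Real.pi / 2 * s.im)))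
  rw [neg_neg, zero_mul] at this
  refine this.congr' ?_
  filter_upwards [eventually_gt_atTop 0] with u hu
  rw [norm_axis_cpow hu]

/-- Where it converges, the iterated integral is the regularised one. -/
lemma integralFromInfinity_eq_regularizedIntegral (hl : ∀ p ∈ l, AxisAdmissible p.1)
    (hS : ∀ l', l' <:+ l → l' ≠ [] → (exponentSum l').re < 0) {t : ℝ} (ht : 0 < t) :
    integralFromInfinity l t = regularizedIntegral l t := by
  induction l generalizing t with
  | nil => rw [integralFromInfinity, regularizedIntegral_nil]
  | cons p l ih =>
    obtain ⟨f, s⟩ := p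
    have hf : AxisAdmissible f := hl _ List.mem_cons_self
    have hl' : ∀ p ∈ l, AxisAdmissible p.1 := fun q hq => hl q (List.mem_cons_of_mem _ hq)
    have hS0 := hS _ List.suffix_rfl (by simp)
    have hne : exponentSum ((f, s) :: l) ≠ 0 := fun h => by simp [h] at hS0
    have h1 : ∀ u ∈ Set.Ioi t, integrand f s u * integralFromInfinity l u =
        integrand f s u * regularizedIntegral l u := fun u hu => by
      rw [ih hl' (fun l' h h' => hS l' (h.trans (List.suffix_cons _ _)) h') (ht.trans hu)]
    -- With negative total exponent the leading power also tends to `0`, so the regularised integral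
    -- is the primitive that vanishes at `i∞`.
    have hlim : Tendsto (regularizedIntegral ((f, s) :: l)) atTop (𝓝 0) := by
      have := (((tendsto_axis_cpow_atTop hS0).const_mul (constantTermProd ((f, s) :: l))).add
        ((isEntireFamily_const hl).entireRapid.tendsto_zero 0)).div_const
          (suffixSumProd ((f, s) :: l))
      rw [mul_zero, add_zero, zero_div] at this
      exact this
    have hint : IntegrableOn (fun u => integrand f s u * regularizedIntegral l u) (Set.Ioi t) := by
      -- After division by the power `z ^ exponentSum l`, the inner integral is a constant plus a
      -- bounded remainder. So the integrand is `O(u ^ (Re S - 1))`, where `S` is the total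
      -- exponent.
      have hE := ((isEntireFamily_const hl').entireRapid.cpow_mul
        (differentiable_const (-exponentSum l))).bound 0 t ht 0
      obtain ⟨C, hC⟩ := hE
      obtain ⟨B, hB⟩ := hf.bounded ht
      refine integrableOn_Ioi_of_norm_le (((continuousOn_integrand hf s).mul
        (continuousOn_regularizedIntegral hl'))) ht (M := (exponentSum ((f, s) :: l)).re - 1)
        (C := B * (Real.exp (-(Real.pi / 2 * (exponentSum ((f, s) :: l) - 1).im)) *
          ((‖constantTermProd l‖ + C) / ‖suffixSumProd l‖))) (by linarith) fun u hu => ?_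
      have hu0 : 0 < u := ht.trans_le hu
      have h2 : integrand f s u * regularizedIntegral l u = onAxis f u *
          (((u : ℂ) * I) ^ (exponentSum ((f, s) :: l) - 1) * I * ((constantTermProd l +
            ((u : ℂ) * I) ^ (-exponentSum l) * regularizedRemainder l u) / suffixSumProd l)) := by
        have h3 : ((u : ℂ) * I) ^ (exponentSum ((f, s) :: l) - 1) =
            ((u : ℂ) * I) ^ (s - 1) * ((u : ℂ) * I) ^ exponentSum l := by
          rw [← axis_cpow_add hu0, exponentSum_cons]; congr 1; ring
        have h4 : ((u : ℂ) * I) ^ exponentSum l * ((u : ℂ) * I) ^ (-exponentSum l) = 1 := by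
          rw [← axis_cpow_add hu0]; simp
        rw [integrand_eq, h3, regularizedIntegral, regularizedNum]
        linear_combination (onAxis f u * ((u : ℂ) * I) ^ (s - 1) * I *
          (-regularizedRemainder l u / suffixSumProd l)) * h4
      have h5 := hC 0 (by simp) u hu
      rw [Real.rpow_zero, mul_one] at h5
      change ‖integrand f s u * regularizedIntegral l u‖ ≤ _
      rw [h2, norm_mul, norm_mul, norm_mul, norm_I, mul_one, norm_div, norm_axis_cpow hu0]
      calc _ ≤ B * (u ^ (exponentSum ((f, s) :: l) - 1).re *
            Real.exp (-(Real.pi / 2 * (exponentSum ((f, s) :: l) - 1).im)) *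
            ((‖constantTermProd l‖ + C) / ‖suffixSumProd l‖)) := by
            gcongr
            · exact (norm_nonneg _).trans (hB u hu)
            · exact hB u hu
            · exact (norm_add_le _ _).trans (by gcongr)
        _ = _ := by rw [sub_re, one_re]; ring
    rw [integralFromInfinity, setIntegral_congr_fun measurableSet_Ioi h1,
      integral_Ioi_of_hasDerivAt_of_tendsto' (fun u hu =>
        hasDerivAt_regularizedIntegral_cons hf hl' hne (ht.trans_le hu)) hint hlim]
    ring

end Fixed

/-! ### Truncated Mellin transforms at `0` -/

/-- The truncated Mellin integrand along the imaginary axis. -/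
def axisMellinIntegrand (h : ℝ → ℂ) (s : ℂ) (u : ℝ) : ℂ := ((u : ℂ) * I) ^ (s - 1) * I * h u

/-- `G` continues the truncated Mellin transform of `h`, which is `O(u ^ (-A))` at `0`. -/
structure IsMellinContinuation (b : ℝ) (h : ℝ → ℂ) (A : ℝ) (G : ℂ → ℂ) : Prop where
  continuousOn : ContinuousOn h (Set.Ioi 0)
  bound : ∃ C, ∀ u ∈ Set.Ioc 0 b, ‖h u‖ ≤ C * u ^ (-A)
  meromorphicOn : MeromorphicOn G Set.univ
  analyticAt : ∀ s : ℂ, A < s.re → AnalyticAt ℂ G s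
  eq_integral : ∀ s : ℂ, A < s.re → G s = ∫ u in b..0, axisMellinIntegrand h s u

/-- The truncated Mellin transform of `h` converges in a half-plane and has a meromorphic
continuation. -/
def HasMellinContinuation (b : ℝ) (h : ℝ → ℂ) : Prop := ∃ A G, IsMellinContinuation b h A G

lemma exists_norm_le_rpow_zero {h : ℝ → ℂ} (hc : ContinuousOn h (Set.Ioi 0)) {M : ℝ}
    (hO : h =O[𝓝[>] 0] fun u => u ^ M) (b : ℝ) :
    ∃ C, ∀ u ∈ Set.Ioc 0 b, ‖h u‖ ≤ C * u ^ M := by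
  have hc' : ContinuousOn (fun u => h u⁻¹) (Set.Ioi 0) :=
    hc.comp (continuousOn_inv₀.mono fun u hu => (ne_of_gt hu : u ≠ 0)) fun u hu => by
      simpa using hu
  have hO' : (fun u => h u⁻¹) =O[atTop] fun u => u ^ (-M) := by
    refine (hO.comp_tendsto tendsto_inv_atTop_nhdsGT_zero).congr' EventuallyEq.rfl ?_
    filter_upwards [eventually_gt_atTop 0] with u hu
    rw [Function.comp_apply, Real.inv_rpow hu.le, Real.rpow_neg hu.le]
  rcases le_or_gt b 0 with hb | hb
  · exact ⟨0, fun u hu => absurd (hu.1.trans_le hu.2) (not_lt.2 hb)⟩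
  obtain ⟨C, hC⟩ := exists_norm_le_rpow_of_isBigO hc' hO' (inv_pos.2 hb)
  refine ⟨C, fun u hu => ?_⟩
  have := hC u⁻¹ (inv_anti₀ hu.1 hu.2)
  rwa [inv_inv, Real.inv_rpow hu.1.le, Real.rpow_neg hu.1.le, inv_inv] at this

lemma rpow_le_rpow_mul {b u x y : ℝ} (hu : 0 < u) (hub : u ≤ b) (hxy : y ≤ x) :
    u ^ x ≤ b ^ (x - y) * u ^ y := by
  calc u ^ x = u ^ (x - y) * u ^ y := by rw [← Real.rpow_add hu]; congr 1; ring
    _ ≤ b ^ (x - y) * u ^ y := by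
      gcongr

lemma continuousOn_axisMellinIntegrand {h : ℝ → ℂ} (hc : ContinuousOn h (Set.Ioi 0)) (s : ℂ) :
    ContinuousOn (axisMellinIntegrand h s) (Set.Ioi 0) :=
  ((continuousOn_axis_cpow _).mul continuousOn_const).mul hc

lemma intervalIntegrable_axisMellinIntegrand {b A : ℝ} {h : ℝ → ℂ} (hb : 0 < b)
    (hc : ContinuousOn h (Set.Ioi 0)) (hA : ∃ C, ∀ u ∈ Set.Ioc 0 b, ‖h u‖ ≤ C * u ^ (-A)) {s : ℂ}
    (hs : A < s.re) : IntervalIntegrable (axisMellinIntegrand h s) volume 0 b := by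
  obtain ⟨C, hC⟩ := hA
  have h1 : IntervalIntegrable (fun u : ℝ =>
      Real.exp (-(Real.pi / 2 * (s - 1).im)) * C * u ^ (s.re - 1 - A)) volume 0 b :=
    (intervalIntegral.intervalIntegrable_rpow' (by linarith)).const_mul _
  rw [intervalIntegrable_iff_integrableOn_Ioc_of_le hb.le] at h1 ⊢
  refine h1.mono' (((continuousOn_axisMellinIntegrand hc s).mono fun u hu =>
    hu.1).aestronglyMeasurable measurableSet_Ioc) ?_
  filter_upwards [ae_restrict_mem measurableSet_Ioc] with u hu
  rw [axisMellinIntegrand, norm_mul, norm_mul, norm_I, mul_one, norm_axis_cpow hu.1]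
  calc _ ≤ u ^ (s - 1).re * Real.exp (-(Real.pi / 2 * (s - 1).im)) * (C * u ^ (-A)) := by
        have := hC u hu
        have := hu.1.le
        gcongr
    _ = Real.exp (-(Real.pi / 2 * (s - 1).im)) * C * (u ^ (s.re - 1) * u ^ (-A)) := by
        rw [sub_re, one_re]; ring
    _ = _ := by rw [← Real.rpow_add hu.1, ← sub_eq_add_neg]

namespace IsMellinContinuation

variable {b A : ℝ} {h : ℝ → ℂ} {G : ℂ → ℂ}

lemma mono (H : IsMellinContinuation b h A G) {A' : ℝ} (hA : A ≤ A') :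
    IsMellinContinuation b h A' G where
  continuousOn := H.continuousOn
  bound := by
    obtain ⟨C, hC⟩ := H.bound
    refine ⟨C * b ^ (-A - -A'), fun u hu => (hC u hu).trans ?_⟩
    have hC0 : 0 ≤ C := nonneg_of_mul_nonneg_left ((norm_nonneg _).trans (hC u hu))
      (Real.rpow_pos_of_pos hu.1 _)
    rw [mul_assoc]
    gcongr
    exact rpow_le_rpow_mul hu.1 hu.2 (by linarith)
  meromorphicOn := H.meromorphicOn
  analyticAt s hs := H.analyticAt s (hA.trans_lt hs)
  eq_integral s hs := H.eq_integral s (hA.trans_lt hs)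

lemma intervalIntegrable (H : IsMellinContinuation b h A G) (hb : 0 < b) {s : ℂ} (hs : A < s.re) :
    IntervalIntegrable (axisMellinIntegrand h s) volume 0 b :=
  intervalIntegrable_axisMellinIntegrand hb H.continuousOn H.bound hs

end IsMellinContinuation

namespace HasMellinContinuation

variable {b : ℝ} {h h' : ℝ → ℂ}

lemma congr_add (hb : 0 < b) (H : HasMellinContinuation b h) (H' : HasMellinContinuation b h') :
    HasMellinContinuation b fun u => h u + h' u := by
  obtain ⟨A, G, H⟩ := H
  obtain ⟨A', G', H'⟩ := H'
  replace H := H.mono (le_max_left A A')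
  replace H' := H'.mono (le_max_right A A')
  refine ⟨max A A', fun s => G s + G' s, H.continuousOn.add H'.continuousOn, ?_,
    fun s hs => (H.meromorphicOn s hs).add (H'.meromorphicOn s hs),
    fun s hs => (H.analyticAt s hs).add (H'.analyticAt s hs), fun s hs => ?_⟩
  · obtain ⟨C, hC⟩ := H.bound
    obtain ⟨C', hC'⟩ := H'.bound
    refine ⟨C + C', fun u hu => (norm_add_le _ _).trans ?_⟩
    linarith [hC u hu, hC' u hu]
  · rw [H.eq_integral s hs, H'.eq_integral s hs, ← intervalIntegral.integral_add
      (H.intervalIntegrable hb hs).symm (H'.intervalIntegrable hb hs).symm]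
    simp only [axisMellinIntegrand, mul_add]

lemma const_mul (H : HasMellinContinuation b h) (c : ℂ) :
    HasMellinContinuation b fun u => c * h u := by
  obtain ⟨A, G, H⟩ := H
  refine ⟨A, fun s => c * G s, continuousOn_const.mul H.continuousOn, ?_,
    fun s hs => (MeromorphicAt.const c s).mul (H.meromorphicOn s hs),
    fun s hs => analyticAt_const.mul (H.analyticAt s hs), fun s hs => ?_⟩
  · obtain ⟨C, hC⟩ := H.bound
    refine ⟨‖c‖ * C, fun u hu => ?_⟩
    rw [norm_mul, mul_assoc]
    have := hC u hu
    gcongr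
  · rw [H.eq_integral s hs, ← intervalIntegral.integral_const_mul]
    congr 1 with u
    simp only [axisMellinIntegrand]
    ring

lemma cpow_mul (hb : 0 < b) (H : HasMellinContinuation b h) (m : ℂ) :
    HasMellinContinuation b fun u => ((u : ℂ) * I) ^ m * h u := by
  obtain ⟨A, G, H⟩ := H
  have hre (s : ℂ) (hs : A - m.re < s.re) : A < (s + m).re := by rw [add_re]; linarith
  have hd (s : ℂ) : AnalyticAt ℂ (fun s => s + m) s := by fun_prop
  refine ⟨A - m.re, fun s => G (s + m), (continuousOn_axis_cpow m).mul H.continuousOn, ?_,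
    fun s _ => ?_, fun s hs => AnalyticAt.fun_comp (g := G) (f := fun s => s + m) (H.analyticAt _ (hre s hs)) (hd s), fun s hs => ?_⟩
  · obtain ⟨C, hC⟩ := H.bound
    refine ⟨Real.exp (-(Real.pi / 2 * m.im)) * C, fun u hu => ?_⟩
    rw [norm_mul, norm_axis_cpow hu.1, show -(A - m.re) = m.re + -A by ring, Real.rpow_add hu.1]
    have := hC u hu
    have := hu.1.le
    calc _ ≤ u ^ m.re * Real.exp (-(Real.pi / 2 * m.im)) * (C * u ^ (-A)) := by gcongr
      _ = _ := by ring
  · exact MeromorphicAt.comp_analyticAt (f := G) (g := fun s => s + m)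
      (H.meromorphicOn (s + m) (Set.mem_univ _)) (hd s)
  · rw [H.eq_integral _ (hre s hs)]
    refine intervalIntegral.integral_congr_ae (Eventually.of_forall fun u hu => ?_)
    rw [Set.uIoc_of_ge hb.le] at hu
    simp only [axisMellinIntegrand]
    rw [show s + m - 1 = (s - 1) + m by ring, axis_cpow_add hu.1]
    ring

/-- Vanishing to infinite order at `0` absorbs `u ^ (s - 1)` locally uniformly in `s`, so the
transform is entire; the abscissa `0` given below is an arbitrary choice. -/
lemma of_isBigO (hb : 0 < b) (hc : ContinuousOn h (Set.Ioi 0))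
    (hO : ∀ M : ℝ, h =O[𝓝[>] 0] fun u => u ^ M) : HasMellinContinuation b h := by
  have hbd (M : ℝ) := exists_norm_le_rpow_zero hc (hO M) b
  have hdiff : Differentiable ℂ fun s => ∫ u in Set.Ioc 0 b, axisMellinIntegrand h s u := by
    rw [← differentiableOn_univ]
    refine differentiableOn_integral_of_bound isOpen_univ ?_ (fun s _ =>
      ((continuousOn_axisMellinIntegrand hc s).mono fun u hu =>
        hu.1).aestronglyMeasurable measurableSet_Ioc) fun s _ => ?_
    · filter_upwards [ae_restrict_mem measurableSet_Ioc] with u hu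
      exact (((differentiable_axis_cpow hu.1 (by fun_prop)).mul_const _).mul_const
        _).differentiableOn
    -- On the unit disc around `s` one has `Re (z - 1) ≥ -(‖s‖ + 2)`, so vanishing of order `‖s‖ +
    -- 2` bounds the integrand by a constant.
    · obtain ⟨C, hC⟩ := hbd (‖s‖ + 2)
      obtain ⟨D, hD⟩ := (isCompact_closedBall s 1).exists_bound_of_continuousOn
        (f := fun z => b ^ ((z - 1).re - -(‖s‖ + 2)) * Real.exp (-(Real.pi / 2 * (z - 1).im))) (by
          refine Continuous.continuousOn (Continuous.mul ?_ ?_)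
          · exact Continuous.rpow continuous_const (by fun_prop) (fun _ => Or.inl hb.ne')
          · fun_prop)
      refine ⟨1, one_pos, fun _ => D * C, integrableOn_const (by simp), ?_⟩
      filter_upwards [ae_restrict_mem measurableSet_Ioc] with u hu z hz
      have h1 : -(‖s‖ + 2) ≤ (z - 1).re := by
        have h2 := abs_le.1 (abs_re_le_norm (z - s))
        have h3 := abs_le.1 (abs_re_le_norm s)
        rw [mem_ball_iff_norm] at hz
        rw [sub_re] at h2
        rw [sub_re, one_re]
        linarith [h2.1, h3.1]
      have h4 := (Real.le_norm_self _).trans (hD z (Metric.ball_subset_closedBall hz))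
      have h5 := hC u hu
      have hu0 := hu.1.le
      have hC0 : 0 ≤ C := nonneg_of_mul_nonneg_left ((norm_nonneg _).trans h5)
        (Real.rpow_pos_of_pos hu.1 _)
      rw [axisMellinIntegrand, norm_mul, norm_mul, norm_I, mul_one, norm_axis_cpow hu.1]
      calc _ ≤ (b ^ ((z - 1).re - -(‖s‖ + 2)) * u ^ (-(‖s‖ + 2))) *
            Real.exp (-(Real.pi / 2 * (z - 1).im)) * (C * u ^ (‖s‖ + 2)) := by
            gcongr
            exact rpow_le_rpow_mul hu.1 hu.2 h1
        _ = (b ^ ((z - 1).re - -(‖s‖ + 2)) * Real.exp (-(Real.pi / 2 * (z - 1).im))) *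
            (C * (u ^ (-(‖s‖ + 2)) * u ^ (‖s‖ + 2))) := by ring
        _ = (b ^ ((z - 1).re - -(‖s‖ + 2)) * Real.exp (-(Real.pi / 2 * (z - 1).im))) * C := by
            rw [← Real.rpow_add hu.1]; simp
        _ ≤ D * C := by gcongr
  refine ⟨0, fun s => -∫ u in Set.Ioc 0 b, axisMellinIntegrand h s u, hc, by simpa using hbd 0,
    fun s _ => (hdiff.analyticAt s).neg.meromorphicAt, fun s _ => (hdiff.analyticAt s).neg,
    fun s _ => ?_⟩
  rw [intervalIntegral.integral_of_ge hb.le]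

/-- Split `f` at `0` as `c z ^ k` plus a function vanishing to infinite order. The power only
translates the Mellin variable, and the rest overcomes the polynomial growth of `h`, giving an
entire transform. -/
lemma onAxis_mul (hb : 0 < b) (H : HasMellinContinuation b h) {f : ℍ → ℂ}
    (hf : AxisAdmissible f) : HasMellinContinuation b fun u => onAxis f u * h u := by
  obtain ⟨c, k, hO⟩ := hf.isBigO_zero
  have hcr : ContinuousOn (fun u : ℝ => onAxis f u - c * ((u : ℂ) * I) ^ (k : ℂ)) (Set.Ioi 0) :=
    hf.continuousOn.sub (continuousOn_const.mul (continuousOn_axis_cpow _))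
  have h1 : HasMellinContinuation b
      fun u => (onAxis f u - c * ((u : ℂ) * I) ^ (k : ℂ)) * h u := by
    obtain ⟨A, G, H⟩ := H
    obtain ⟨C, hC⟩ := H.bound
    refine of_isBigO hb (hcr.mul H.continuousOn) fun M => ?_
    have h2 : h =O[𝓝[>] 0] fun u => u ^ (-A) := by
      refine IsBigO.of_bound C ?_
      filter_upwards [Ioc_mem_nhdsGT hb] with u hu
      rw [Real.norm_of_nonneg (Real.rpow_nonneg hu.1.le _)]
      exact hC u hu
    have h3 := (hO (M + A)).mul h2
    refine h3.congr' (Eventually.of_forall fun u => by simp only [cpow_intCast]) ?_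
    filter_upwards [self_mem_nhdsWithin] with u (hu : 0 < u)
    rw [← Real.rpow_add hu]
    congr 1
    ring
  convert! congr_add hb h1 ((H.cpow_mul hb (k : ℂ)).const_mul c) using 2 with u
  ring

lemma one (hb : 0 < b) : HasMellinContinuation b fun _ => 1 := by
  have han (s : ℂ) (hs : s ≠ 0) : AnalyticAt ℂ (fun s => -(((b : ℂ) * I) ^ s / s)) s :=
    (((differentiable_axis_cpow hb differentiable_id).analyticAt s).div analyticAt_id hs).neg
  have hne (s : ℂ) (hs : 0 < s.re) : s ≠ 0 := fun h => by simp [h] at hs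
  have hbd : ∃ C, ∀ u ∈ Set.Ioc 0 b, ‖(fun _ => 1 : ℝ → ℂ) u‖ ≤ C * u ^ (-0 : ℝ) := ⟨1, by simp⟩
  refine ⟨0, fun s => -(((b : ℂ) * I) ^ s / s), continuousOn_const, hbd,
    fun s _ => (((differentiable_axis_cpow hb differentiable_id).analyticAt s).meromorphicAt.div
      analyticAt_id.meromorphicAt).neg, fun s hs => han s (hne s hs), fun s hs => ?_⟩
  have hi := intervalIntegrable_axisMellinIntegrand hb (h := fun _ => 1) continuousOn_const hbd hs
  rw [intervalIntegral.integral_symm, intervalIntegral.integral_eq_sub_of_hasDerivAt_of_tendsto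
    (f := fun u : ℝ => ((u : ℂ) * I) ^ s / s) (fa := 0) (fb := ((b : ℂ) * I) ^ s / s) hb ?_ hi
    ?_ ?_, sub_zero]
  · intro u hu
    refine ((hasDerivAt_axis_cpow hu.1 s).div_const s).congr_deriv ?_
    have := hne s hs
    simp only [axisMellinIntegrand]
    field_simp
  · rw [tendsto_zero_iff_norm_tendsto_zero]
    have h1 : Tendsto (fun u : ℝ => u ^ s.re * Real.exp (-(Real.pi / 2 * s.im)) / ‖s‖) (𝓝[>] 0)
        (𝓝 0) := by
      have := ((Real.continuousAt_rpow_const 0 s.re (Or.inr hs.le)).tendsto.mono_left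
        (nhdsWithin_le_nhds (s := Set.Ioi 0))).mul_const (Real.exp (-(Real.pi / 2 * s.im)))
      simpa [Real.zero_rpow hs.ne'] using this.div_const ‖s‖
    refine h1.congr' ?_
    filter_upwards [self_mem_nhdsWithin] with u (hu : 0 < u)
    rw [norm_div, norm_axis_cpow hu]
  · exact ((hasDerivAt_axis_cpow hb s).div_const s).continuousAt.tendsto.mono_left
      nhdsWithin_le_nhds

end HasMellinContinuation

lemma hasDerivAt_integral_of_continuousOn_Ioi {h : ℝ → ℂ} (hc : ContinuousOn h (Set.Ioi 0))
    {b t : ℝ} (hb : 0 < b) (ht : 0 < t) : HasDerivAt (fun t => ∫ u in b..t, h u) (h t) t := by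
  refine intervalIntegral.integral_hasDerivAt_right ?_
    (hc.stronglyMeasurableAtFilter isOpen_Ioi t ht) (hc.continuousAt (Ioi_mem_nhds ht))
  exact (hc.mono fun u hu => lt_of_lt_of_le (lt_min hb ht) hu.1).intervalIntegrable

/-- Partial integration with `z ^ s / s`: the boundary term vanishes at `b` because the primitive
does, and at `0` for large `Re s`. The transform of the primitive is therefore `-G(s + 1) / (sI)`.
-/
lemma HasMellinContinuation.integral {b : ℝ} {h : ℝ → ℂ} (hb : 0 < b)
    (H : HasMellinContinuation b h) : HasMellinContinuation b fun t => ∫ u in b..t, h u := by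
  obtain ⟨A, G, H⟩ := H
  -- A nonnegative abscissa keeps `s ≠ 0` in the half-plane, and makes `u ^ (-B)` decreasing, so
  -- that the primitive obeys a bound of the same order as `h`.
  replace H := H.mono (le_max_left A 0)
  set B := max A 0
  have hB : 0 ≤ B := le_max_right A 0
  have hne (s : ℂ) (hs : B < s.re) : s ≠ 0 := fun h => by simp [h] at hs; linarith
  have hd (s : ℂ) : AnalyticAt ℂ (fun s => s + 1) s := by fun_prop
  have hderiv {t : ℝ} (ht : 0 < t) :=
    hasDerivAt_integral_of_continuousOn_Ioi H.continuousOn hb ht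
  have hcont : ContinuousOn (fun t => ∫ u in b..t, h u) (Set.Ioi 0) := fun t ht =>
    (hderiv ht).continuousAt.continuousWithinAt
  obtain ⟨C, hC⟩ := H.bound
  have hbd : ∀ t ∈ Set.Ioc 0 b, ‖∫ u in b..t, h u‖ ≤ C * b * t ^ (-B) := by
    intro t ht
    have hC0 : 0 ≤ C := nonneg_of_mul_nonneg_left ((norm_nonneg _).trans (hC t ht))
      (Real.rpow_pos_of_pos ht.1 _)
    refine (intervalIntegral.norm_integral_le_of_norm_le_const (C := C * t ^ (-B))
      fun u hu => ?_).trans ?_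
    · rw [Set.uIoc_of_ge ht.2] at hu
      refine (hC u ⟨ht.1.trans hu.1, hu.2⟩).trans ?_
      gcongr ?_ * ?_
      exact Real.rpow_le_rpow_of_nonpos ht.1 hu.1.le (by linarith)
    · have h1 : |t - b| ≤ b := by rw [abs_le]; constructor <;> linarith [ht.1, ht.2]
      have := ht.1.le
      calc _ ≤ C * t ^ (-B) * b := by gcongr
        _ = _ := by ring
  have hmero : MeromorphicOn (fun s => -(G (s + 1) / (s * I))) Set.univ := fun s _ => by
    have h1 : MeromorphicAt (fun s => G (s + 1)) s := MeromorphicAt.comp_analyticAt (f := G)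
      (g := fun s => s + 1) (H.meromorphicOn (s + 1) (Set.mem_univ _)) (hd s)
    have h2 : AnalyticAt ℂ (fun s : ℂ => s * I) s := by fun_prop
    exact (h1.div h2.meromorphicAt).neg
  refine ⟨B, fun s => -(G (s + 1) / (s * I)), hcont, ⟨C * b, hbd⟩, hmero, fun s hs => ?_,
    fun s hs => ?_⟩
  · have h1 : AnalyticAt ℂ (fun s => G (s + 1)) s := AnalyticAt.fun_comp (g := G)
      (f := fun s => s + 1) (H.analyticAt (s + 1) (by simp; linarith)) (hd s)
    have h2 : AnalyticAt ℂ (fun s : ℂ => s * I) s := by fun_prop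
    exact (h1.div h2 (mul_ne_zero (hne s hs) I_ne_zero)).neg
  · have hs1 : B < (s + 1).re := by simp; linarith
    have hs0 := hne s hs
    have hi1 := intervalIntegrable_axisMellinIntegrand hb hcont ⟨C * b, hbd⟩ hs
    have hi2 := H.intervalIntegrable hb hs1
    have hi3 : IntervalIntegrable (fun u => axisMellinIntegrand (fun t => ∫ u in b..t, h u) s u +
        (s * I)⁻¹ * axisMellinIntegrand h (s + 1) u) volume 0 b :=
      hi1.add (hi2.const_mul _)
    have key := intervalIntegral.integral_eq_sub_of_hasDerivAt_of_tendsto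
      (f := fun t : ℝ => ((t : ℂ) * I) ^ s / s * ∫ u in b..t, h u) (fa := 0) (fb := 0) hb
      (fun t ht => by
        refine (((hasDerivAt_axis_cpow ht.1 s).div_const s).mul (hderiv ht.1)).congr_deriv ?_
        simp only [axisMellinIntegrand, add_sub_cancel_right]
        have := I_ne_zero
        field_simp) hi3 ?_ ?_
    · rw [intervalIntegral.integral_add hi1 (hi2.const_mul _),
        intervalIntegral.integral_const_mul] at key
      rw [H.eq_integral _ hs1, intervalIntegral.integral_symm 0 b,
        intervalIntegral.integral_symm 0 b]
      rw [sub_zero] at key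
      rw [eq_neg_of_add_eq_zero_left key]
      ring
    · have h1 : Tendsto (fun t : ℝ => Real.exp (-(Real.pi / 2 * s.im)) / ‖s‖ * (C * b) *
          t ^ (s.re - B)) (𝓝[>] 0) (𝓝 0) := by
        have := ((Real.continuousAt_rpow_const 0 (s.re - B) (Or.inr (by linarith))).tendsto.mono_left
          (nhdsWithin_le_nhds (s := Set.Ioi 0))).const_mul
            (Real.exp (-(Real.pi / 2 * s.im)) / ‖s‖ * (C * b))
        simpa [Real.zero_rpow (sub_pos.2 hs).ne'] using this
      refine squeeze_zero_norm' ?_ h1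
      filter_upwards [Ioc_mem_nhdsGT hb] with t ht
      rw [norm_mul, norm_div, norm_axis_cpow ht.1, sub_eq_add_neg s.re, Real.rpow_add ht.1]
      have := hbd t ht
      have := ht.1.le
      calc _ ≤ t ^ s.re * Real.exp (-(Real.pi / 2 * s.im)) / ‖s‖ * (C * b * t ^ (-B)) := by gcongr
        _ = _ := by ring
    · have h1 : Tendsto (fun t : ℝ => ((t : ℂ) * I) ^ s / s * ∫ u in b..t, h u) (𝓝 b)
          (𝓝 (((b : ℂ) * I) ^ s / s * ∫ u in b..b, h u)) :=
        (((hasDerivAt_axis_cpow hb s).div_const s).mul (hderiv hb)).continuousAt.tendsto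
      rw [intervalIntegral.integral_same, mul_zero] at h1
      exact h1.mono_left nhdsWithin_le_nhds

/-! ### Modular iterated integrals -/

/-- No nonempty suffix has vanishing exponent sum. -/
def SuffixSumsNeZero (l : List ((ℍ → ℂ) × ℂ)) : Prop :=
  ∀ l', l' <:+ l → l' ≠ [] → exponentSum l' ≠ 0

lemma suffixSumsNeZero_nil : SuffixSumsNeZero [] := fun _ h h' => absurd (List.suffix_nil.1 h) h'

lemma suffixSumsNeZero_cons {p : (ℍ → ℂ) × ℂ} {l : List ((ℍ → ℂ) × ℂ)} :
    SuffixSumsNeZero (p :: l) ↔ exponentSum (p :: l) ≠ 0 ∧ SuffixSumsNeZero l := by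
  refine ⟨fun h => ⟨h _ List.suffix_rfl (by simp), fun l' hl' => h l'
    (hl'.trans (List.suffix_cons _ _))⟩, fun h l' hl' hne => ?_⟩
  rcases List.suffix_cons_iff.1 hl' with rfl | hl'
  · exact h.1
  · exact h.2 l' hl' hne

lemma SuffixSumsNeZero.drop {l : List ((ℍ → ℂ) × ℂ)} (h : SuffixSumsNeZero l) (j : ℕ) :
    SuffixSumsNeZero (l.drop j) := fun l' hl' => h l' (hl'.trans (List.drop_suffix j l))

lemma SuffixSumsNeZero.suffixSumProd_ne_zero {l : List ((ℍ → ℂ) × ℂ)} (h : SuffixSumsNeZero l) :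
    suffixSumProd l ≠ 0 := by
  induction l with
  | nil => simp [suffixSumProd]
  | cons p l ih =>
    rw [suffixSumsNeZero_cons] at h
    exact mul_ne_zero h.1 (ih h.2)

/-! ### Continuation in the last and in the first exponent. -/

lemma isEntireFamily_shiftLast {l : List ((ℍ → ℂ) × ℂ)} (hl : ∀ p ∈ l, AxisAdmissible p.1) :
    IsEntireFamily fun w => shiftLast w l := by
  induction l with
  | nil => exact .nil
  | cons p l ih =>
    have hl' : ∀ q ∈ l, AxisAdmissible q.1 := fun q hq => hl q (List.mem_cons_of_mem _ hq)
    have hp := hl p List.mem_cons_self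
    match l with
    | [] => exact .cons hp (by fun_prop) .nil
    | q :: l => exact .cons hp (differentiable_const p.2) (ih hl')

lemma shiftLast_zero (l : List ((ℍ → ℂ) × ℂ)) : shiftLast 0 l = l := by
  induction l with
  | nil => rfl
  | cons p l ih =>
    match l with
    | [] => simp [shiftLast]
    | q :: l => rw [shiftLast, ih]

lemma exponentSum_shiftLast (w : ℂ) {l : List ((ℍ → ℂ) × ℂ)} (hl : l ≠ []) :
    exponentSum (shiftLast w l) = exponentSum l + w := by
  induction l with
  | nil => exact absurd rfl hl
  | cons p l ih =>
    match l with
    | [] => simp [shiftLast]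
    | q :: l => rw [shiftLast, exponentSum_cons, ih (by simp), exponentSum_cons p]; ring

lemma shiftLast_mem {w : ℂ} {l : List ((ℍ → ℂ) × ℂ)} (hl : ∀ p ∈ l, AxisAdmissible p.1) :
    ∀ p ∈ shiftLast w l, AxisAdmissible p.1 := by
  induction l with
  | nil => exact hl
  | cons p l ih =>
    have hl' : ∀ q ∈ l, AxisAdmissible q.1 := fun q hq => hl q (List.mem_cons_of_mem _ hq)
    have hp := hl p List.mem_cons_self
    match l with
    | [] => simpa [shiftLast] using hp
    | q :: l => exact List.forall_mem_cons.2 ⟨hp, ih hl'⟩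

/-- Every nonempty suffix contains the last entry. Shifting that one exponent far to the left thus
makes all the integrals converge. -/
lemma eventually_suffix_shiftLast (l : List ((ℍ → ℂ) × ℂ)) :
    ∀ᶠ w in leftEnd, ∀ l', l' <:+ shiftLast w l → l' ≠ [] → (exponentSum l').re < 0 := by
  induction l with
  | nil => exact Eventually.of_forall fun w l' h h' => absurd (List.suffix_nil.1 h) h'
  | cons p l ih =>
    filter_upwards [ih, eventually_leftEnd (-(exponentSum (p :: l)).re)] with w h1 h2 l' hl' hne
    have h3 : (exponentSum (shiftLast w (p :: l))).re < 0 := by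
      rw [exponentSum_shiftLast w (by simp), add_re]
      linarith
    match l with
    | [] =>
      rw [shiftLast, List.suffix_cons_iff] at hl'
      rcases hl' with rfl | hl'
      · exact h3
      · exact absurd (List.suffix_nil.1 hl') hne
    | q :: l =>
      rw [shiftLast, List.suffix_cons_iff] at hl'
      rcases hl' with rfl | hl'
      · exact h3
      · exact h1 l' hl' hne

lemma one_div_sqrt_pos {N : ℕ} (hN : 0 < N) : 0 < 1 / Real.sqrt N := by positivity

/-- The regularised integral of the shifted list is meromorphic in the shift and equals the
convergent integral far to the left. Nonvanishing suffix sums make it holomorphic at shift `0`. -/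
lemma continuedFromInfinity_eq {N : ℕ} (hN : 0 < N) {l : List ((ℍ → ℂ) × ℂ)}
    (hl : ∀ p ∈ l, AxisAdmissible p.1) (hS : SuffixSumsNeZero l) :
    continuedFromInfinity N l = regularizedIntegral l (1 / Real.sqrt N) := by
  have hb := one_div_sqrt_pos hN
  have hfam := isEntireFamily_shiftLast hl
  rw [continuedFromInfinity, meromorphicContinuation_apply hasInteriorPoints_leftEnd
    (G := fun w => regularizedIntegral (shiftLast w l) (1 / Real.sqrt N))
    (hfam.meromorphicOn_regularizedIntegral hb), shiftLast_zero]
  · filter_upwards [eventually_suffix_shiftLast l] with w hw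
    refine ⟨hfam.analyticAt_regularizedIntegral hb (SuffixSumsNeZero.suffixSumProd_ne_zero
      fun l' h h' h0 => ?_), ?_⟩
    · have := hw l' h h'
      simp [h0] at this
    · rw [integralFromInfinity_eq_regularizedIntegral (shiftLast_mem hl) hw hb]
  · refine hfam.analyticAt_regularizedIntegral hb ?_
    rw [shiftLast_zero]
    exact hS.suffixSumProd_ne_zero

/-- The recursion starts from `1` and multiplies by `f`, by a power of `z` and by `I`, then
integrates from `b`; each operation preserves `HasMellinContinuation`. -/
lemma hasMellinContinuation_integralFromPoint {b : ℝ} (hb : 0 < b) {l : List ((ℍ → ℂ) × ℂ)}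
    (hl : ∀ p ∈ l, AxisAdmissible p.1) : HasMellinContinuation b (integralFromPoint b l) := by
  induction l with
  | nil => exact .one hb
  | cons p l ih =>
    obtain ⟨f, s⟩ := p
    have h1 := ((((ih fun q hq => hl q (List.mem_cons_of_mem _ hq)).onAxis_mul hb
      (hl _ List.mem_cons_self)).cpow_mul hb (s - 1)).const_mul I).integral hb
    convert! h1 using 2 with t
    rw [integralFromPoint]
    congr 1 with u
    rw [integrand_eq]
    ring

lemma integrand_mul_eq (f : ℍ → ℂ) (s : ℂ) (h : ℝ → ℂ) (u : ℝ) :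
    integrand f s u * h u = axisMellinIntegrand (fun u => onAxis f u * h u) s u := by
  rw [integrand_eq, axisMellinIntegrand]
  ring

/-- The defining continuation runs over a shift `w` of the first exponent, separately for each `s`.
The integral depends only on `s + w`, so one function `G` serves all `s` and exhibits the dependence
on `s` as meromorphic. -/
lemma exists_continuedToZero_eq {N : ℕ} (hN : 0 < N) {f : ℍ → ℂ} (hf : AxisAdmissible f)
    {l : List ((ℍ → ℂ) × ℂ)} (hl : ∀ p ∈ l, AxisAdmissible p.1) :
    ∃ (A : ℝ) (G : ℂ → ℂ), MeromorphicOn G Set.univ ∧ (∀ s : ℂ, A < s.re → AnalyticAt ℂ G s) ∧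
      (∀ s, AnalyticAt ℂ G s → continuedToZero N ((f, s) :: l) = G s) ∧
      ∀ s : ℂ, A < s.re →
        Tendsto (integralFromPoint (1 / Real.sqrt N) ((f, s) :: l)) (𝓝[>] 0) (𝓝 (G s)) := by
  have hb := one_div_sqrt_pos hN
  set b := 1 / Real.sqrt N with hbdef
  obtain ⟨A, G, H⟩ := (hasMellinContinuation_integralFromPoint hb hl).onAxis_mul hb hf
  refine ⟨A, G, H.meromorphicOn, H.analyticAt, fun s hs => ?_, fun s hs => ?_⟩
  · have hd (w : ℂ) : AnalyticAt ℂ (fun w => s + w) w := by fun_prop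
    rw [continuedToZero, meromorphicContinuation_apply hasInteriorPoints_rightEnd
      (G := fun w => G (s + w)), add_zero]
    · exact fun w _ => MeromorphicAt.comp_analyticAt (f := G) (g := fun w => s + w)
        (H.meromorphicOn (s + w) (Set.mem_univ _)) (hd w)
    · filter_upwards [eventually_rightEnd (A - s.re)] with w hw
      have hw' : A < (s + w).re := by rw [add_re]; linarith
      refine ⟨AnalyticAt.fun_comp (g := G) (f := fun w => s + w) (H.analyticAt _ hw') (hd w), ?_⟩
      rw [H.eq_integral _ hw', shiftFirst, integralFromPoint]
      simp only [integrand_mul_eq, ← hbdef]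
    · exact AnalyticAt.fun_comp (g := G) (f := fun w => s + w) (by simpa using hs) (hd 0)
  · have h1 := intervalIntegral.continuousOn_primitive_interval' (H.intervalIntegrable hb hs)
      (a := b) Set.right_mem_uIcc
    have h2 := (h1 0 Set.left_mem_uIcc).tendsto
    rw [H.eq_integral s hs]
    simp only [integralFromPoint, integrand_mul_eq]
    refine h2.mono_left ?_
    rw [Set.uIcc_of_le hb.le]
    exact (nhdsWithin_mono _ Set.Ioc_subset_Icc_self).trans' (by
      rw [nhdsWithin_Ioc_eq_nhdsGT hb])

/-- Composition of paths. -/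
lemma regularizedIntegral_eq_sum {b : ℝ} (hb : 0 < b) {l : List ((ℍ → ℂ) × ℂ)}
    (hl : ∀ p ∈ l, AxisAdmissible p.1) (hS : SuffixSumsNeZero l) {t : ℝ} (ht : 0 < t) :
    regularizedIntegral l t = ∑ j ∈ Finset.range (l.length + 1),
      integralFromPoint b (l.take j) t * regularizedIntegral (l.drop j) b := by
  induction l generalizing t with
  | nil => simp [integralFromPoint, regularizedIntegral_nil]
  | cons p l ih =>
    obtain ⟨f, s⟩ := p
    have hf : AxisAdmissible f := hl _ List.mem_cons_self
    have hl' : ∀ p ∈ l, AxisAdmissible p.1 := fun q hq => hl q (List.mem_cons_of_mem _ hq)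
    rw [suffixSumsNeZero_cons] at hS
    have hpos : ∀ u ∈ Set.uIcc b t, 0 < u := fun u hu => lt_of_lt_of_le (lt_min hb ht) hu.1
    have hint (h : ℝ → ℂ) (hh : ContinuousOn h (Set.Ioi 0)) :
        IntervalIntegrable (fun u => integrand f s u * h u) volume b t :=
      (((continuousOn_integrand hf s).mul hh).mono hpos).intervalIntegrable
    have key := intervalIntegral.integral_eq_sub_of_hasDerivAt (fun u hu =>
      hasDerivAt_regularizedIntegral_cons hf hl' hS.1 (hpos u hu))
      (hint _ (continuousOn_regularizedIntegral hl'))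
    have hsum : ∫ u in b..t, integrand f s u * regularizedIntegral l u =
        ∑ j ∈ Finset.range (l.length + 1), integralFromPoint b ((f, s) :: l.take j) t *
          regularizedIntegral (l.drop j) b := by
      calc _ = ∫ u in b..t, ∑ j ∈ Finset.range (l.length + 1),
            integrand f s u * integralFromPoint b (l.take j) u *
              regularizedIntegral (l.drop j) b := by
            refine intervalIntegral.integral_congr fun u hu => ?_
            simp only [ih hl' hS.2 (hpos u hu), Finset.mul_sum, mul_assoc]
        _ = _ := by
            rw [intervalIntegral.integral_finsetSum]
            · refine Finset.sum_congr rfl fun j _ => ?_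
              rw [intervalIntegral.integral_mul_const, integralFromPoint]
            · intro j _
              obtain ⟨A, G, H⟩ := hasMellinContinuation_integralFromPoint hb (l := l.take j)
                fun p hp => hl' p (List.mem_of_mem_take hp)
              exact (hint _ H.continuousOn).mul_const _
    -- The term `j = 0` is the constant of integration, the regularised integral of the whole list
    -- at `b`; the others come from the inner induction hypothesis.
    rw [List.length_cons, Finset.sum_range_succ']
    simp only [List.take_succ_cons, List.drop_succ_cons, List.take_zero, List.drop_zero,
      integralFromPoint, one_mul]
    rw [eq_add_of_sub_eq key.symm, hsum]
    simp only [integralFromPoint]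

/-! ### The integral from `i∞` to `0` as a limit of regularised integrals. -/

/-- The modular iterated integral of a list. -/
def listIteratedIntegral (N : ℕ) (l : List ((ℍ → ℂ) × ℂ)) : ℂ :=
  ∑ j ∈ Finset.range (l.length + 1),
    continuedToZero N (l.take j) * continuedFromInfinity N (l.drop j)

lemma modularIteratedIntegral_eq (N : ℕ) {n : ℕ} (f : Fin n → ℍ → ℂ) (s : Fin n → ℂ) :
    modularIteratedIntegral N f s = listIteratedIntegral N (List.ofFn fun j => (f j, s j)) := by
  simp [modularIteratedIntegral, listIteratedIntegral]

lemma continuedToZero_nil (N : ℕ) : continuedToZero N [] = 1 := by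
  simp only [continuedToZero, shiftFirst, integralFromPoint]
  exact meromorphicContinuation_const hasInteriorPoints_rightEnd 1 0

/-- Let `t → 0` in the composition of paths. The terms `j ≥ 1` depend on `s` through Mellin
continuations, and the term `j = 0` through the regularised integral at the cut point. -/
lemma listIteratedIntegral_properties {N : ℕ} (hN : 0 < N) {f : ℍ → ℂ} (hf : AxisAdmissible f)
    {l : List ((ℍ → ℂ) × ℂ)} (hl : ∀ p ∈ l, AxisAdmissible p.1) (hS : SuffixSumsNeZero l) :
    MeromorphicOn (fun s => listIteratedIntegral N ((f, s) :: l)) Set.univ ∧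
    ∃ σ : ℝ, ∀ s : ℂ, σ < s.re →
      AnalyticAt ℂ (fun s => listIteratedIntegral N ((f, s) :: l)) s ∧
      Tendsto (regularizedIntegral ((f, s) :: l)) (𝓝[>] 0)
        (𝓝 (listIteratedIntegral N ((f, s) :: l))) := by
  have hb := one_div_sqrt_pos hN
  set b := 1 / Real.sqrt N with hbdef
  have hcons (s : ℂ) : ∀ p ∈ (f, s) :: l, AxisAdmissible p.1 := List.forall_mem_cons.2 ⟨hf, hl⟩
  choose A G hG hGa hGe hGt using fun j => exists_continuedToZero_eq hN hf (l := l.take j)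
    fun p hp => hl p (List.mem_of_mem_take hp)
  set E : ℂ → ℂ := fun s => (∑ j ∈ Finset.range (l.length + 1),
    G j s * regularizedIntegral (l.drop j) b) + regularizedIntegral ((f, s) :: l) b with hE
  have hfam : IsEntireFamily fun s => (f, s) :: l :=
    .cons hf differentiable_id (isEntireFamily_const hl)
  have hEm : MeromorphicOn E Set.univ := by
    intro s hs
    refine MeromorphicAt.add (MeromorphicAt.fun_sum fun j _ => ?_)
      (hfam.meromorphicOn_regularizedIntegral hb s hs)
    exact (hG j s hs).mul (MeromorphicAt.const _ s)
  have hEa (s : ℂ) (h1 : ∀ j ∈ Finset.range (l.length + 1), AnalyticAt ℂ (G j) s)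
      (h2 : s + exponentSum l ≠ 0) : AnalyticAt ℂ E s := by
    refine AnalyticAt.add (Finset.analyticAt_fun_sum _ fun j hj => (h1 j hj).mul analyticAt_const)
      (hfam.analyticAt_regularizedIntegral hb (SuffixSumsNeZero.suffixSumProd_ne_zero ?_))
    exact suffixSumsNeZero_cons.2 ⟨by simpa using h2, hS⟩
  have heq (s : ℂ) (h1 : ∀ j ∈ Finset.range (l.length + 1), AnalyticAt ℂ (G j) s)
      (h2 : s + exponentSum l ≠ 0) : listIteratedIntegral N ((f, s) :: l) = E s := by
    rw [listIteratedIntegral, List.length_cons, Finset.sum_range_succ']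
    simp only [List.take_succ_cons, List.drop_succ_cons, List.take_zero, List.drop_zero]
    rw [continuedToZero_nil, one_mul, continuedFromInfinity_eq hN (hcons s)
      (suffixSumsNeZero_cons.2 ⟨by simpa using h2, hS⟩), hE]
    congr 1
    refine Finset.sum_congr rfl fun j hj => ?_
    rw [hGe j s (h1 j hj), continuedFromInfinity_eq hN
      (fun p hp => hl p (List.mem_of_mem_drop hp)) (hS.drop j)]
  refine ⟨fun s hs => ?_, ?_⟩
  -- At poles of the single factors the normalised values are conventional, so agreement with `E` is
  -- claimed only on punctured neighbourhoods; that suffices for meromorphy.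
  · refine (hEm s hs).congr ?_
    have h1 : ∀ᶠ z in 𝓝[≠] s, ∀ j ∈ Finset.range (l.length + 1), AnalyticAt ℂ (G j) z := by
      rw [Filter.eventually_all_finset]
      exact fun j _ => (hG j s hs).eventually_analyticAt
    have h2 : ∀ᶠ z in 𝓝[≠] s, z + exponentSum l ≠ 0 := by
      rcases eq_or_ne s (-exponentSum l) with rfl | hne
      · filter_upwards [self_mem_nhdsWithin] with z hz h
        exact hz (eq_neg_of_add_eq_zero_left h)
      · filter_upwards [(eventually_ne_nhds hne).filter_mono nhdsWithin_le_nhds] with z hz h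
        exact hz (eq_neg_of_add_eq_zero_left h)
    filter_upwards [h1, h2] with z hz hz'
    exact (heq z hz hz').symm
  · obtain ⟨B, hB⟩ := ((Finset.range (l.length + 1)).image A).exists_le
    refine ⟨max B (-(exponentSum l).re), fun s hs => ?_⟩
    have hgood (z : ℂ) (hz : max B (-(exponentSum l).re) < z.re) :
        (∀ j ∈ Finset.range (l.length + 1), A j < z.re) ∧ z + exponentSum l ≠ 0 := by
      refine ⟨fun j hj => ?_, fun h => ?_⟩
      · exact (hB _ (Finset.mem_image_of_mem A hj)).trans_lt ((le_max_left _ _).trans_lt hz)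
      · have h1 := congr_arg Complex.re h
        rw [add_re, zero_re] at h1
        linarith [(le_max_right _ _).trans_lt hz]
    obtain ⟨h1, h2⟩ := hgood s hs
    refine ⟨(hEa s (fun j hj => hGa j s (h1 j hj)) h2).congr ?_, ?_⟩
    · filter_upwards [(isOpen_lt continuous_const Complex.continuous_re).mem_nhds hs] with z hz
      obtain ⟨h1, h2⟩ := hgood z hz
      exact (heq z (fun j hj => hGa j z (h1 j hj)) h2).symm
    · rw [heq s (fun j hj => hGa j s (h1 j hj)) h2]
      have h3 : Tendsto (fun t => (∑ j ∈ Finset.range (l.length + 1),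
          integralFromPoint b ((f, s) :: l.take j) t * regularizedIntegral (l.drop j) b) +
          regularizedIntegral ((f, s) :: l) b) (𝓝[>] 0) (𝓝 (E s)) :=
        (tendsto_finsetSum _ fun j hj => (hGt j s (h1 j hj)).mul_const _).add tendsto_const_nhds
      refine h3.congr' ?_
      filter_upwards [self_mem_nhdsWithin] with t (ht : 0 < t)
      rw [regularizedIntegral_eq_sum hb (hcons s)
        (suffixSumsNeZero_cons.2 ⟨by simpa using h2, hS⟩) ht, List.length_cons,
        Finset.sum_range_succ' _ (l.length + 1)]
      simp [integralFromPoint]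

/-! ### Primitives of iterated integrals with integral exponents -/

/-- `G` is asymptotic to `z ^ s p(z)` at `i∞`, up to `o(1)`, for some polynomial `p`. -/
def HasPowerAsymptotics (s : ℂ) (G : ℝ → ℂ) : Prop :=
  ∃ p : Polynomial ℂ, Tendsto (fun u : ℝ => G u - ((u : ℂ) * I) ^ s * p.eval ((u : ℂ) * I))
    atTop (𝓝 0)

namespace HasPowerAsymptotics

variable {s : ℂ} {G H : ℝ → ℂ}

lemma zero (s : ℂ) : HasPowerAsymptotics s fun _ => 0 := ⟨0, by simp⟩

lemma add (hG : HasPowerAsymptotics s G) (hH : HasPowerAsymptotics s H) :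
    HasPowerAsymptotics s fun u => G u + H u := by
  obtain ⟨p, hp⟩ := hG
  obtain ⟨q, hq⟩ := hH
  refine ⟨p + q, ?_⟩
  have := hp.add hq
  rw [add_zero] at this
  refine this.congr fun u => ?_
  rw [Polynomial.eval_add]
  ring

lemma const_mul (hG : HasPowerAsymptotics s G) (c : ℂ) :
    HasPowerAsymptotics s fun u => c * G u := by
  obtain ⟨p, hp⟩ := hG
  refine ⟨Polynomial.C c * p, ?_⟩
  have := hp.const_mul c
  rw [mul_zero] at this
  refine this.congr fun u => ?_
  rw [Polynomial.eval_mul, Polynomial.eval_C]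
  ring

lemma of_eq (m : ℕ) (c : ℂ) {E : ℝ → ℂ} (hE : Tendsto E atTop (𝓝 0))
    (h : ∀ u > 0, G u = c * ((u : ℂ) * I) ^ (s + m) + E u) : HasPowerAsymptotics s G := by
  refine ⟨Polynomial.C c * Polynomial.X ^ m, hE.congr' ?_⟩
  filter_upwards [eventually_gt_atTop 0] with u hu
  rw [h u hu, axis_cpow_add hu, cpow_natCast]
  simp only [Polynomial.eval_mul, Polynomial.eval_C, Polynomial.eval_pow, Polynomial.eval_X]
  ring

/-- If `z ^ s p(z)` has a finite limit, multiplying by `z ^ (-s) → 0` gives `p(z) → 0`, which forces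
`p = 0`. This fixes every constant of integration at `i∞` below. -/
lemma eq_zero_of_tendsto (hG : HasPowerAsymptotics s G) (hs : 0 < s.re) {κ : ℂ}
    (hκ : Tendsto G atTop (𝓝 κ)) : κ = 0 := by
  obtain ⟨p, hp⟩ := hG
  have h1 : Tendsto (fun u : ℝ => ((u : ℂ) * I) ^ s * p.eval ((u : ℂ) * I)) atTop (𝓝 κ) := by
    have := hκ.sub hp
    rw [sub_zero] at this
    exact this.congr fun u => by ring
  have h2 : Tendsto (fun u : ℝ => p.eval ((u : ℂ) * I)) atTop (𝓝 0) := by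
    have := (tendsto_axis_cpow_atTop (s := -s) (by simpa using hs)).mul h1
    rw [zero_mul] at this
    refine this.congr' ?_
    filter_upwards [eventually_gt_atTop 0] with u hu
    rw [← mul_assoc, ← axis_cpow_add hu, neg_add_cancel, cpow_zero, one_mul]
  have h3 : p = 0 := by
    by_contra hne
    rcases lt_or_ge 0 p.degree with hd | hd
    · have h4 : Tendsto (fun u : ℝ => ‖(u : ℂ) * I‖) atTop atTop := by
        simpa using tendsto_abs_atTop_atTop
      exact not_tendsto_nhds_of_tendsto_atTop (p.tendsto_norm_atTop hd h4) _ h2.norm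
    · rw [Polynomial.eq_C_of_degree_le_zero hd] at h2 hne
      simp only [Polynomial.eval_C] at h2
      exact hne (by rw [tendsto_nhds_unique tendsto_const_nhds h2, Polynomial.C_0])
  simp only [h3, Polynomial.eval_zero, mul_zero] at h1
  exact tendsto_nhds_unique h1 tendsto_const_nhds

end HasPowerAsymptotics

/-- The list with positive integral exponents as a list with complex exponents. -/
def castExponents (K : List ((ℍ → ℂ) × ℕ+)) : List ((ℍ → ℂ) × ℂ) :=
  K.map fun p => (p.1, ((p.2 : ℕ) : ℂ))

@[simp] lemma castExponents_nil : castExponents [] = [] := rfl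

@[simp] lemma castExponents_cons (p : (ℍ → ℂ) × ℕ+) (K) :
    castExponents (p :: K) = (p.1, ((p.2 : ℕ) : ℂ)) :: castExponents K := rfl

lemma exists_exponentSum_castExponents (K : List ((ℍ → ℂ) × ℕ+)) :
    ∃ m : ℕ, exponentSum (castExponents K) = m := by
  induction K with
  | nil => exact ⟨0, by simp⟩
  | cons p K ih =>
    obtain ⟨m, hm⟩ := ih
    exact ⟨p.2 + m, by simp [hm]⟩

lemma exponentSum_cons_castExponents_ne_zero {s : ℂ} (hs : 0 < s.re) (f : ℍ → ℂ)
    (K : List ((ℍ → ℂ) × ℕ+)) : exponentSum ((f, s) :: castExponents K) ≠ 0 := by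
  obtain ⟨m, hm⟩ := exists_exponentSum_castExponents K
  rw [exponentSum_cons, hm]
  intro h
  have := congr_arg Complex.re h
  simp only [add_re, natCast_re, zero_re] at this
  linarith [m.cast_nonneg (α := ℝ)]

lemma suffixSumsNeZero_castExponents (K : List ((ℍ → ℂ) × ℕ+)) :
    SuffixSumsNeZero (castExponents K) := by
  induction K with
  | nil => exact suffixSumsNeZero_nil
  | cons p K ih =>
    exact suffixSumsNeZero_cons.2
      ⟨exponentSum_cons_castExponents_ne_zero (by simp) p.1 K, ih⟩

lemma castExponents_mem {K : List ((ℍ → ℂ) × ℕ+)} (hK : ∀ p ∈ K, AxisAdmissible p.1) :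
    ∀ p ∈ castExponents K, AxisAdmissible p.1 := by
  simp only [castExponents, List.forall_mem_map]
  exact hK

/-- The function `z ^ t I_{i∞}^z(K)`. -/
def monomialIntegral (t : ℕ) (K : List ((ℍ → ℂ) × ℕ+)) (u : ℝ) : ℂ :=
  ((u : ℂ) * I) ^ (t : ℂ) * regularizedIntegral (castExponents K) u

/-- A primitive of `z ^ (s - 1) z ^ t I_{i∞}^z(K)`, obtained by partial integration. -/
def monomialPrimitive (s : ℂ) (t : ℕ) : List ((ℍ → ℂ) × ℕ+) → ℝ → ℂ
  | [], u => (s + t)⁻¹ * ((u : ℂ) * I) ^ (s + t)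
  | (f, β) :: K, u => (s + t)⁻¹ * (((u : ℂ) * I) ^ (s + t) *
      regularizedIntegral (castExponents ((f, β) :: K)) u -
      regularizedIntegral ((f, s + (t + (β : ℕ) : ℕ)) :: castExponents K) u)

/-! ### Derivatives and asymptotics of the explicit primitives. -/

section Primitives

variable {s : ℂ} {f : ℍ → ℂ} {K : List ((ℍ → ℂ) × ℕ+)} (t : ℕ)

lemma re_add_natCast_pos (hs : 0 < s.re) : 0 < (s + t).re := by
  rw [add_re, natCast_re]
  positivity

lemma add_natCast_ne_zero (hs : 0 < s.re) : s + t ≠ 0 := fun h => by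
  have := re_add_natCast_pos t hs
  simp [h] at this

lemma hasDerivAt_onAxis_mul_primitive (hs : 0 < s.re) (hf : AxisAdmissible f)
    (hK : ∀ p ∈ K, AxisAdmissible p.1) {u : ℝ} (hu : 0 < u) :
    HasDerivAt (regularizedIntegral ((f, s + t) :: castExponents K))
      (axisMellinIntegrand (fun u => onAxis f u * monomialIntegral t K u) s u) u := by
  refine (hasDerivAt_regularizedIntegral_cons hf (castExponents_mem hK)
    (exponentSum_cons_castExponents_ne_zero (re_add_natCast_pos t hs) f K) hu).congr_deriv ?_
  rw [integrand_eq, axisMellinIntegrand, monomialIntegral, show s + t - 1 = (s - 1) + t by ring,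
    axis_cpow_add hu]
  ring

lemma hasDerivAt_monomialPrimitive (hs : 0 < s.re) (hK : ∀ p ∈ K, AxisAdmissible p.1) {u : ℝ}
    (hu : 0 < u) : HasDerivAt (monomialPrimitive s t K)
      (axisMellinIntegrand (monomialIntegral t K) s u) u := by
  have hne := add_natCast_ne_zero t hs
  have h0 : ((u : ℂ) * I) ^ (s + t - 1) = ((u : ℂ) * I) ^ (s - 1) * ((u : ℂ) * I) ^ (t : ℂ) := by
    rw [← axis_cpow_add hu]; congr 1; ring
  match K with
  | [] =>
    refine ((hasDerivAt_axis_cpow hu (s + t)).const_mul ((s + t)⁻¹)).congr_deriv ?_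
    rw [axisMellinIntegrand, monomialIntegral, castExponents_nil, regularizedIntegral_nil, h0]
    field_simp
  | (f, β) :: K =>
    have hf : AxisAdmissible f := hK _ List.mem_cons_self
    have hK' : ∀ p ∈ K, AxisAdmissible p.1 := fun q hq => hK q (List.mem_cons_of_mem _ hq)
    have h1 := hasDerivAt_regularizedIntegral_cons (s := (β : ℕ)) hf (castExponents_mem hK')
      (exponentSum_cons_castExponents_ne_zero (by simp) f K) hu
    have h2 := hasDerivAt_onAxis_mul_primitive (t + β) hs hf hK' hu
    refine ((((hasDerivAt_axis_cpow hu (s + t)).mul h1).sub h2).const_mul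
      ((s + t)⁻¹)).congr_deriv ?_
    have h3 : ((u : ℂ) * I) ^ (s + t) * ((u : ℂ) * I) ^ (((β : ℕ) : ℂ) - 1) =
        ((u : ℂ) * I) ^ (s - 1) * ((u : ℂ) * I) ^ ((t + β : ℕ) : ℂ) := by
      rw [← axis_cpow_add hu, ← axis_cpow_add hu]; congr 1; push_cast; ring
    simp only [axisMellinIntegrand, monomialIntegral, integrand_eq, castExponents_cons, h0]
    rw [inv_mul_eq_iff_eq_mul₀ hne]
    linear_combination (onAxis f u * I * regularizedIntegral (castExponents K) u) * h3

lemma regularizedIntegral_eq_add (l : List ((ℍ → ℂ) × ℂ)) (u : ℝ) :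
    regularizedIntegral l u = constantTermProd l / suffixSumProd l *
      ((u : ℂ) * I) ^ exponentSum l + (suffixSumProd l)⁻¹ * regularizedRemainder l u := by
  rw [regularizedIntegral, regularizedNum]
  ring

lemma tendsto_cpow_mul_regularizedRemainder {l : List ((ℍ → ℂ) × ℂ)}
    (hl : ∀ p ∈ l, AxisAdmissible p.1) (s : ℂ) :
    Tendsto (fun u : ℝ => ((u : ℂ) * I) ^ s * ((suffixSumProd l)⁻¹ * regularizedRemainder l u))
      atTop (𝓝 0) := by
  have := (((isEntireFamily_const hl).entireRapid.cpow_mul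
    (differentiable_const s)).entire_mul (differentiable_const (suffixSumProd l)⁻¹)).tendsto_zero 0
  exact this.congr fun u => by ring

lemma hasPowerAsymptotics_regularizedIntegral (hf : AxisAdmissible f)
    (hK : ∀ p ∈ K, AxisAdmissible p.1) :
    HasPowerAsymptotics s (regularizedIntegral ((f, s + t) :: castExponents K)) := by
  obtain ⟨m, hm⟩ := exists_exponentSum_castExponents K
  have hl : ∀ p ∈ (f, s + t) :: castExponents K, AxisAdmissible p.1 :=
    List.forall_mem_cons.2 ⟨hf, castExponents_mem hK⟩
  refine .of_eq (t + m) (constantTermProd ((f, s + t) :: castExponents K) /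
    suffixSumProd ((f, s + t) :: castExponents K))
    (tendsto_cpow_mul_regularizedRemainder hl 0) fun u hu => ?_
  rw [regularizedIntegral_eq_add, cpow_zero, one_mul, exponentSum_cons, hm]
  push_cast
  rw [add_assoc]

lemma hasPowerAsymptotics_monomialPrimitive (hK : ∀ p ∈ K, AxisAdmissible p.1) :
    HasPowerAsymptotics s (monomialPrimitive s t K) := by
  match K with
  | [] =>
    refine .of_eq t ((s + t)⁻¹) tendsto_const_nhds fun u hu => ?_
    rw [monomialPrimitive, add_zero]
  | (f, β) :: K =>
    have hf : AxisAdmissible f := hK _ List.mem_cons_self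
    have hK' : ∀ p ∈ K, AxisAdmissible p.1 := fun q hq => hK q (List.mem_cons_of_mem _ hq)
    obtain ⟨m, hm⟩ := exists_exponentSum_castExponents ((f, β) :: K)
    have h1 : HasPowerAsymptotics s fun u => ((u : ℂ) * I) ^ (s + t) *
        regularizedIntegral (castExponents ((f, β) :: K)) u := by
      refine .of_eq (t + m) (constantTermProd (castExponents ((f, β) :: K)) /
        suffixSumProd (castExponents ((f, β) :: K))) (tendsto_cpow_mul_regularizedRemainder
        (castExponents_mem hK) (s + t)) fun u hu => ?_
      rw [regularizedIntegral_eq_add, hm, Nat.cast_add, ← add_assoc, axis_cpow_add hu (s + t)]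
      ring
    have h2 := (hasPowerAsymptotics_regularizedIntegral (s := s) (t + β) hf hK').const_mul (-1)
    convert! (h1.add h2).const_mul ((s + t)⁻¹) using 2 with u
    rw [monomialPrimitive]
    ring

/-- At `0` the regularised integral has at most polynomial growth, of an order independent of `s`,
as composition of paths at `z = i` shows. So the boundary terms of partial integration vanish for
large `Re s`. -/
lemma exists_tendsto_cpow_mul_regularizedIntegral (hK : ∀ p ∈ K, AxisAdmissible p.1) :
    ∃ σ : ℝ, ∀ s : ℂ, σ < s.re → Tendsto (fun u : ℝ => ((u : ℂ) * I) ^ (s + t) *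
      regularizedIntegral (castExponents K) u) (𝓝[>] 0) (𝓝 0) := by
  have hl := castExponents_mem hK
  set l := castExponents K with hldef
  choose A G H using fun j => hasMellinContinuation_integralFromPoint one_pos (l := l.take j)
    fun p hp => hl p (List.mem_of_mem_take hp)
  obtain ⟨B, hB⟩ := ((Finset.range (l.length + 1)).image A).exists_le
  refine ⟨B, fun s hs => ?_⟩
  have h1 : ∀ j ∈ Finset.range (l.length + 1), Tendsto (fun u : ℝ => ((u : ℂ) * I) ^ (s + t) *
      (integralFromPoint 1 (l.take j) u * regularizedIntegral (l.drop j) 1)) (𝓝[>] 0) (𝓝 0) := by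
    intro j hj
    obtain ⟨C, hC⟩ := (H j).bound
    have hpos : 0 < (s + t).re - A j := by
      have := hB _ (Finset.mem_image_of_mem A hj)
      rw [add_re, natCast_re]
      linarith [t.cast_nonneg (α := ℝ)]
    have h2 : Tendsto (fun u : ℝ => Real.exp (-(Real.pi / 2 * (s + t).im)) * C *
        ‖regularizedIntegral (l.drop j) 1‖ * u ^ ((s + t).re - A j)) (𝓝[>] 0) (𝓝 0) := by
      have := ((Real.continuousAt_rpow_const 0 ((s + t).re - A j)
        (Or.inr hpos.le)).tendsto.mono_left (nhdsWithin_le_nhds (s := Set.Ioi 0))).const_mul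
          (Real.exp (-(Real.pi / 2 * (s + t).im)) * C * ‖regularizedIntegral (l.drop j) 1‖)
      rwa [Real.zero_rpow hpos.ne', mul_zero] at this
    refine squeeze_zero_norm' ?_ h2
    filter_upwards [Ioc_mem_nhdsGT one_pos] with u hu
    rw [norm_mul, norm_mul, norm_axis_cpow hu.1, sub_eq_add_neg, Real.rpow_add hu.1]
    have := hC u hu
    have := hu.1.le
    calc _ ≤ u ^ (s + t).re * Real.exp (-(Real.pi / 2 * (s + t).im)) *
          (C * u ^ (-A j) * ‖regularizedIntegral (l.drop j) 1‖) := by gcongr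
      _ = _ := by ring
  have h3 := tendsto_finsetSum _ h1
  rw [Finset.sum_const_zero] at h3
  refine h3.congr' ?_
  filter_upwards [self_mem_nhdsWithin] with u (hu : 0 < u)
  rw [regularizedIntegral_eq_sum one_pos hl (suffixSumsNeZero_castExponents K) hu, Finset.mul_sum]

end Primitives

/-! ### The module of iterated integrals with integral exponents -/

/-- The functions `z ^ t I_{i∞}^z(K)`, where the functions in `K` form a sublist of `L`. -/
def monomialIntegrals (L : List (ℍ → ℂ)) : Set (ℝ → ℂ) :=
  {g | ∃ t K, (K.map Prod.fst).Sublist L ∧ g = monomialIntegral t K}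

variable (A : Subalgebra ℚ ℂ)

/-- The linear combinations of the functions `z ^ t I_{i∞}^z(K)`. -/
def integralModule (L : List (ℍ → ℂ)) : Submodule A (ℝ → ℂ) :=
  Submodule.span A (monomialIntegrals L)

variable {A} {L : List (ℍ → ℂ)} {f : ℍ → ℂ}

lemma monomialIntegral_mem {t : ℕ} {K : List ((ℍ → ℂ) × ℕ+)} (hK : (K.map Prod.fst).Sublist L) :
    monomialIntegral t K ∈ integralModule A L := Submodule.subset_span ⟨t, K, hK, rfl⟩

lemma integralModule_le_cons : integralModule A L ≤ integralModule A (f :: L) := by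
  refine Submodule.span_mono ?_
  rintro g ⟨t, K, hK, rfl⟩
  exact ⟨t, K, hK.cons f, rfl⟩

lemma const_mul_mem {g : ℝ → ℂ} (hg : g ∈ integralModule A L) {c : ℂ} (hc : c ∈ A) :
    (fun u => c * g u) ∈ integralModule A L :=
  Submodule.smul_mem (integralModule A L) (⟨c, hc⟩ : A) hg

lemma inv_natCast_mem (A : Subalgebra ℚ ℂ) (m : ℕ) : ((m : ℂ))⁻¹ ∈ A := by
  have := A.algebraMap_mem ((m : ℚ)⁻¹)
  simpa using this

lemma admissible_of_sublist {K : List ((ℍ → ℂ) × ℕ+)} (hL : ∀ f ∈ L, AxisAdmissible f)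
    (hK : (K.map Prod.fst).Sublist L) : ∀ p ∈ K, AxisAdmissible p.1 := fun _ hp =>
  hL _ (hK.subset (List.mem_map_of_mem hp))

lemma axisMellinIntegrand_one (h : ℝ → ℂ) (u : ℝ) : axisMellinIntegrand h 1 u = I * h u := by
  simp [axisMellinIntegrand]

/-- `monomialPrimitive` at `s = 1` has integral exponents, the same functions and the rational
factor `1 / (1 + t)`, so it stays in the module. Its leading part at `i∞` is divisible by `z`, which
leaves no free constant. -/
lemma exists_primitive_mem (hL : ∀ f ∈ L, AxisAdmissible f) {g : ℝ → ℂ}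
    (hg : g ∈ integralModule A L) : ∃ G ∈ integralModule A L,
      (∀ u > 0, HasDerivAt G (I * g u) u) ∧ HasPowerAsymptotics 1 G := by
  induction hg using Submodule.span_induction with
  | zero => exact ⟨0, zero_mem _, fun u hu => by simp, .zero 1⟩
  | add g h _ _ ihg ihh =>
    obtain ⟨G, hG, hG', hG''⟩ := ihg
    obtain ⟨H, hH, hH', hH''⟩ := ihh
    exact ⟨G + H, add_mem hG hH, fun u hu => ((hG' u hu).add (hH' u hu)).congr_deriv
      (by rw [Pi.add_apply]; ring), hG''.add hH''⟩
  | smul c g _ ih =>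
    obtain ⟨G, hG, hG', hG''⟩ := ih
    exact ⟨fun u => c * G u, const_mul_mem hG c.2, fun u hu =>
      ((hG' u hu).const_mul (c : ℂ)).congr_deriv (by
        rw [Pi.smul_apply, Subalgebra.smul_def, smul_eq_mul]; ring), hG''.const_mul c⟩
  | mem g hg =>
    obtain ⟨t, K, hK, rfl⟩ := hg
    have hKa := admissible_of_sublist hL hK
    refine ⟨monomialPrimitive 1 t K, ?_, fun u hu => ?_,
      hasPowerAsymptotics_monomialPrimitive t hKa⟩
    · have hc : ((1 : ℂ) + t)⁻¹ ∈ A := by simpa [add_comm] using inv_natCast_mem A (t + 1)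
      match K with
      | [] =>
        have := const_mul_mem (monomialIntegral_mem (A := A) (t := t + 1) hK) hc
        convert! this using 2 with u
        rw [monomialPrimitive, monomialIntegral, castExponents_nil, regularizedIntegral_nil]
        push_cast
        rw [mul_one, add_comm (t : ℂ)]
      | (f, β) :: K =>
        have h1 := monomialIntegral_mem (A := A) (t := t + 1) hK
        have h2 := monomialIntegral_mem (A := A) (t := 0)
          (K := (f, (⟨1 + (t + β), by positivity⟩ : ℕ+)) :: K) hK
        convert! const_mul_mem (sub_mem h1 h2) hc using 2 with u
        rw [monomialPrimitive, Pi.sub_apply, monomialIntegral, monomialIntegral, Nat.cast_zero,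
          cpow_zero, one_mul, castExponents_cons ((f, (⟨1 + (t + β), _⟩ : ℕ+)))]
        simp only [PNat.mk_coe, Nat.cast_add, Nat.cast_one, add_comm (t : ℂ) 1]
    · rw [← axisMellinIntegrand_one]
      exact hasDerivAt_monomialPrimitive t (by simp) hKa hu

/-- The part with `f` becomes an iterated integral one step longer, its new first exponent `1 + t`
absorbing `z ^ t`. The part with `a₀` is integrated by `exists_primitive_mem`, and `a₀ ∈ A` keeps
the coefficients in `A`. -/
lemma exists_onAxis_primitive_mem (hL : ∀ f ∈ L, AxisAdmissible f) (hf : AxisAdmissible f)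
    (ha : fourierCoeff f 0 ∈ A) {g : ℝ → ℂ} (hg : g ∈ integralModule A L) :
    ∃ G ∈ integralModule A (f :: L),
      (∀ u > 0, HasDerivAt G (I * ((onAxis f u - fourierCoeff f 0) * g u)) u) ∧
      HasPowerAsymptotics 1 G := by
  obtain ⟨H, hH, hH', hH''⟩ := exists_primitive_mem hL hg
  suffices ∃ G ∈ integralModule A (f :: L),
      (∀ u > 0, HasDerivAt G (I * (onAxis f u * g u)) u) ∧ HasPowerAsymptotics 1 G by
    obtain ⟨G, hG, hG', hG''⟩ := this
    refine ⟨fun u => G u + -fourierCoeff f 0 * H u, add_mem hG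
      (const_mul_mem (integralModule_le_cons hH) (neg_mem ha)), fun u hu => ?_,
      hG''.add (hH''.const_mul _)⟩
    exact ((hG' u hu).add ((hH' u hu).const_mul _)).congr_deriv (by ring)
  clear hH hH' hH''
  induction hg using Submodule.span_induction with
  | zero => exact ⟨0, zero_mem _, fun u hu => by simp, .zero 1⟩
  | add g h _ _ ihg ihh =>
    obtain ⟨G, hG, hG', hG''⟩ := ihg
    obtain ⟨H, hH, hH', hH''⟩ := ihh
    exact ⟨G + H, add_mem hG hH, fun u hu => ((hG' u hu).add (hH' u hu)).congr_deriv
      (by rw [Pi.add_apply]; ring), hG''.add hH''⟩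
  | smul c g _ ih =>
    obtain ⟨G, hG, hG', hG''⟩ := ih
    exact ⟨fun u => c * G u, const_mul_mem hG c.2, fun u hu =>
      ((hG' u hu).const_mul (c : ℂ)).congr_deriv (by
        rw [Pi.smul_apply, Subalgebra.smul_def, smul_eq_mul]; ring), hG''.const_mul c⟩
  | mem g hg =>
    obtain ⟨t, K, hK, rfl⟩ := hg
    have hKa := admissible_of_sublist hL hK
    refine ⟨regularizedIntegral ((f, 1 + t) :: castExponents K), ?_, fun u hu => ?_,
      hasPowerAsymptotics_regularizedIntegral t hf hKa⟩
    · have := monomialIntegral_mem (A := A) (L := f :: L) (t := 0)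
        (K := (f, (⟨1 + t, by positivity⟩ : ℕ+)) :: K) (by simpa using hK)
      convert! this using 1
      funext u
      rw [monomialIntegral, Nat.cast_zero, cpow_zero, one_mul, castExponents_cons]
      simp
    · rw [← axisMellinIntegrand_one fun u => onAxis f u * monomialIntegral t K u]
      exact hasDerivAt_onAxis_mul_primitive t (by simp) hf hKa hu

/-! ### Multiple exponential series -/

variable {n : ℕ}

/-- The sum `m₁ + ⋯ + mₙ`. -/
def totalIndex (m : Fin n → ℕ+) : ℝ := ∑ i, ((m i : ℕ) : ℝ)

/-- The coefficient `∏ a_{m_j} / (m_j + ⋯ + mₙ) ^ α_j`. -/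
def tailCoeff (a : Fin n → ℕ → ℂ) (α : Fin n → ℕ) (m : Fin n → ℕ+) : ℂ :=
  ∏ j, a j (m j) / (∑ i ∈ Finset.Ici j, (m i : ℂ)) ^ α j

/-- The series `∑ ∏ a_{m_j} / (m_j + ⋯ + mₙ) ^ α_j · exp(-2π(m₁ + ⋯ + mₙ)u)`. -/
def multipleExpSeries (a : Fin n → ℕ → ℂ) (α : Fin n → ℕ) (u : ℝ) : ℂ :=
  ∑' m : Fin n → ℕ+, tailCoeff a α m * (Real.exp (-(2 * Real.pi * totalIndex m) * u) : ℂ)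

/-- All the sequences are of polynomial growth. -/
def PolynomiallyBounded (a : Fin n → ℕ → ℂ) : Prop :=
  ∀ j, ∃ (C : ℝ) (K : ℕ), ∀ m : ℕ+, ‖a j m‖ ≤ C * ((m : ℕ) : ℝ) ^ K

lemma totalIndex_nonneg (m : Fin n → ℕ+) : 0 ≤ totalIndex m :=
  Finset.sum_nonneg fun _ _ => Nat.cast_nonneg _

lemma le_totalIndex (m : Fin n → ℕ+) (j : Fin n) : ((m j : ℕ) : ℝ) ≤ totalIndex m :=
  Finset.single_le_sum (f := fun i => ((m i : ℕ) : ℝ)) (fun _ _ => Nat.cast_nonneg _)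
    (Finset.mem_univ j)

lemma one_le_totalIndex (m : Fin (n + 1) → ℕ+) : 1 ≤ totalIndex m :=
  le_trans (by exact_mod_cast (m 0).pos) (le_totalIndex m 0)

lemma summable_prod_pnat {g : Fin n → ℕ+ → ℝ} (h0 : ∀ j m, 0 ≤ g j m)
    (hg : ∀ j, Summable (g j)) : Summable fun m : Fin n → ℕ+ => ∏ j, g j (m j) := by
  induction n with
  | zero => exact Summable.of_finite
  | succ n ih =>
    rw [← (Fin.consEquiv fun _ => ℕ+).summable_iff]
    have := (hg 0).mul_of_nonneg (ih (fun j => h0 j.succ) fun j => hg j.succ) (h0 0)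
      fun m => Finset.prod_nonneg fun j _ => h0 _ _
    refine this.congr fun m => ?_
    simp [Fin.prod_univ_succ, Fin.consEquiv]

lemma norm_tailCoeff_le (a : Fin n → ℕ → ℂ) (α : Fin n → ℕ) (m : Fin n → ℕ+) :
    ‖tailCoeff a α m‖ ≤ ∏ j, ‖a j (m j)‖ := by
  rw [tailCoeff, norm_prod]
  refine Finset.prod_le_prod (fun _ _ => norm_nonneg _) fun j _ => ?_
  rw [norm_div]
  refine div_le_self (norm_nonneg _) ?_
  rw [norm_pow]
  refine one_le_pow₀ ?_
  have h1 : ∑ i ∈ Finset.Ici j, (m i : ℂ) = ((∑ i ∈ Finset.Ici j, (m i : ℕ) : ℕ) : ℂ) := by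
    push_cast; rfl
  rw [h1, norm_natCast, Nat.one_le_cast]
  exact (show 1 ≤ ((m j : ℕ+) : ℕ) from (m j).pos).trans (Finset.single_le_sum (f := fun i => (m i : ℕ))
    (fun _ _ => Nat.zero_le _) (Finset.mem_Ici.2 le_rfl))

/-- As `m_j ≤ m₁ + ⋯ + mₙ`, a power `K j + 2` of the total for each `j` dominates `m_j ^ (K j + 2)`
and leaves a product of convergent series. The exponents `α` only help, so `B` does not depend on
them. -/
lemma exists_summable_tailCoeff_div_pow {a : Fin n → ℕ → ℂ} (ha : PolynomiallyBounded a) :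
    ∃ B : ℕ, ∀ α, Summable fun m => ‖tailCoeff a α m‖ / totalIndex m ^ B := by
  choose C K h using ha
  refine ⟨∑ j, (K j + 2), fun α => ?_⟩
  have hs : Summable fun m : ℕ+ => 1 / ((m : ℕ) : ℝ) ^ 2 :=
    (Real.summable_one_div_nat_pow.2 one_lt_two).comp_injective PNat.coe_injective
  have hC (j) : 0 ≤ C j := by
    have := (norm_nonneg _).trans (h j 1)
    simpa using this
  refine Summable.of_nonneg_of_le (fun m => div_nonneg (norm_nonneg _)
    (pow_nonneg (totalIndex_nonneg m) _)) (fun m => ?_)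
    (summable_prod_pnat (g := fun j m => C j * (1 / ((m : ℕ) : ℝ) ^ 2))
      (fun j m => mul_nonneg (hC j) (by positivity)) fun j => hs.mul_left (C j))
  rw [← Finset.prod_pow_eq_pow_sum]
  calc ‖tailCoeff a α m‖ / ∏ j, totalIndex m ^ (K j + 2)
      ≤ (∏ j, ‖a j (m j)‖) / ∏ j, totalIndex m ^ (K j + 2) := by
        gcongr
        · exact Finset.prod_nonneg fun _ _ => pow_nonneg (totalIndex_nonneg m) _
        · exact norm_tailCoeff_le a α m
    _ = ∏ j, ‖a j (m j)‖ / totalIndex m ^ (K j + 2) := by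
        rw [Finset.prod_div_distrib]
    _ ≤ _ := by
        refine Finset.prod_le_prod (fun j _ => div_nonneg (norm_nonneg _)
          (pow_nonneg (totalIndex_nonneg m) _)) fun j _ => ?_
        have hm : (0 : ℝ) < (m j : ℕ) := Nat.cast_pos.2 (m j).pos
        calc ‖a j (m j)‖ / totalIndex m ^ (K j + 2)
            ≤ C j * ((m j : ℕ) : ℝ) ^ K j / ((m j : ℕ) : ℝ) ^ (K j + 2) := by
              gcongr
              · exact mul_nonneg (hC j) (by positivity)
              · exact h j (m j)
              · exact le_totalIndex m j
          _ = _ := by field_simp; ring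

lemma pow_mul_exp_le (B : ℕ) {x u : ℝ} (hx : 0 ≤ x) (hu : 0 < u) :
    x ^ B * Real.exp (-(2 * Real.pi * x) * u) ≤ B.factorial / (2 * Real.pi) ^ B * u ^ (-B : ℝ) := by
  have h1 : 0 ≤ 2 * Real.pi * x * u := by positivity
  have h2 := Real.pow_div_factorial_le_exp _ h1 B
  rw [div_le_iff₀ (by positivity)] at h2
  rw [neg_mul, Real.exp_neg, Real.rpow_neg hu.le, Real.rpow_natCast, ← div_eq_mul_inv,
    div_le_iff₀ (Real.exp_pos _)]
  calc x ^ B = (2 * Real.pi * x * u) ^ B / ((2 * Real.pi) ^ B * u ^ B) := by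
        rw [← mul_pow, ← div_pow]
        congr 1
        field_simp
    _ ≤ (Real.exp (2 * Real.pi * x * u) * B.factorial) / ((2 * Real.pi) ^ B * u ^ B) := by gcongr
    _ = _ := by field_simp

lemma summable_tailCoeff_div_pow_of_le {a : Fin (n + 1) → ℕ → ℂ} {α : Fin (n + 1) → ℕ} {B : ℕ}
    (h : Summable fun m => ‖tailCoeff a α m‖ / totalIndex m ^ B) {x : ℝ} (hx : B ≤ x) :
    Summable fun m => ‖tailCoeff a α m‖ / totalIndex m ^ x := by
  refine Summable.of_nonneg_of_le (fun m => div_nonneg (norm_nonneg _)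
    (Real.rpow_nonneg (totalIndex_nonneg m) _)) (fun m => ?_) h
  have h1 := one_le_totalIndex m
  rw [← Real.rpow_natCast]
  gcongr

lemma summable_norm_tailCoeff_mul_exp {a : Fin n → ℕ → ℂ} (ha : PolynomiallyBounded a)
    (α : Fin n → ℕ) {u : ℝ} (hu : 0 < u) :
    Summable fun m => ‖tailCoeff a α m‖ * Real.exp (-(2 * Real.pi * totalIndex m) * u) := by
  cases n with
  | zero => exact Summable.of_finite
  | succ n =>
    obtain ⟨B, hB⟩ := exists_summable_tailCoeff_div_pow ha
    refine Summable.of_nonneg_of_le (fun m => by positivity) (fun m => ?_)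
      ((hB α).mul_right (B.factorial / (2 * Real.pi) ^ B * u ^ (-B : ℝ)))
    have h1 : 0 < totalIndex m := one_pos.trans_le (one_le_totalIndex m)
    calc _ = ‖tailCoeff a α m‖ / totalIndex m ^ B *
          (totalIndex m ^ B * Real.exp (-(2 * Real.pi * totalIndex m) * u)) := by field_simp
      _ ≤ _ := by
        refine mul_le_mul_of_nonneg_left (pow_mul_exp_le B h1.le hu)
          (div_nonneg (norm_nonneg _) (pow_nonneg h1.le _))

lemma norm_tailCoeff_mul_exp (a : Fin n → ℕ → ℂ) (α : Fin n → ℕ) (u : ℝ) (m : Fin n → ℕ+) :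
    ‖tailCoeff a α m * (Real.exp (-(2 * Real.pi * totalIndex m) * u) : ℂ)‖ =
      ‖tailCoeff a α m‖ * Real.exp (-(2 * Real.pi * totalIndex m) * u) := by
  rw [norm_mul, norm_real, Real.norm_of_nonneg (Real.exp_nonneg _)]

lemma summable_tailCoeff_mul_exp {a : Fin n → ℕ → ℂ} (ha : PolynomiallyBounded a)
    (α : Fin n → ℕ) {u : ℝ} (hu : 0 < u) : Summable fun m =>
      tailCoeff a α m * (Real.exp (-(2 * Real.pi * totalIndex m) * u) : ℂ) :=
  .of_norm ((summable_norm_tailCoeff_mul_exp ha α hu).congr fun m =>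
    (norm_tailCoeff_mul_exp a α u m).symm)

/-- The freedom in `B` covers both ends: `B₀` controls growth at `0`, and large `B` gives decay at
infinity. -/
lemma exists_norm_multipleExpSeries_le {a : Fin (n + 1) → ℕ → ℂ} (ha : PolynomiallyBounded a) :
    ∃ B₀ : ℕ, ∀ α, (Summable fun m => ‖tailCoeff a α m‖ / totalIndex m ^ B₀) ∧
      ∀ B ≥ B₀, ∃ C, ∀ u > 0, ‖multipleExpSeries a α u‖ ≤ C * u ^ (-B : ℝ) := by
  obtain ⟨B₀, hB₀⟩ := exists_summable_tailCoeff_div_pow ha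
  refine ⟨B₀, fun α => ⟨hB₀ α, fun B hB => ?_⟩⟩
  have hs := summable_tailCoeff_div_pow_of_le (hB₀ α) (x := B) (by exact_mod_cast hB)
  simp only [Real.rpow_natCast] at hs
  refine ⟨(∑' m, ‖tailCoeff a α m‖ / totalIndex m ^ B) * (B.factorial / (2 * Real.pi) ^ B),
    fun u hu => ?_⟩
  have h1 := summable_norm_tailCoeff_mul_exp ha α hu
  calc _ ≤ ∑' m, ‖tailCoeff a α m‖ * Real.exp (-(2 * Real.pi * totalIndex m) * u) := by
        refine (norm_tsum_le_tsum_norm (h1.congr fun m =>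
          (norm_tailCoeff_mul_exp a α u m).symm)).trans (le_of_eq ?_)
        simp only [norm_tailCoeff_mul_exp]
    _ ≤ ∑' m, ‖tailCoeff a α m‖ / totalIndex m ^ B *
          (B.factorial / (2 * Real.pi) ^ B * u ^ (-B : ℝ)) := by
        refine h1.tsum_le_tsum (fun m => ?_) (hs.mul_right _)
        have h1 : 0 < totalIndex m := one_pos.trans_le (one_le_totalIndex m)
        calc _ = ‖tailCoeff a α m‖ / totalIndex m ^ B *
              (totalIndex m ^ B * Real.exp (-(2 * Real.pi * totalIndex m) * u)) := by field_simp
          _ ≤ _ := by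
            refine mul_le_mul_of_nonneg_left (pow_mul_exp_le B h1.le hu)
              (div_nonneg (norm_nonneg _) (pow_nonneg h1.le _))
    _ = _ := by rw [tsum_mul_right]; ring

lemma continuousOn_multipleExpSeries {a : Fin n → ℕ → ℂ} (ha : PolynomiallyBounded a)
    (α : Fin n → ℕ) : ContinuousOn (multipleExpSeries a α) (Set.Ioi 0) := by
  intro u (hu : 0 < u)
  have h1 : ContinuousOn (multipleExpSeries a α) (Set.Ioi (u / 2)) := by
    refine continuousOn_tsum (fun m => by fun_prop)
      (summable_norm_tailCoeff_mul_exp ha α (half_pos hu)) fun m v hv => ?_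
    rw [norm_tailCoeff_mul_exp]
    have h2 := totalIndex_nonneg m
    have h3 : 0 ≤ 2 * Real.pi * totalIndex m := by positivity
    gcongr ‖tailCoeff a α m‖ * Real.exp ?_
    have h4 := mul_le_mul_of_nonneg_left (le_of_lt hv) h3
    linarith
  exact (h1.continuousAt (Ioi_mem_nhds (half_lt_self hu))).continuousWithinAt

lemma sum_Ici_zero_eq (m : Fin (n + 1) → ℕ+) :
    ∑ i ∈ Finset.Ici (0 : Fin (n + 1)), (m i : ℂ) = totalIndex m := by
  have : Finset.Ici (0 : Fin (n + 1)) = Finset.univ := by ext; simp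
  rw [this, totalIndex]
  push_cast
  rfl

lemma sum_Ici_succ_eq (m : Fin (n + 1) → ℕ+) (j : Fin n) :
    ∑ i ∈ Finset.Ici j.succ, (m i : ℂ) = ∑ i ∈ Finset.Ici j, (m i.succ : ℂ) := by
  rw [← Fin.map_succEmb_Ici, Finset.sum_map]
  rfl

lemma tailCoeff_cons_eq (a : Fin (n + 1) → ℕ → ℂ) (e : ℕ) (β : Fin n → ℕ)
    (m : Fin (n + 1) → ℕ+) : tailCoeff a (Fin.cons e β) m =
      a 0 (m 0) / (totalIndex m : ℂ) ^ e * tailCoeff (fun j => a j.succ) β fun j => m j.succ := by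
  rw [tailCoeff, Fin.prod_univ_succ, sum_Ici_zero_eq]
  simp [tailCoeff, sum_Ici_succ_eq]

/-- Differentiating the exponential brings down `-2π(m₁ + ⋯ + mₙ)`, which cancels one power in the
first denominator. -/
lemma hasDerivAt_multipleExpSeries {a : Fin (n + 1) → ℕ → ℂ} (ha : PolynomiallyBounded a)
    (e : ℕ) (β : Fin n → ℕ) {u : ℝ} (hu : 0 < u) :
    HasDerivAt (multipleExpSeries a (Fin.cons (e + 1) β))
      (-(2 * Real.pi) * multipleExpSeries a (Fin.cons e β) u) u := by
  have hmem : u ∈ Set.Ioi (u / 2) := half_lt_self hu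
  have h1 := hasDerivAt_tsum_of_isPreconnected (𝕜 := ℝ) (t := Set.Ioi (u / 2))
    (g := fun m u => tailCoeff a (Fin.cons (e + 1) β) m *
      (Real.exp (-(2 * Real.pi * totalIndex m) * u) : ℂ))
    (g' := fun m u => -(2 * Real.pi) * (tailCoeff a (Fin.cons e β) m *
      (Real.exp (-(2 * Real.pi * totalIndex m) * u) : ℂ)))
    (y₀ := u) (y := u)
    ((summable_norm_tailCoeff_mul_exp ha (Fin.cons e β) (half_pos hu)).mul_left
      ‖(-(2 * Real.pi) : ℂ)‖) isOpen_Ioi isPreconnected_Ioi ?_ ?_ hmem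
    (summable_tailCoeff_mul_exp ha _ hu) hmem
  · refine h1.congr_deriv ?_
    rw [tsum_mul_left, multipleExpSeries]
  · intro m v _
    have h2 : HasDerivAt (fun v : ℝ => Real.exp (-(2 * Real.pi * totalIndex m) * v))
        (Real.exp (-(2 * Real.pi * totalIndex m) * v) * -(2 * Real.pi * totalIndex m)) v := by
      simpa using ((hasDerivAt_id v).const_mul (-(2 * Real.pi * totalIndex m))).exp
    refine (h2.ofReal_comp.const_mul _).congr_deriv ?_
    have h3 : (totalIndex m : ℂ) ≠ 0 :=
      ofReal_ne_zero.2 (one_pos.trans_le (one_le_totalIndex m)).ne'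
    rw [tailCoeff_cons_eq, tailCoeff_cons_eq]
    push_cast
    field_simp
    ring
  · intro m v hv
    rw [norm_mul, norm_tailCoeff_mul_exp]
    have h2 := totalIndex_nonneg m
    have h3 : 0 ≤ 2 * Real.pi * totalIndex m := by positivity
    gcongr _ * (‖tailCoeff a _ m‖ * Real.exp ?_)
    have h4 := mul_le_mul_of_nonneg_left (le_of_lt hv) h3
    linarith

lemma totalIndex_cons (m₀ : ℕ+) (m : Fin n → ℕ+) :
    totalIndex (Fin.cons m₀ m : Fin (n + 1) → ℕ+) = (m₀ : ℕ) + totalIndex m := by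
  simp [totalIndex, Fin.sum_univ_succ]

lemma multipleExpSeries_cons_zero {a : Fin (n + 1) → ℕ → ℂ} (ha : PolynomiallyBounded a)
    (β : Fin n → ℕ) {u : ℝ} (hu : 0 < u) {c : ℂ}
    (hc : HasSum (fun m : ℕ+ => a 0 m * (Real.exp (-(2 * Real.pi * m * u)) : ℂ)) c)
    (hc' : Summable fun m : ℕ+ => ‖a 0 m * (Real.exp (-(2 * Real.pi * m * u)) : ℂ)‖) :
    multipleExpSeries a (Fin.cons 0 β) u = c * multipleExpSeries (fun j => a j.succ) β u := by
  have ha' : PolynomiallyBounded fun j : Fin n => a j.succ := fun j => ha j.succ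
  rw [multipleExpSeries, multipleExpSeries, ← hc.tsum_eq, tsum_mul_tsum_of_summable_norm hc'
    ((summable_norm_tailCoeff_mul_exp ha' β hu).congr fun m =>
      (norm_tailCoeff_mul_exp _ β u m).symm), ← (Fin.consEquiv fun _ => ℕ+).tsum_eq]
  refine tsum_congr fun m => ?_
  have h1 : (Fin.consEquiv fun _ : Fin (n + 1) => ℕ+) m = Fin.cons m.1 m.2 := rfl
  rw [h1, tailCoeff_cons_eq, totalIndex_cons, pow_zero, div_one, Fin.cons_zero,
    show -(2 * Real.pi * ((m.1 : ℕ) + totalIndex m.2)) * u =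
      -(2 * Real.pi * (m.1 : ℕ) * u) + -(2 * Real.pi * totalIndex m.2) * u by ring,
    Real.exp_add, ofReal_mul]
  simp only [Fin.cons_succ]
  ring

/-! ### Multiple exponential series as iterated integrals -/

/-- The two primitives differ by a constant, which is the limit of `G` at infinity; the asymptotics
of `G` force it to be `0`. -/
lemma HasPowerAsymptotics.eqOn_of_tendsto_zero {s : ℂ} (hs : 0 < s.re) {P G φ : ℝ → ℂ}
    (hP : ∀ u > 0, HasDerivAt P (φ u) u) (hG : ∀ u > 0, HasDerivAt G (φ u) u)
    (hG' : HasPowerAsymptotics s G) (hP' : Tendsto P atTop (𝓝 0)) : Set.EqOn P G (Set.Ioi 0) := by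
  have h1 : Set.EqOn G (fun u => P u + (G 1 - P 1)) (Set.Ioi 0) := by
    refine isOpen_Ioi.eqOn_of_deriv_eq isPreconnected_Ioi (x := 1)
      (fun u hu => (hG u hu).differentiableAt.differentiableWithinAt)
      (fun u hu => ((hP u hu).add_const _).differentiableAt.differentiableWithinAt)
      (fun u hu => ?_) (Set.mem_Ioi.2 one_pos) (by ring)
    rw [(hG u hu).deriv, ((hP u hu).add_const _).deriv]
  have h2 : Tendsto G atTop (𝓝 (0 + (G 1 - P 1))) :=
    (hP'.add_const _).congr' ((eventually_gt_atTop 0).mono fun u hu => (h1 hu).symm)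
  have h3 := hG'.eq_zero_of_tendsto hs h2
  rw [zero_add] at h3
  intro u hu
  have := h1 hu
  simp only [h3, add_zero] at this
  exact this.symm

/-- An axis-admissible function that is the sum of its Fourier series, with coefficients of
polynomial growth. -/
structure AxisExpandable (f : ℍ → ℂ) : Prop where
  admissible : AxisAdmissible f
  hasSum : ∀ u > 0, HasSum
    (fun m : ℕ => fourierCoeff f m * (Real.exp (-(2 * Real.pi * m * u)) : ℂ)) (onAxis f u)
  bound : ∃ (C : ℝ) (K : ℕ), ∀ m : ℕ+, ‖fourierCoeff f m‖ ≤ C * ((m : ℕ) : ℝ) ^ K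

lemma axisExpandable_of_modularForm {N : ℕ} (hN : 0 < N) {k : ℤ}
    (f : ModularForm (CongruenceSubgroup.Gamma1 N : Subgroup (GL (Fin 2) ℝ)) k) :
    AxisExpandable f := by
  have : NeZero N := ⟨hN.ne'⟩
  have h1 : (1 : ℝ) ∈ (CongruenceSubgroup.Gamma1 N : Subgroup (GL (Fin 2) ℝ)).strictPeriods := by
    simp
  refine ⟨axisAdmissible_of_modularForm f h1,
    fun u hu => hasSum_fourierCoeff_onAxis f h1 hu, ?_⟩
  obtain ⟨K, hK⟩ := fourierCoeff_isBigO (by simp) f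
  obtain ⟨C, hC, h⟩ := Asymptotics.bound_of_isBigO_nat_atTop hK
  refine ⟨C, K, fun m => ?_⟩
  have := h (x := (m : ℕ)) (by positivity)
  rwa [Real.norm_of_nonneg (by positivity)] at this

lemma AxisExpandable.hasSum_pnat {f : ℍ → ℂ} (hf : AxisExpandable f) {u : ℝ} (hu : 0 < u) :
    HasSum (fun m : ℕ+ => fourierCoeff f m * (Real.exp (-(2 * Real.pi * m * u)) : ℂ))
      (onAxis f u - fourierCoeff f 0) := by
  rw [← Equiv.pnatEquivNat.symm.hasSum_iff]
  have h := (hasSum_nat_add_iff' 1).2 (hf.hasSum u hu)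
  simpa [Function.comp_def] using h

lemma polynomiallyBounded_fourierCoeff {F : Fin n → ℍ → ℂ} (hF : ∀ j, AxisExpandable (F j)) :
    PolynomiallyBounded fun j => fourierCoeff (F j) := fun j => (hF j).bound

lemma multipleExpSeries_fourierCoeff_cons_zero {F : Fin (n + 1) → ℍ → ℂ}
    (hF : ∀ j, AxisExpandable (F j)) (β : Fin n → ℕ) {u : ℝ} (hu : 0 < u) :
    multipleExpSeries (fun j => fourierCoeff (F j)) (Fin.cons 0 β) u =
      (onAxis (F 0) u - fourierCoeff (F 0) 0) *
        multipleExpSeries (fun j => fourierCoeff (F j.succ)) β u :=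
  multipleExpSeries_cons_zero (polynomiallyBounded_fourierCoeff hF) β hu
    ((hF 0).hasSum_pnat hu) ((hF 0).hasSum_pnat hu).summable.norm

lemma tendsto_multipleExpSeries_atTop {a : Fin (n + 1) → ℕ → ℂ} (ha : PolynomiallyBounded a)
    (α : Fin (n + 1) → ℕ) : Tendsto (multipleExpSeries a α) atTop (𝓝 0) := by
  obtain ⟨B₀, h⟩ := exists_norm_multipleExpSeries_le ha
  obtain ⟨C, hC⟩ := (h α).2 (B₀ + 1) (by simp)
  have h1 : Tendsto (fun u : ℝ => C * u ^ (-((B₀ + 1 : ℕ) : ℝ))) atTop (𝓝 0) := by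
    simpa using (tendsto_rpow_neg_atTop (y := ((B₀ + 1 : ℕ) : ℝ)) (by positivity)).const_mul C
  exact squeeze_zero_norm' ((eventually_gt_atTop 0).mono fun u hu => hC u hu) h1

/-- Double induction, on the number of functions and on the leading exponent `e`. The step to
exponent `1` integrates `(f - a₀)` times the shorter series, and each later step is a plain
integration. -/
lemma exists_multipleExpSeries_eq (A : Subalgebra ℚ ℂ) {F : Fin n → ℍ → ℂ}
    (hF : ∀ j, AxisExpandable (F j)) (hA : ∀ j, fourierCoeff (F j) 0 ∈ A) (β : Fin n → ℕ+) :
    ∃ g ∈ integralModule A (List.ofFn F), ∀ u > 0,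
      multipleExpSeries (fun j => fourierCoeff (F j)) (fun j => β j) u =
        (2 * Real.pi * I) ^ (∑ j, (β j : ℕ)) * g u := by
  induction n with
  | zero =>
    refine ⟨monomialIntegral 0 [], monomialIntegral_mem (by simp), fun u hu => ?_⟩
    simp [multipleExpSeries, tailCoeff, totalIndex, monomialIntegral, regularizedIntegral_nil]
  | succ n ih =>
    have ha := polynomiallyBounded_fourierCoeff hF
    obtain ⟨g, hg, hgD⟩ := ih (fun j => hF j.succ) (fun j => hA j.succ) fun j => β j.succ
    have hL : ∀ f ∈ List.ofFn F, AxisAdmissible f := List.forall_mem_ofFn_iff.2 fun j => (hF j).admissible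
    have hL' : ∀ f ∈ List.ofFn (fun j : Fin n => F j.succ), AxisAdmissible f :=
      List.forall_mem_ofFn_iff.2 fun j => (hF j.succ).admissible
    have key (e : ℕ) : ∃ g ∈ integralModule A (List.ofFn F), ∀ u > 0,
        multipleExpSeries (fun j => fourierCoeff (F j))
          (Fin.cons (e + 1) fun j => (β j.succ : ℕ)) u =
        (2 * Real.pi * I) ^ (e + 1 + ∑ j : Fin n, (β j.succ : ℕ)) * g u := by
      induction e with
      | zero =>
        obtain ⟨G, hG, hG', hG''⟩ := exists_onAxis_primitive_mem hL' (hF 0).admissible (hA 0) hg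
        refine ⟨G, by rwa [List.ofFn_succ], ?_⟩
        refine HasPowerAsymptotics.eqOn_of_tendsto_zero (s := 1) (by simp)
          (fun u hu => hasDerivAt_multipleExpSeries ha 0 _ hu)
          (fun u hu => ((hG' u hu).const_mul _).congr_deriv ?_) (hG''.const_mul _)
          (tendsto_multipleExpSeries_atTop ha _)
        rw [multipleExpSeries_fourierCoeff_cons_zero hF _ hu, hgD u hu, zero_add, pow_add, pow_one]
        -- The derivative supplies `-2π` and the primitive in `z = iu` supplies `I`; they match
        -- because `-2π = (2πi) · I`, whence one factor `2πi` per integration.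
        linear_combination (2 * Real.pi * (2 * Real.pi * I) ^ (∑ j : Fin n, (β j.succ : ℕ)) *
          (onAxis (F 0) u - fourierCoeff (F 0) 0) * g u) * I_sq
      | succ e ihe =>
        obtain ⟨g, hg, hgD⟩ := ihe
        obtain ⟨G, hG, hG', hG''⟩ := exists_primitive_mem hL hg
        refine ⟨G, hG, ?_⟩
        refine HasPowerAsymptotics.eqOn_of_tendsto_zero (s := 1) (by simp)
          (fun u hu => hasDerivAt_multipleExpSeries ha (e + 1) _ hu)
          (fun u hu => ((hG' u hu).const_mul _).congr_deriv ?_) (hG''.const_mul _)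
          (tendsto_multipleExpSeries_atTop ha _)
        rw [hgD u hu, add_right_comm (e + 1) 1, pow_succ]
        linear_combination (2 * Real.pi * (2 * Real.pi * I) ^ (e + 1 +
          ∑ j : Fin n, (β j.succ : ℕ)) * g u) * I_sq
    obtain ⟨g, hg, h⟩ := key (β 0 - 1)
    refine ⟨g, hg, fun u hu => ?_⟩
    have h0 : (β 0 : ℕ) - 1 + 1 = β 0 := Nat.sub_add_cancel (β 0).pos
    rw [h0] at h
    rw [Fin.sum_univ_succ, ← h u hu]
    congr 1
    funext j
    refine Fin.cases ?_ (fun j => ?_) j <;> simp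

/-! ### Terms of linear combinations -/

variable {N : ℕ} {F : Fin (n + 1) → ℍ → ℂ}

lemma exists_index_of_sublist {g : ℍ → ℂ} {β₀ : ℕ+} {K : List ((ℍ → ℂ) × ℕ+)}
    (h : (((g, β₀) :: K).map Prod.fst).Sublist (List.ofFn F)) :
    ∃ ι : Fin (K.length + 1) ↪o Fin (n + 1), F (ι 0) = g ∧ ∀ j, F (ι j.succ) = (K.get j).1 := by
  obtain ⟨e, he⟩ := List.sublist_iff_exists_fin_orderEmbedding_get_eq.1 h
  have h1 : K.length + 1 = (((g, β₀) :: K).map Prod.fst).length := by simp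
  have h2 : (List.ofFn F).length = n + 1 := by simp
  refine ⟨((Fin.castOrderIso h1).toOrderEmbedding.trans e).trans
    (Fin.castOrderIso h2).toOrderEmbedding, ?_, fun j => ?_⟩
  · have := he (Fin.cast h1 0)
    simp only [List.get_eq_getElem, List.getElem_ofFn] at this
    exact this.symm
  · have := he (Fin.cast h1 j.succ)
    simp only [List.get_eq_getElem, List.getElem_ofFn] at this
    exact this.symm.trans (by simp)

namespace IntegralTerm

/-- The exponents `β` with their functions. -/
def tailList (T : IntegralTerm n) (F : Fin (n + 1) → ℍ → ℂ) : List ((ℍ → ℂ) × ℕ+) :=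
  List.ofFn fun j => (F (T.index j.succ), T.β j)

lemma integral_eq (T : IntegralTerm n) (N : ℕ) (F : Fin (n + 1) → ℍ → ℂ) (s : ℂ) :
    T.integral N F s =
      listIteratedIntegral N ((F (T.index 0), s + T.shift) :: castExponents (T.tailList F)) := by
  rw [integral, modularIteratedIntegral_eq, List.ofFn_succ]
  simp [exponents, castExponents, tailList, List.map_ofFn, Function.comp_def]

lemma tailList_mem (T : IntegralTerm n) (hF : ∀ j, AxisAdmissible (F j)) :
    ∀ p ∈ castExponents (T.tailList F), AxisAdmissible p.1 :=
  castExponents_mem (List.forall_mem_ofFn_iff.2 fun _ => hF _)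

lemma meromorphicOn_integral (T : IntegralTerm n) (hN : 0 < N) (hF : ∀ j, AxisAdmissible (F j)) :
    MeromorphicOn (T.integral N F) Set.univ := by
  intro s _
  have h1 := (listIteratedIntegral_properties hN (hF (T.index 0)) (T.tailList_mem hF)
    (suffixSumsNeZero_castExponents _)).1 (s + T.shift) trivial
  have h2 : AnalyticAt ℂ (fun s : ℂ => s + T.shift) s := by fun_prop
  rw [funext (T.integral_eq N F)]
  exact MeromorphicAt.comp_analyticAt (f := fun z => listIteratedIntegral N
    ((F (T.index 0), z) :: castExponents (T.tailList F))) h1 h2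

lemma exists_analyticAt_integral (T : IntegralTerm n) (hN : 0 < N)
    (hF : ∀ j, AxisAdmissible (F j)) :
    ∃ σ : ℝ, ∀ s : ℂ, σ < s.re → AnalyticAt ℂ (T.integral N F) s := by
  obtain ⟨σ, hσ⟩ := (listIteratedIntegral_properties hN (hF (T.index 0)) (T.tailList_mem hF)
    (suffixSumsNeZero_castExponents _)).2
  refine ⟨σ, fun s hs => ?_⟩
  have h2 : AnalyticAt ℂ (fun s : ℂ => s + T.shift) s := by fun_prop
  rw [funext (T.integral_eq N F)]
  exact AnalyticAt.fun_comp (g := fun z => listIteratedIntegral N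
    ((F (T.index 0), z) :: castExponents (T.tailList F))) (hσ (s + T.shift) (by
      rw [add_re, natCast_re]; linarith [T.shift.cast_nonneg (α := ℝ)])).1 h2

/-- Multiply the coefficient of a term by a constant. -/
def scale (c : ℂ) (T : IntegralTerm n) : IntegralTerm n := { T with num := .C c * T.num }

lemma scale_coeff_mul_integral (c : ℂ) (T : IntegralTerm n) (N : ℕ) (F : Fin (n + 1) → ℍ → ℂ)
    (s : ℂ) : (T.scale c).coeff s * (T.scale c).integral N F s =
      c * (T.coeff s * T.integral N F s) := by
  have : (T.scale c).integral N F s = T.integral N F s := rfl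
  rw [this, coeff, coeff, scale, Polynomial.eval_mul, Polynomial.eval_C]
  ring

lemma exists_of_sublist (N : ℕ) {g : ℍ → ℂ} {β₀ : ℕ+} {K : List ((ℍ → ℂ) × ℕ+)}
    (h : (((g, β₀) :: K).map Prod.fst).Sublist (List.ofFn F)) (t : ℕ) (P : Polynomial ℂ)
    {D : Polynomial ℚ} (hD : D ≠ 0) :
    ∃ T : IntegralTerm n, T.num = P ∧ T.den = D ∧
      ∀ s, T.integral N F s = listIteratedIntegral N ((g, s + t) :: castExponents K) := by
  obtain ⟨ι, h0, h1⟩ := exists_index_of_sublist h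
  refine ⟨⟨K.length, ι, t, fun j => (K.get j).2, P, D, hD⟩, rfl, rfl, fun s => ?_⟩
  rw [integral_eq]
  simp only [tailList, h0, h1]
  congr 3
  exact List.ofFn_get K

/-- The value of the linear combination given by a list of terms. -/
def listSum (Ts : List (IntegralTerm n)) (N : ℕ) (F : Fin (n + 1) → ℍ → ℂ) (s : ℂ) : ℂ :=
  (Ts.map fun T => T.coeff s * T.integral N F s).sum

lemma listSum_append (Ts Us : List (IntegralTerm n)) (N : ℕ) (F : Fin (n + 1) → ℍ → ℂ) (s : ℂ) :
    listSum (Ts ++ Us) N F s = listSum Ts N F s + listSum Us N F s := by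
  simp [listSum]

lemma listSum_map_scale (c : ℂ) (Ts : List (IntegralTerm n)) (N : ℕ) (F : Fin (n + 1) → ℍ → ℂ)
    (s : ℂ) : listSum (Ts.map (scale c)) N F s = c * listSum Ts N F s := by
  simp only [listSum, List.map_map, Function.comp_def, scale_coeff_mul_integral,
    List.sum_map_mul_left]

/-- The numerators have coefficients in `A`, and the denominators have no zeros for `0 < Re s`. -/
def Over (A : Subalgebra ℚ ℂ) (T : IntegralTerm n) : Prop :=
  (∀ d, T.num.coeff d ∈ A) ∧ ∀ s : ℂ, 0 < s.re → Polynomial.aeval s T.den ≠ 0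

lemma Over.scale {A : Subalgebra ℚ ℂ} {T : IntegralTerm n} (hT : T.Over A) {c : ℂ} (hc : c ∈ A) :
    (T.scale c).Over A :=
  ⟨fun d => by
    rw [IntegralTerm.scale, Polynomial.coeff_C_mul]
    exact mul_mem hc (hT.1 d), hT.2⟩

lemma exists_linear_of_sublist (N : ℕ) {A : Subalgebra ℚ ℂ} {g : ℍ → ℂ} {β₀ : ℕ+}
    {K : List ((ℍ → ℂ) × ℕ+)} (h : (((g, β₀) :: K).map Prod.fst).Sublist (List.ofFn F)) (t r : ℕ)
    {c : ℂ} (hc : c ∈ A) : ∃ T : IntegralTerm n, T.Over A ∧ ∀ s, T.coeff s * T.integral N F s =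
      c * (s + r)⁻¹ * listIteratedIntegral N ((g, s + t) :: castExponents K) := by
  obtain ⟨T, hnum, hden, h1⟩ := exists_of_sublist N h t (.C c)
    (D := .X + .C (r : ℚ)) (Polynomial.X_add_C_ne_zero _)
  have h2 (s : ℂ) : Polynomial.aeval s T.den = s + r := by simp [hden]
  refine ⟨T, ⟨fun d => ?_, fun s hs => ?_⟩, fun s => ?_⟩
  · rw [hnum, Polynomial.coeff_C]
    split_ifs
    exacts [hc, zero_mem _]
  · rw [h2]
    exact add_natCast_ne_zero r hs
  · rw [h1, coeff, h2, hnum, Polynomial.eval_C, div_eq_mul_inv]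

lemma exists_const_of_sublist (N : ℕ) (A : Subalgebra ℚ ℂ) {g : ℍ → ℂ} {β₀ : ℕ+}
    {K : List ((ℍ → ℂ) × ℕ+)} (h : (((g, β₀) :: K).map Prod.fst).Sublist (List.ofFn F)) (t : ℕ) :
    ∃ T : IntegralTerm n, T.Over A ∧ ∀ s, T.coeff s * T.integral N F s =
      listIteratedIntegral N ((g, s + t) :: castExponents K) := by
  obtain ⟨T, hnum, hden, h1⟩ := exists_of_sublist N h t 1 (D := 1) one_ne_zero
  refine ⟨T, ⟨fun d => ?_, fun s hs => ?_⟩, fun s => ?_⟩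
  · rw [hnum, Polynomial.coeff_one]
    split_ifs
    exacts [one_mem _, zero_mem _]
  · simp [hden]
  · simp [h1, coeff, hden, hnum]

end IntegralTerm

/-! ### Terms as limits of primitives at `0`. -/

lemma exists_tendsto_regularizedIntegral (hN : 0 < N) (t : ℕ) {f : ℍ → ℂ}
    {K : List ((ℍ → ℂ) × ℕ+)} (hf : AxisAdmissible f) (hK : ∀ p ∈ K, AxisAdmissible p.1) :
    ∃ σ : ℝ, ∀ s : ℂ, σ < s.re → Tendsto (regularizedIntegral ((f, s + t) :: castExponents K))
      (𝓝[>] 0) (𝓝 (listIteratedIntegral N ((f, s + t) :: castExponents K))) := by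
  obtain ⟨σ, hσ⟩ := (listIteratedIntegral_properties hN hf (castExponents_mem hK)
    (suffixSumsNeZero_castExponents _)).2
  refine ⟨σ, fun s hs => (hσ (s + t) ?_).2⟩
  rw [add_re, natCast_re]
  linarith [t.cast_nonneg (α := ℝ)]

/-- At `0` the boundary term of the partial integration disappears. What remains is `-(s + t)⁻¹`
times one iterated integral, or nothing if `K` is empty. -/
lemma exists_terms_monomialPrimitive (hN : 0 < N) (A : Subalgebra ℚ ℂ)
    (hF : ∀ j, AxisAdmissible (F j)) (t : ℕ) {K : List ((ℍ → ℂ) × ℕ+)}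
    (hK : (K.map Prod.fst).Sublist (List.ofFn F)) :
    ∃ Ts : List (IntegralTerm n), (∀ T ∈ Ts, T.Over A) ∧ ∃ σ : ℝ, ∀ s : ℂ, σ < s.re →
      Tendsto (monomialPrimitive s t K) (𝓝[>] 0) (𝓝 (IntegralTerm.listSum Ts N F s)) := by
  have hKa := admissible_of_sublist (List.forall_mem_ofFn_iff.2 hF) hK
  obtain ⟨σ, hσ⟩ := exists_tendsto_cpow_mul_regularizedIntegral t hKa
  match K with
  | [] =>
    refine ⟨[], by simp, σ, fun s hs => ?_⟩
    have := (hσ s hs).const_mul ((s + t)⁻¹)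
    rw [mul_zero] at this
    refine this.congr fun u => ?_
    rw [castExponents_nil, regularizedIntegral_nil, mul_one, monomialPrimitive]
  | (g, β) :: K =>
    obtain ⟨T, hT, hTe⟩ := IntegralTerm.exists_linear_of_sublist N hK (t + β) t
      (neg_mem (one_mem A))
    obtain ⟨σ', hσ'⟩ := exists_tendsto_regularizedIntegral hN (t + β)
      (hKa _ List.mem_cons_self) fun q hq => hKa q (List.mem_cons_of_mem _ hq)
    refine ⟨[T], by simpa using hT, max σ σ', fun s hs => ?_⟩
    have := ((hσ s ((le_max_left _ _).trans_lt hs)).sub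
      (hσ' s ((le_max_right _ _).trans_lt hs))).const_mul ((s + t)⁻¹)
    convert! this using 2
    simp only [IntegralTerm.listSum, List.map_cons, List.map_nil, List.sum_cons, List.sum_nil, hTe]
    ring

/-- The order of quantifiers matters: the terms are chosen before `s`, while the primitive `G`
varies with it. On a generator, `f₁` is prefixed to the list, and `-a₀` multiplies the primitive
from partial integration. -/
lemma exists_terms_of_mem (hN : 0 < N) {A : Subalgebra ℚ ℂ} (hF : ∀ j, AxisAdmissible (F j))
    (hA : fourierCoeff (F 0) 0 ∈ A) {g : ℝ → ℂ}
    (hg : g ∈ integralModule A (List.ofFn fun j : Fin n => F j.succ)) :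
    ∃ Ts : List (IntegralTerm n), (∀ T ∈ Ts, T.Over A) ∧ ∃ σ : ℝ, ∀ s : ℂ, σ < s.re →
      ∃ G : ℝ → ℂ, (∀ u > 0, HasDerivAt G
        (axisMellinIntegrand (fun u => (onAxis (F 0) u - fourierCoeff (F 0) 0) * g u) s u) u) ∧
        HasPowerAsymptotics s G ∧
        Tendsto G (𝓝[>] 0) (𝓝 (IntegralTerm.listSum Ts N F s)) := by
  induction hg using Submodule.span_induction with
  | zero =>
    exact ⟨[], by simp, 0, fun s hs => ⟨fun _ => 0, fun u hu => by
      simpa [axisMellinIntegrand] using hasDerivAt_const u (0 : ℂ), .zero s, by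
      simp [IntegralTerm.listSum]⟩⟩
  | add g h _ _ ihg ihh =>
    obtain ⟨Ts, hTs, σ, H⟩ := ihg
    obtain ⟨Us, hUs, τ, H'⟩ := ihh
    refine ⟨Ts ++ Us, fun T hT => (List.mem_append.1 hT).elim (hTs T) (hUs T), max σ τ,
      fun s hs => ?_⟩
    obtain ⟨G₁, h1, h2, h3⟩ := H s ((le_max_left _ _).trans_lt hs)
    obtain ⟨G₂, h1', h2', h3'⟩ := H' s ((le_max_right _ _).trans_lt hs)
    refine ⟨fun u => G₁ u + G₂ u, fun u hu => ((h1 u hu).add (h1' u hu)).congr_deriv ?_,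
      h2.add h2', ?_⟩
    · simp only [axisMellinIntegrand, Pi.add_apply]
      ring
    · rw [IntegralTerm.listSum_append]
      exact h3.add h3'
  | smul c g _ ih =>
    obtain ⟨Ts, hTs, σ, H⟩ := ih
    refine ⟨Ts.map (IntegralTerm.scale c), ?_, σ, fun s hs => ?_⟩
    · simp only [List.forall_mem_map]
      exact fun T hT => (hTs T hT).scale c.2
    obtain ⟨G, h1, h2, h3⟩ := H s hs
    refine ⟨fun u => c * G u, fun u hu => ((h1 u hu).const_mul (c : ℂ)).congr_deriv ?_,
      h2.const_mul c, ?_⟩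
    · simp only [axisMellinIntegrand, Pi.smul_apply, Subalgebra.smul_def, smul_eq_mul]
      ring
    · rw [IntegralTerm.listSum_map_scale]
      exact h3.const_mul _
  | mem g hg =>
    obtain ⟨t, K, hK, rfl⟩ := hg
    have hK0 : (((F 0, (1 : ℕ+)) :: K).map Prod.fst).Sublist (List.ofFn F) := by
      simpa [List.ofFn_succ] using hK
    have hK1 : (K.map Prod.fst).Sublist (List.ofFn F) := by
      rw [List.ofFn_succ]
      exact hK.cons _
    have hKa := admissible_of_sublist (List.forall_mem_ofFn_iff.2 hF) hK1
    obtain ⟨T, hT, hTe⟩ := IntegralTerm.exists_const_of_sublist N A hK0 t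
    obtain ⟨σ, hσ⟩ := exists_tendsto_regularizedIntegral hN t (hF 0) hKa
    obtain ⟨Ts, hTs, τ, hτ⟩ := exists_terms_monomialPrimitive hN A hF t hK1
    refine ⟨T :: Ts.map (IntegralTerm.scale (-fourierCoeff (F 0) 0)), ?_, max 0 (max σ τ),
      fun s hs => ⟨fun u => regularizedIntegral ((F 0, s + t) :: castExponents K) u +
        -fourierCoeff (F 0) 0 * monomialPrimitive s t K u, fun u hu => ?_, ?_, ?_⟩⟩
    · refine List.forall_mem_cons.2 ⟨hT, ?_⟩
      simp only [List.forall_mem_map]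
      exact fun T hT => (hTs T hT).scale (neg_mem hA)
    · have hs0 : 0 < s.re := (le_max_left _ _).trans_lt hs
      refine ((hasDerivAt_onAxis_mul_primitive t hs0 (hF 0) hKa hu).add
        ((hasDerivAt_monomialPrimitive t hs0 hKa hu).const_mul _)).congr_deriv ?_
      simp only [axisMellinIntegrand]
      ring
    · exact (hasPowerAsymptotics_regularizedIntegral t (hF 0) hKa).add
        ((hasPowerAsymptotics_monomialPrimitive t hKa).const_mul _)
    · have h1 := hσ s (((le_max_left _ _).trans (le_max_right _ _)).trans_lt hs)
      have h2 := hτ s (((le_max_right _ _).trans (le_max_right _ _)).trans_lt hs)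
      have h3 : IntegralTerm.listSum (T :: Ts.map (IntegralTerm.scale (-fourierCoeff (F 0) 0))) N F
          s = listIteratedIntegral N ((F 0, s + t) :: castExponents K) +
            -fourierCoeff (F 0) 0 * IntegralTerm.listSum Ts N F s := by
        rw [← IntegralTerm.listSum_map_scale, ← hTe, IntegralTerm.listSum, List.map_cons,
          List.sum_cons, IntegralTerm.listSum]
      rw [h3]
      exact h1.add (h2.const_mul _)

/-! ### The integral representation -/

/-- Integrability of `φ` already gives `H` a limit at infinity, and the asymptotics make it `0`,
though the summands of `H` may diverge separately. -/
lemma integral_Ioi_eq_neg_of_tendsto {s : ℂ} (hs : 0 < s.re) {H φ : ℝ → ℂ} {ℓ : ℂ}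
    (hφ : IntegrableOn φ (Set.Ioi 0)) (hH : ∀ u > 0, HasDerivAt H (φ u) u)
    (hH' : HasPowerAsymptotics s H) (h0 : Tendsto H (𝓝[>] 0) (𝓝 ℓ)) :
    ∫ u in Set.Ioi 0, φ u = -ℓ := by
  have h1 := tendsto_limUnder_of_hasDerivAt_of_integrableOn_Ioi hH hφ
  rw [hH'.eq_zero_of_tendsto hs h1] at h1
  -- The value of `H` at `0` is unrelated to its limit there; redefining it as `ℓ` gives the
  -- one-sided continuity needed at the end point.
  have h2 : Set.EqOn (Function.update H 0 ℓ) H (Set.Ioi 0) := fun u (hu : 0 < u) =>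
    Function.update_of_ne hu.ne' _ _
  rw [integral_Ioi_of_hasDerivAt_of_tendsto (f := Function.update H 0 ℓ) (m := 0) ?_
    (fun u hu => (hH u hu).congr_of_eventuallyEq (h2.eventuallyEq_of_mem (Ioi_mem_nhds hu))) hφ
    (h1.congr' (h2.symm.eventuallyEq_of_mem (Ioi_mem_atTop 0))), Function.update_self, zero_sub]
  rwa [continuousWithinAt_update_same, Set.Ici_sdiff_left]

lemma axisMellinIntegrand_eq (h : ℝ → ℂ) (s : ℂ) {u : ℝ} (hu : 0 < u) :
    axisMellinIntegrand h s u = I ^ s * ((u : ℂ) ^ (s - 1) • h u) := by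
  rw [axisMellinIntegrand, axis_cpow_split hu, smul_eq_mul,
    show I ^ s = I ^ (s - 1) * I by
      rw [cpow_sub _ _ I_ne_zero, cpow_one]; field_simp]
  ring

lemma I_cpow_mul_mellin_eq {D H : ℝ → ℂ} {s ℓ : ℂ} (hs : 0 < s.re) (hD : MellinConvergent D s)
    (hH : ∀ u > 0, HasDerivAt H (axisMellinIntegrand D s u) u)
    (hH' : HasPowerAsymptotics s H) (h0 : Tendsto H (𝓝[>] 0) (𝓝 ℓ)) :
    I ^ s * mellin D s = -ℓ := by
  have h1 : Set.EqOn (fun u : ℝ => I ^ s * ((u : ℂ) ^ (s - 1) • D u)) (axisMellinIntegrand D s)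
    (Set.Ioi 0) := fun u hu => (axisMellinIntegrand_eq D s hu).symm
  rw [← integral_Ioi_eq_neg_of_tendsto hs
    (IntegrableOn.congr_fun (Integrable.const_mul hD (I ^ s)) h1 measurableSet_Ioi) hH hH' h0,
    ← setIntegral_congr_fun measurableSet_Ioi h1, integral_const_mul, mellin]

lemma multipleLTerm_exponents (F : Fin (n + 1) → ℍ → ℂ) (s : ℂ) (α : Fin n → ℕ+)
    (m : Fin (n + 1) → ℕ+) : multipleLTerm F (exponents s α) m =
      tailCoeff (fun j => fourierCoeff (F j)) (Fin.cons 0 fun j => (α j : ℕ)) m /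
        (totalIndex m : ℂ) ^ s := by
  rw [tailCoeff_cons_eq, multipleLTerm, Fin.prod_univ_succ, sum_Ici_zero_eq]
  simp [exponents, tailCoeff, sum_Ici_succ_eq, mul_div_right_comm]

lemma mellinConvergent_multipleExpSeries {a : Fin (n + 1) → ℕ → ℂ} (ha : PolynomiallyBounded a)
    {α : Fin (n + 1) → ℕ} {B₀ : ℕ}
    (h : ∀ B ≥ B₀, ∃ C, ∀ u > 0, ‖multipleExpSeries a α u‖ ≤ C * u ^ (-B : ℝ)) {s : ℂ}
    (hs : B₀ < s.re) : MellinConvergent (multipleExpSeries a α) s := by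
  have hO {B : ℕ} (hB : B₀ ≤ B) {l : Filter ℝ} (hl : ∀ᶠ u in l, 0 < u) :
      multipleExpSeries a α =O[l] fun u => u ^ (-B : ℝ) := by
    obtain ⟨C, hC⟩ := h B hB
    refine .of_bound C (hl.mono fun u hu => ?_)
    rw [Real.norm_of_nonneg (by positivity)]
    exact hC u hu
  obtain ⟨B, hB⟩ := exists_nat_gt s.re
  exact mellinConvergent_of_isBigO_rpow
    ((continuousOn_multipleExpSeries ha α).locallyIntegrableOn measurableSet_Ioi)
    (hO (Nat.cast_le.1 (hs.trans hB).le) (eventually_gt_atTop 0)) hB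
    (hO le_rfl self_mem_nhdsWithin) hs

lemma hasSum_mellin_multipleExpSeries {a : Fin (n + 1) → ℕ → ℂ} (ha : PolynomiallyBounded a)
    {α : Fin (n + 1) → ℕ} {s : ℂ} (hs : 0 < s.re)
    (h : Summable fun m => ‖tailCoeff a α m‖ / totalIndex m ^ s.re) :
    HasSum (fun m => Gamma s * (2 * Real.pi : ℂ) ^ (-s) *
      (tailCoeff a α m / (totalIndex m : ℂ) ^ s)) (mellin (multipleExpSeries a α) s) := by
  have hpos (m : Fin (n + 1) → ℕ+) : 0 < totalIndex m := one_pos.trans_le (one_le_totalIndex m)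
  have h1 := hasSum_mellin (p := fun m => 2 * Real.pi * totalIndex m)
    (fun m => Or.inr (mul_pos Real.two_pi_pos (hpos m))) hs
    (fun u hu => (summable_tailCoeff_mul_exp ha α hu).hasSum) ?_
  · convert! h1 using 2 with m
    have h2 : ((2 * Real.pi : ℝ) : ℂ) = 2 * Real.pi := by push_cast; rfl
    rw [ofReal_mul, mul_cpow_ofReal_nonneg Real.two_pi_pos.le (hpos m).le, h2, cpow_neg]
    ring
  · refine (h.mul_left ((2 * Real.pi) ^ (-s.re))).congr fun m => ?_
    rw [Real.mul_rpow Real.two_pi_pos.le (hpos m).le, Real.rpow_neg Real.two_pi_pos.le]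
    ring

/-- On the principal branch `log(-2πi) = log 2π - πi/2`, so `(-2πi) ^ (-s)` contributes exactly the
factor `I ^ s` produced by the substitution `z = iu`. -/
lemma neg_two_pi_I_cpow (s : ℂ) (a : ℕ) : (-2 * Real.pi * I) ^ (-(s + a)) =
    (-2 * Real.pi * I)⁻¹ ^ a * (2 * Real.pi : ℂ) ^ (-s) * I ^ s := by
  have h0 : (-2 * Real.pi * I : ℂ) ≠ 0 := by simp [Real.pi_ne_zero]
  have h1 : (-2 * Real.pi * I : ℂ) = ((2 * Real.pi : ℝ) : ℂ) * -I := by push_cast; ring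
  have h2 : (-2 * Real.pi * I : ℂ) ^ (-s) = (2 * Real.pi : ℂ) ^ (-s) * I ^ s := by
    rw [cpow_def_of_ne_zero h0, h1, log_ofReal_mul Real.two_pi_pos (neg_ne_zero.2 I_ne_zero),
      log_neg_I, cpow_def_of_ne_zero I_ne_zero, log_I, cpow_def_of_ne_zero (by simp),
      ← Complex.exp_add, ofReal_log Real.two_pi_pos.le]
    push_cast
    congr 1
    ring
  rw [neg_add, cpow_add _ _ h0, h2, cpow_neg _ (a : ℂ), cpow_natCast, inv_pow]
  ring

lemma summable_multipleLTerm {F : Fin (n + 1) → ℍ → ℂ} {α : Fin n → ℕ+} {s : ℂ}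
    (h : Summable fun m => ‖tailCoeff (fun j => fourierCoeff (F j))
      (Fin.cons 0 fun j => (α j : ℕ)) m‖ / totalIndex m ^ s.re) :
    Summable (multipleLTerm F (exponents s α)) := by
  refine .of_norm (h.congr fun m => ?_)
  rw [multipleLTerm_exponents, norm_div,
    norm_cpow_eq_rpow_re_of_pos (one_pos.trans_le (one_le_totalIndex m))]

/-- The representation of the multiple modular `L`-series by iterated integrals. -/
theorem exists_multipleLSeries_eq {N : ℕ} (hN : 0 < N) {A : Subalgebra ℚ ℂ}
    {F : Fin (n + 1) → ℍ → ℂ} (hF : ∀ j, AxisExpandable (F j))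
    (hA : ∀ j, fourierCoeff (F j) 0 ∈ A) (α : Fin n → ℕ+) :
    ∃ Ts : List (IntegralTerm n), (∀ T ∈ Ts, T.Over A) ∧ ∃ σ : ℝ, ∀ s : ℂ, σ < s.re →
      Summable (multipleLTerm F (exponents s α)) ∧
      multipleLSeries F (exponents s α) = (Gamma s)⁻¹ * IntegralTerm.listSum Ts N F s := by
  have ha := polynomiallyBounded_fourierCoeff hF
  obtain ⟨g, hg, hgD⟩ := exists_multipleExpSeries_eq A (fun j : Fin n => hF j.succ)
    (fun j => hA j.succ) α
  obtain ⟨Ts, hTs, σ, H⟩ := exists_terms_of_mem hN (fun j => (hF j).admissible) (hA 0) hg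
  obtain ⟨B₀, hB⟩ := exists_norm_multipleExpSeries_le ha
  set a := ∑ j, (α j : ℕ) with ha_def
  -- The outer minus sign comes from evaluating the primitive at the lower end point `0`, and `(-1)
  -- ^ a` from `(-2πi) ^ (-a) (2πi) ^ a`.
  refine ⟨Ts.map (IntegralTerm.scale (-(-1) ^ a)), ?_, max 0 (max σ B₀), fun s hs => ?_⟩
  · simp only [List.forall_mem_map]
    exact fun T hT => (hTs T hT).scale (neg_mem (pow_mem (neg_mem (one_mem A)) _))
  simp only [max_lt_iff] at hs
  obtain ⟨hs0, hsσ, hsB⟩ := hs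
  obtain ⟨hB1, hB2⟩ := hB (Fin.cons 0 fun j => (α j : ℕ))
  have hsum := summable_tailCoeff_div_pow_of_le hB1 hsB.le
  refine ⟨summable_multipleLTerm hsum, ?_⟩
  obtain ⟨G, hG, hG', hG0⟩ := H s hsσ
  have h1 := I_cpow_mul_mellin_eq hs0 (mellinConvergent_multipleExpSeries ha hB2 hsB)
    (fun u hu => ((hG u hu).const_mul ((2 * Real.pi * I) ^ a)).congr_deriv (by
      rw [axisMellinIntegrand, axisMellinIntegrand,
        multipleExpSeries_fourierCoeff_cons_zero hF _ hu, hgD u hu]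
      ring)) (hG'.const_mul _) (hG0.const_mul _)
  have h2 := (hasSum_mellin_multipleExpSeries ha hs0 hsum).tsum_eq
  simp only [← multipleLTerm_exponents] at h2
  rw [tsum_mul_left] at h2
  have h3 : ∑ j, exponents s α j = s + a := by
    rw [Fin.sum_univ_succ]
    simp [exponents, ha_def]
  have h4 : (-2 * Real.pi * I : ℂ)⁻¹ ^ a * (2 * Real.pi * I) ^ a = (-1) ^ a := by
    have : (Real.pi : ℂ) ≠ 0 := ofReal_ne_zero.2 Real.pi_ne_zero
    rw [← mul_pow]
    congr 1
    field_simp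
  rw [multipleLSeries, h3, neg_two_pi_I_cpow, IntegralTerm.listSum_map_scale,
    eq_inv_mul_iff_mul_eq₀ (Gamma_ne_zero_of_re_pos hs0)]
  rw [← h2] at h1
  linear_combination (-2 * Real.pi * I : ℂ)⁻¹ ^ a * h1 -
    IntegralTerm.listSum Ts N F s * h4

/-! ### Meromorphic continuation of the linear combination -/

variable {M : ℕ}

lemma IntegralTerm.listSum_eq_sum_get (Ts : List (IntegralTerm n)) (N : ℕ)
    (F : Fin (n + 1) → ℍ → ℂ) (s : ℂ) : IntegralTerm.listSum Ts N F s =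
      ∑ i, (Ts.get i).coeff s * (Ts.get i).integral N F s := by
  rw [IntegralTerm.listSum, ← List.sum_ofFn]
  congr 1
  conv_lhs => rw [← List.ofFn_get Ts, List.map_ofFn]
  rfl

lemma IntegralTerm.RegularAt.analyticAt {T : IntegralTerm n} {s : ℂ} (h : T.RegularAt N F s) :
    AnalyticAt ℂ (fun s => T.coeff s * T.integral N F s) s := by
  refine AnalyticAt.mul (AnalyticAt.div ?_ ?_ h.2) h.1
  · exact T.num.differentiable.analyticAt s
  · exact T.den.differentiable_aeval.analyticAt s

lemma IntegralTerm.meromorphicOn_coeff (T : IntegralTerm n) :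
    MeromorphicOn T.coeff Set.univ := fun s _ =>
  (T.num.differentiable.analyticAt s).meromorphicAt.div
    (T.den.differentiable_aeval.analyticAt s).meromorphicAt

/-- Since `1 / Γ` is entire, the right-hand side is meromorphic on the plane and continues the
series, so uniqueness identifies it with `multipleL` wherever all terms are regular. -/
lemma multipleL_eq_of_terms {T : Fin M → IntegralTerm n} {α : Fin n → ℕ+} {σ : ℝ}
    (hmero : ∀ i, MeromorphicOn ((T i).integral N F) Set.univ)
    (hreg : ∀ s : ℂ, σ < s.re → ∀ i, (T i).RegularAt N F s)
    (h : ∀ s : ℂ, σ < s.re → multipleLSeries F (exponents s α) =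
      (Gamma s)⁻¹ * ∑ i, (T i).coeff s * (T i).integral N F s) :
    (∀ s : ℂ, σ < s.re → multipleL F α s = multipleLSeries F (exponents s α)) ∧
    ∀ s : ℂ, (∀ i, (T i).RegularAt N F s) →
      multipleL F α s = (Gamma s)⁻¹ * ∑ i, (T i).coeff s * (T i).integral N F s := by
  set E : ℂ → ℂ := fun s => (Gamma s)⁻¹ * ∑ i, (T i).coeff s * (T i).integral N F s with hE
  have hΓ (s : ℂ) : AnalyticAt ℂ (fun s => (Gamma s)⁻¹) s :=
    differentiable_one_div_Gamma.analyticAt s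
  have hEm : MeromorphicOn E Set.univ := fun s hs =>
    (hΓ s).meromorphicAt.mul (MeromorphicAt.fun_sum fun i _ =>
      ((T i).meromorphicOn_coeff s hs).mul (hmero i s hs))
  have hEa (s : ℂ) (hs : ∀ i, (T i).RegularAt N F s) : AnalyticAt ℂ E s :=
    (hΓ s).mul (Finset.analyticAt_fun_sum _ fun i _ => (hs i).analyticAt)
  have key (s : ℂ) (hs : ∀ i, (T i).RegularAt N F s) : multipleL F α s = E s :=
    meromorphicContinuation_apply hasInteriorPoints_rightEnd hEm
      ((eventually_rightEnd σ).mono fun s hs => ⟨hEa s (hreg s hs), (h s hs).symm⟩) (hEa s hs)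
  exact ⟨fun s hs => (key s (hreg s hs)).trans (h s hs).symm, key⟩

end MultipleModular

end

/-! ### The theorem, with `A` generated by the zeroth Fourier coefficients. -/

theorem mainTheorem2 (N : ℕ) (hN : 0 < N) (n : ℕ) (k : Fin (n + 1) → ℤ)
    (χ : Fin (n + 1) → DirichletCharacter ℂ N)
    (f : ∀ j : Fin (n + 1),
      ModularForm (CongruenceSubgroup.Gamma1 N : Subgroup (GL (Fin 2) ℝ)) (k j))
    (hf : ∀ j, MultipleModular.HasNebentypus N (χ j) (f j))
    (α : Fin n → ℕ+) :
    ∃ (M : ℕ) (T : Fin M → MultipleModular.IntegralTerm n),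
      -- the coefficients are rational functions of `s` over `ℚ[a₀⁽¹⁾, …, a₀⁽ⁿ⁺¹⁾]`
      (∀ i d, (T i).num.coeff d ∈
        Algebra.adjoin ℚ (Set.range fun j => MultipleModular.fourierCoeff (f j) 0)) ∧
      -- the iterated integrals are meromorphic functions of `s ∈ ℂ`
      (∀ i, MeromorphicOn ((T i).integral N fun j => f j) Set.univ) ∧
      -- for `Re s` large the `L`-series converges and no term has a pole
      (∃ σ : ℝ, ∀ s : ℂ, σ < s.re →
        Summable (MultipleModular.multipleLTerm (fun j => f j) (MultipleModular.exponents s α)) ∧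
        MultipleModular.multipleL (fun j => f j) α s =
          MultipleModular.multipleLSeries (fun j => f j) (MultipleModular.exponents s α) ∧
        ∀ i, (T i).RegularAt N (fun j => f j) s) ∧
      -- the `L`-function is the linear combination
      ∀ s : ℂ, (∀ i, (T i).RegularAt N (fun j => f j) s) →
        MultipleModular.multipleL (fun j => f j) α s =
          (Complex.Gamma s)⁻¹ *
            ∑ i, (T i).coeff s * (T i).integral N (fun j => f j) s := by
  have hF (j : Fin (n + 1)) := MultipleModular.axisExpandable_of_modularForm hN (f j)
  obtain ⟨Ts, hTs, σ, H⟩ := MultipleModular.exists_multipleLSeries_eq hN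
    (A := Algebra.adjoin ℚ (Set.range fun j => MultipleModular.fourierCoeff (f j) 0)) hF
    (fun j => Algebra.subset_adjoin ⟨j, rfl⟩) α
  have hmem (i) : Ts.get i ∈ Ts := List.get_mem Ts i
  choose τ hτ using fun i => (Ts.get i).exists_analyticAt_integral hN fun j => (hF j).admissible
  obtain ⟨τ₀, hτ₀⟩ := (Finset.univ.image τ).exists_le
  have hmero (i) := (Ts.get i).meromorphicOn_integral hN fun j => (hF j).admissible
  -- The bound `0` keeps the denominators nonzero, `σ` gives the series identity, and `τ₀` makes all
  -- the integrals holomorphic.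
  have hreg (s : ℂ) (hs : max (max 0 σ) τ₀ < s.re) (i) :
      (Ts.get i).RegularAt N (fun j => f j) s := by
    simp only [max_lt_iff] at hs
    exact ⟨hτ i s ((hτ₀ _ (Finset.mem_image_of_mem τ (Finset.mem_univ i))).trans_lt hs.2),
      (hTs _ (hmem i)).2 s hs.1.1⟩
  obtain ⟨h1, h2⟩ := MultipleModular.multipleL_eq_of_terms (T := Ts.get) hmero hreg
    fun s hs => by
      rw [(H s ((le_max_right _ _).trans_lt ((le_max_left _ _).trans_lt hs))).2,
        MultipleModular.IntegralTerm.listSum_eq_sum_get]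
  refine ⟨Ts.length, Ts.get, fun i => (hTs _ (hmem i)).1, hmero,
    ⟨max (max 0 σ) τ₀, fun s hs => ⟨?_, h1 s hs, hreg s hs⟩⟩, h2⟩
  exact (H s ((le_max_right _ _).trans_lt ((le_max_left _ _).trans_lt hs))).1
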